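/- Work on $\mathbb R^4$. Let $\dot H^1=\dot H^1(\mathbb R^4)$ be the space of $u\in L^4$ with distributional gradient in $L^2$, normed by $\|\nabla u\|_{L^2}$. For $a=(a_1,\dots,a_4)$, $A_x=(A_1,\dots,A_4)$ real valued and $f,\phi$ complex valued write $D_j\phi=\partial_j\phi+iA_j\phi$, $D_t\phi=\partial_t\phi+iA_0\phi$, $J_\alpha=-\mathrm{Im}(\phi\,\overline{D_\alpha\phi})$. All quantities are at time $0$. A gauge covariant data set is a tuple $(a,e,f,g)\in \dot H^1\times L^2\times\dot H^1\times L^2$ ($a,e$ real $4$-vectors, $f,g$ complex), with energy $$\mathcal E[a,e,f,g]=\int_{\mathbb R^4}\tfrac12\sum_j e_j^2+\tfrac14\sum_{j,k}(\partial_ja_k-\partial_ka_j)^2+\tfrac12|g|^2+\tfrac12\sum_j|\partial_jf+ia_jf|^2\,dx .$$ It is a (finite energy) Coulomb data set if $\sum_\ell\partial_\ell a_\ell=0$ and $\sum_\ell\partial_\ell e_\ell=\mathrm{Im}(f\bar g)$. For $(A_x[0],\phi[0])=(A_x,\partial_tA_x,\phi,\partial_t\phi)\in \dot H^1\times L^2\times\dot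 H^1\times L^2$ let $$E_{lin}(A_x[0],\phi[0])=\tfrac12\int_{\mathbb R^4}\sum_{j=1}^4\sum_{\mu=0}^4|\partial_\mu A_j|^2+\sum_{\mu=0}^4|\partial_\mu\phi|^2\,dx ,$$ where $\partial_0=\partial_t$; it is called Coulomb if $\sum_\ell\partial_\ell A_\ell=0=\sum_\ell\partial_\ell\partial_tA_\ell$. Given $A_0\in\dot H^1$, the gauge covariant data of $(A_x[0],\phi[0],A_0)$ are $(A_x,F_{0x},\phi,D_t\phi)$ with $F_{0j}=\partial_tA_j-\partial_jA_0$, and $\mathcal E[A,\phi]$ is their energy. Consider, in the sense of distributions, the equations $$\Delta A_0=J_0,\qquad \Delta\,\partial_tA_0=\sum_{i}\partial_iJ_i, \tag{$*$}$$ the first being equivalent to $(-\Delta+|\phi|^2)A_0=\mathrm{Im}(\phi\,\overline{\partial_t\phi})$. **Proposition.** 1. There is an absolute constant $C>0$ such that every Coulomb data set $(a,e,f,g)$ is the gauge covariant data $(A_x,F_{0x},\phi,D_t\phi)$ of a unique pair consisting of Coulomb $(A_x[0],\phi[0])\in\dot H^1\times L^2$ and $A_0\in\dot H^1$ with $\Delta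 A_0=J_0$; and $E_{lin}(A_x[0],\phi[0])\le C(\mathcal E[A,\phi]+\mathcal E[A,\phi]^2)$. 2. Conversely, for every $(A_x[0],\phi[0])\in\dot H^1\times L^2$ there is a unique solution $(A_0,\partial_tA_0)\in\dot H^1\times L^2$ of $(*)$. The map $(A_x[0],\phi[0])\mapsto(A_0,\partial_tA_0)$ is $C^\infty$ in these topologies, $\mathcal E[A,\phi]$ is a $C^\infty$ function of $(A_x[0],\phi[0])$, and $\mathcal E[A,\phi]\le C(E_{lin}(A_x[0],\phi[0])+E_{lin}(A_x[0],\phi[0])^2)$ with an absolute constant $C>0$. 3. Let $m:\mathbb R\to\mathbb R$ be a smooth cutoff with $m(r)=1$ for $r\le1$ and $m(r)=0$ for $r\ge2$, and let $P_k$, $k\in\mathbb Z$, be the Littlewood–Paley projection with symbol $m(|\xi|/2^k)-m(|\xi|/2^{k-1})$. For every $E$ there are $\epsilon_0>0$ and $C>0$ (depending only on $E$ and $m$) such that, if $(A_x[0],\phi[0])\in\dot H^1\times L^2$ is Coulomb, $A_0\in\dot H^1$ solves $\Delta A_0=J_0$, $\mathcal E[A,\phi]\le E$, $0<\epsilon\le\epsilon_0$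 and $$\sup_{k\in\mathbb Z}2^{-k}\max\big(\|P_k\phi\|_{L^\infty},\,2^{-k}\|P_k\partial_t\phi\|_{L^\infty}\big)\le\epsilon ,$$ then $|\mathcal E[A,\phi]-E_{lin}(A_x[0],\phi[0])|\le C\epsilon^{1/4}$. -/

import Mathlib

noncomputable section

namespace MKG

open MeasureTheory
open scoped ContDiff ENNReal FourierTransform Laplacian

/-- Space `ℝ⁴`. -/
abbrev R4 : Type := EuclideanSpace ℝ (Fin 4)

instance holderTripleFourFourTwo : ENNReal.HolderTriple 4 4 2 where
  inv_add_inv_eq_inv := by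
    have h4 : (4 : ℝ≥0∞) = 2 * 2 := by norm_num
    rw [h4, ENNReal.mul_inv (by simp) (by simp), ← two_mul, ← mul_assoc,
      ENNReal.mul_inv_cancel (by simp) (by simp), one_mul]

instance factOneLeFour : Fact ((1 : ℝ≥0∞) ≤ 4) := ⟨by norm_num⟩

/-- `L²(ℝ⁴; F)`. -/
abbrev L2 (F : Type) [NormedAddCommGroup F] : Type := Lp F 2 (volume : Measure R4)

/-- `L⁴(ℝ⁴; F)`. -/
abbrev L4 (F : Type) [NormedAddCommGroup F] : Type := Lp F 4 (volume : Measure R4)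

/-- Real test functions on `ℝ⁴`. -/
def IsTest (η : R4 → ℝ) : Prop := ContDiff ℝ ∞ η ∧ HasCompactSupport η

/-- The classical partial derivative `∂_j η` of a test function. -/
def pd (j : Fin 4) (η : R4 → ℝ) (x : R4) : ℝ := fderiv ℝ η x (EuclideanSpace.single j 1)

section Sobolev

variable {F : Type} [NormedAddCommGroup F] [NormedSpace ℝ F]

/-- `g` is the `j`-th distributional partial derivative of `u`. -/
def IsWeakPartial (j : Fin 4) (u g : R4 → F) : Prop :=
  ∀ η : R4 → ℝ, IsTest η → ∫ x, pd j η x • u x = - ∫ x, η x • g x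

lemma IsTest.pd_isTest {η : R4 → ℝ} (h : IsTest η) (j : Fin 4) : IsTest (pd j η) :=
  ⟨(h.1.fderiv_right (m := ∞) (by simp)).clm_apply contDiff_const, h.2.fderiv_apply (𝕜 := ℝ) _⟩

lemma integrable_test_smul {η : R4 → ℝ} (h : IsTest η) {p : ℝ≥0∞} (hp : 1 ≤ p)
    (u : Lp F p (volume : Measure R4)) : Integrable (fun x => η x • u x) :=
  ((Lp.memLp u).locallyIntegrable hp).integrable_smul_left_of_hasCompactSupport
    h.1.continuous h.2

lemma integral_test_add {η : R4 → ℝ} (h : IsTest η) {p : ℝ≥0∞} (hp : 1 ≤ p)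
    (u v : Lp F p (volume : Measure R4)) :
    ∫ x, η x • (u + v : Lp F p (volume : Measure R4)) x
      = (∫ x, η x • u x) + ∫ x, η x • v x := by
  rw [← integral_add (integrable_test_smul h hp u) (integrable_test_smul h hp v)]
  refine integral_congr_ae ?_
  filter_upwards [Lp.coeFn_add u v] with x hx
  rw [hx, Pi.add_apply, smul_add]

lemma integral_test_smul (η : R4 → ℝ) {p : ℝ≥0∞} (c : ℝ)
    (u : Lp F p (volume : Measure R4)) :
    ∫ x, η x • (c • u : Lp F p (volume : Measure R4)) x = c • ∫ x, η x • u x := by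
  rw [← integral_smul]
  refine integral_congr_ae ?_
  filter_upwards [Lp.coeFn_smul c u] with x hx
  rw [hx, Pi.smul_apply, smul_comm]

lemma integral_test_zero (η : R4 → ℝ) {p : ℝ≥0∞} :
    ∫ x, η x • (0 : Lp F p (volume : Measure R4)) x = 0 := by
  refine integral_eq_zero_of_ae ?_
  filter_upwards [Lp.coeFn_zero F p (volume : Measure R4)] with x hx
  rw [hx, Pi.zero_apply, smul_zero]

/-- Pairs `(u, ∇u)` with `u ∈ L⁴` whose distributional gradient is in `L²`. -/
def hdot1Graph (F : Type) [NormedAddCommGroup F] [NormedSpace ℝ F] :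
    Submodule ℝ (L4 F × (Fin 4 → L2 F)) where
  carrier := {p | ∀ j, IsWeakPartial j p.1 (p.2 j)}
  zero_mem' := by
    intro j η _
    exact (integral_test_zero (F := F) (p := 4) (pd j η)).trans
      ((neg_eq_zero.2 (integral_test_zero (F := F) (p := 2) η)).symm)
  add_mem' := by
    intro p q hp hq j η hη
    have h1 := integral_test_add (F := F) (hη.pd_isTest j) (p := 4) (by norm_num) p.1 q.1
    have h2 := integral_test_add (F := F) hη (p := 2) (by norm_num) (p.2 j) (q.2 j)
    have := hp j η hη
    have := hq j η hη
    change ∫ x, pd j η x • (p.1 + q.1 : L4 F) x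
      = - ∫ x, η x • (p.2 j + q.2 j : L2 F) x
    rw [h1, h2, hp j η hη, hq j η hη, neg_add]
  smul_mem' := by
    intro c p hp j η hη
    change ∫ x, pd j η x • (c • p.1 : L4 F) x = - ∫ x, η x • (c • p.2 j : L2 F) x
    rw [integral_test_smul, integral_test_smul, hp j η hη, smul_neg]

/-- A function in `L⁴(ℝ⁴)` with vanishing distributional gradient is zero. -/
lemma eq_zero_of_weakPartial_zero [CompleteSpace F] (u : L4 F) (hu : ∀ j η, IsTest η →
    ∫ x, pd j η x • u x = 0) : u = 0 := by
  have hloc : LocallyIntegrable u (volume : Measure R4) :=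
    (Lp.memLp u).locallyIntegrable (by norm_num)
  -- for a test function `η`, the function `x ↦ ∫ η (x - y) u(y) dy` has zero gradient
  have hconst : ∀ η : R4 → ℝ, IsTest η → ∀ x : R4,
      (convolution η u (ContinuousLinearMap.lsmul ℝ ℝ) volume) x
        = (convolution η u (ContinuousLinearMap.lsmul ℝ ℝ) volume) 0 := by
    intro η hη x
    have hd : ∀ z, HasFDerivAt (convolution η u (ContinuousLinearMap.lsmul ℝ ℝ) volume)
        ((convolution (fderiv ℝ η) u
          ((ContinuousLinearMap.lsmul ℝ ℝ).precompL R4) volume) z) z := fun z =>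
      hη.2.hasFDerivAt_convolution_left _ (hη.1.of_le (by exact_mod_cast le_top)) hloc z
    refine is_const_of_fderiv_eq_zero (𝕜 := ℝ) (fun z => (hd z).differentiableAt) (fun z => ?_) x 0
    rw [(hd z).fderiv]
    have hint : Integrable (fun y => ((ContinuousLinearMap.lsmul ℝ ℝ (E := F)).precompL R4)
        (fderiv ℝ η y) (u (z - y))) :=
      (HasCompactSupport.convolutionExists_left _ (hη.2.fderiv (𝕜 := ℝ))
        (hη.1.continuous_fderiv (by simp)) hloc z)
    have hj : ∀ j : Fin 4, ((convolution (fderiv ℝ η) u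
          ((ContinuousLinearMap.lsmul ℝ ℝ).precompL R4) volume) z)
          (EuclideanSpace.single j (1 : ℝ)) = 0 := by
      intro j
      rw [convolution_def, ContinuousLinearMap.integral_apply hint]
      simp only [ContinuousLinearMap.precompL_apply, ContinuousLinearMap.lsmul_apply]
      have hη' : IsTest (fun y => η (z - y)) :=
        ⟨hη.1.comp (contDiff_const.sub contDiff_id),
          hη.2.comp_homeomorph (Homeomorph.subLeft z)⟩
      have := hu j _ hη'
      rw [← integral_sub_left_eq_self _ _ z]
      simp only [sub_sub_cancel]
      rw [← neg_eq_zero, ← integral_neg, ← this]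
      refine integral_congr_ae (Filter.Eventually.of_forall fun y => ?_)
      have hc : fderiv ℝ (fun y => η (z - y)) y = - fderiv ℝ η (z - y) := by
        have h1 : HasFDerivAt η (fderiv ℝ η (z - y)) (z - y) :=
          (hη.1.differentiable (by simp) _).hasFDerivAt
        have h2 := h1.comp y ((hasFDerivAt_id y).const_sub z)
        have h3 := h2.fderiv
        simp only [Function.comp_def] at h3
        rw [h3]; ext v; simp
      simp [pd, hc]
    ext v
    have hv : v = ∑ j, v j • (EuclideanSpace.single j (1 : ℝ) : R4) := by
      ext i; simp [Finset.sum_apply, Pi.single_apply]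
    rw [hv, map_sum]
    simp [hj]
  -- and it vanishes at infinity
  have hzero : ∀ η : R4 → ℝ, IsTest η →
      (convolution η u (ContinuousLinearMap.lsmul ℝ ℝ) volume) 0 = 0 := by
    intro η hη
    by_contra hne
    set c := (convolution η u (ContinuousLinearMap.lsmul ℝ ℝ) volume) 0 with hc
    have hq : ENNReal.HolderTriple (1 - (4 : ℝ≥0∞)⁻¹)⁻¹ 4 1 := ⟨by
      rw [inv_inv, inv_one]; exact tsub_add_cancel_of_le (by simp)⟩
    set q : ℝ≥0∞ := (1 - (4 : ℝ≥0∞)⁻¹)⁻¹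
    have hηq : MemLp η q (volume : Measure R4) := hη.1.continuous.memLp_of_hasCompactSupport hη.2
    have hbound : ∀ ε : ℝ≥0∞, ε ≠ 0 → ‖c‖ₑ ≤ eLpNorm η q volume * ε := by
      intro ε hε
      obtain ⟨g, hgs, hgε, hgc, hg4⟩ :=
        (Lp.memLp u).exists_hasCompactSupport_eLpNorm_sub_le (by norm_num) hε
      obtain ⟨R1, hR1⟩ := (show IsCompact (tsupport g) from hgs).isBounded.subset_closedBall 0
      obtain ⟨R2, hR2⟩ := (show IsCompact (tsupport η) from hη.2).isBounded.subset_closedBall 0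
      set x : R4 := EuclideanSpace.single 0 (|R1| + |R2| + 1)
      have hx : ‖x‖ = |R1| + |R2| + 1 := by
        rw [PiLp.norm_single, Real.norm_eq_abs, abs_of_pos (by positivity)]
      have hprod : ∀ t, η t • g (x - t) = 0 := by
        intro t
        by_contra h
        have h1 : t ∈ tsupport η := subset_tsupport _ (fun h0 => h (by simp [h0]))
        have h2 : x - t ∈ tsupport g := subset_tsupport _ (fun h0 => h (by simp [h0]))
        have h3 := hR2 h1
        have h4 := hR1 h2
        rw [mem_closedBall_zero_iff] at h3 h4
        have h5 : ‖x‖ ≤ ‖x - t‖ + ‖t‖ := by simpa using norm_add_le (x - t) t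
        linarith [le_abs_self R1, le_abs_self R2]
      have hcx : c = ∫ t, η t • ((u : R4 → F) - g) (x - t) := by
        rw [hc, ← hconst η hη x, convolution_def]
        refine integral_congr_ae (Filter.Eventually.of_forall fun t => ?_)
        simp [smul_sub, hprod t]
      have hmp : MeasurePreserving (fun t : R4 => x - t) volume volume :=
        volume.measurePreserving_sub_left x
      have hw : AEStronglyMeasurable ((u : R4 → F) - g) (volume : Measure R4) :=
        (Lp.aestronglyMeasurable u).sub hgc.aestronglyMeasurable
      calc ‖c‖ₑ ≤ ∫⁻ t, ‖η t • ((u : R4 → F) - g) (x - t)‖ₑ := by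
            rw [hcx]; exact enorm_integral_le_lintegral_enorm _
        _ = eLpNorm (η • (((u : R4 → F) - g) ∘ fun t => x - t)) 1 volume := by
            rw [eLpNorm_one_eq_lintegral_enorm]; rfl
        _ ≤ eLpNorm η q volume * eLpNorm (((u : R4 → F) - g) ∘ fun t => x - t) 4 volume :=
            eLpNorm_smul_le_mul_eLpNorm (hw.comp_measurePreserving hmp) hηq.1
        _ = eLpNorm η q volume * eLpNorm ((u : R4 → F) - g) 4 volume := by
            rw [eLpNorm_comp_measurePreserving hw hmp]
        _ ≤ eLpNorm η q volume * ε := by gcongr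
    have hpos : 0 < ‖c‖ₑ := by simpa using hne
    have hM : eLpNorm η q volume ≠ ⊤ := hηq.2.ne
    obtain ⟨ε, hε0, hε⟩ := ENNReal.exists_pos_mul_lt hM hpos.ne'
    rw [mul_comm] at hε
    exact absurd (hbound ε hε0.ne') (not_le.2 hε)
  have hae : ∀ᵐ x ∂(volume : Measure R4), u x = 0 := by
    refine ae_eq_zero_of_integral_contDiff_smul_eq_zero hloc fun η h1 h2 => ?_
    have h := hzero (fun y => η (-y)) ⟨h1.comp contDiff_neg, h2.comp_homeomorph (Homeomorph.neg R4)⟩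
    rw [convolution_def, ← integral_neg_eq_self] at h
    simpa using h
  exact (Lp.eq_zero_iff_ae_eq_zero).2 hae

end Sobolev

/-- The homogeneous Sobolev space `Ḣ¹(ℝ⁴; F)`, realized as the space of functions `u ∈ L⁴`
whose distributional gradient is in `L²`; it is normed by `‖∇u‖_{L²}`. -/
def HDot1 (F : Type) [NormedAddCommGroup F] [NormedSpace ℝ F] : Type := hdot1Graph F

namespace HDot1

variable {F : Type} [NormedAddCommGroup F] [NormedSpace ℝ F]

instance : AddCommGroup (HDot1 F) := inferInstanceAs (AddCommGroup (hdot1Graph F))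
instance : Module ℝ (HDot1 F) := inferInstanceAs (Module ℝ (hdot1Graph F))

/-- The function underlying an element of `Ḣ¹`. -/
def fn (u : HDot1 F) : L4 F := u.1.1

/-- The distributional partial derivative `∂_j u ∈ L²`. -/
def D (u : HDot1 F) (j : Fin 4) : L2 F := u.1.2 j

lemma isWeakPartial (u : HDot1 F) (j : Fin 4) : IsWeakPartial j u.fn (u.D j) := u.2 j

/-- The gradient `u ↦ ∇u`, with values in the Hilbert sum of four copies of `L²`. -/
def gradL (F : Type) [NormedAddCommGroup F] [NormedSpace ℝ F] :
    HDot1 F →ₗ[ℝ] PiLp 2 (fun _ : Fin 4 => L2 F) where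
  toFun u := WithLp.toLp 2 u.D
  map_add' _ _ := rfl
  map_smul' _ _ := rfl

lemma gradL_injective [CompleteSpace F] : Function.Injective (gradL F) := by
  rw [injective_iff_map_eq_zero]
  intro u hu
  have hD : ∀ j, u.D j = 0 := fun j => congrFun (congrArg WithLp.ofLp hu) j
  have h0 : u.fn = 0 := by
    refine eq_zero_of_weakPartial_zero _ fun j η hη => ?_
    rw [u.isWeakPartial j η hη, hD j, integral_test_zero, neg_zero]
  exact Subtype.ext (Prod.ext h0 (funext hD))

/-- The norm of `Ḣ¹` is `‖u‖ = (∑_j ‖∂_j u‖²_{L²})^{1/2}`. -/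
instance [CompleteSpace F] : NormedAddCommGroup (HDot1 F) :=
  NormedAddCommGroup.induced (HDot1 F) (PiLp 2 (fun _ : Fin 4 => L2 F)) (gradL F) gradL_injective

instance [CompleteSpace F] : NormedSpace ℝ (HDot1 F) :=
  NormedSpace.induced ℝ (HDot1 F) (PiLp 2 (fun _ : Fin 4 => L2 F)) (gradL F)

lemma norm_sq_eq [CompleteSpace F] (u : HDot1 F) : ‖u‖ ^ 2 = ∑ j, ‖u.D j‖ ^ 2 :=
  PiLp.norm_sq_eq_of_L2 (fun _ : Fin 4 => L2 F) (WithLp.toLp 2 u.D)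

end HDot1

/-- The product `i a f` of `a ∈ L⁴(ℝ⁴; ℝ)` and `f ∈ L⁴(ℝ⁴; ℂ)`, an element of `L²(ℝ⁴; ℂ)`. -/
def iMul (a : L4 ℝ) (f : L4 ℂ) : L2 ℂ :=
  MemLp.toLp (fun x => Complex.I * ((a x : ℂ) * f x))
    ((MemLp.mul' (p := 4) (q := 4) (r := 2) (Lp.memLp f) (Lp.memLp a).ofReal).const_mul Complex.I)

/-- The initial data `(A_x[0], φ[0]) = (A_x, ∂ₜA_x, φ, ∂ₜφ)(0)` in `Ḣ¹ × L²`. -/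
abbrev LinData : Type := (Fin 4 → HDot1 ℝ) × (Fin 4 → L2 ℝ) × HDot1 ℂ × L2 ℂ

/-- `A_x(0)`. -/
abbrev LinData.A (U : LinData) : Fin 4 → HDot1 ℝ := U.1
/-- `∂ₜA_x(0)`. -/
abbrev LinData.At (U : LinData) : Fin 4 → L2 ℝ := U.2.1
/-- `φ(0)`. -/
abbrev LinData.φ (U : LinData) : HDot1 ℂ := U.2.2.1
/-- `∂ₜφ(0)`. -/
abbrev LinData.φt (U : LinData) : L2 ℂ := U.2.2.2

/-- Gauge covariant data `(a, e, f, g) = (A_x, F_{0x}, φ, D_tφ)(0)` in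
`ℋ¹ = Ḣ¹ × L² × Ḣ¹ × L²`. -/
abbrev CovData : Type := (Fin 4 → HDot1 ℝ) × (Fin 4 → L2 ℝ) × HDot1 ℂ × L2 ℂ

/-- `a_j = A_j(0)`. -/
abbrev CovData.a (d : CovData) : Fin 4 → HDot1 ℝ := d.1
/-- `e_j = F_{0j}(0)`. -/
abbrev CovData.e (d : CovData) : Fin 4 → L2 ℝ := d.2.1
/-- `f = φ(0)`. -/
abbrev CovData.f (d : CovData) : HDot1 ℂ := d.2.2.1
/-- `g = D_tφ(0)`. -/
abbrev CovData.g (d : CovData) : L2 ℂ := d.2.2.2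

/-- `∑_ℓ ∂_ℓ V_ℓ = w` in the sense of distributions. -/
def HasWeakDiv (V : Fin 4 → R4 → ℝ) (w : R4 → ℝ) : Prop :=
  ∀ η : R4 → ℝ, IsTest η → ∑ l, ∫ x, pd l η x * V l x = - ∫ x, η x * w x

/-- `Δ v = w` in the sense of distributions. -/
def HasWeakLaplacian (v w : R4 → ℝ) : Prop :=
  ∀ η : R4 → ℝ, IsTest η → ∫ x, (Δ η) x * v x = ∫ x, η x * w x

/-- `Δ v = ∑_ℓ ∂_ℓ W_ℓ` in the sense of distributions. -/
def HasWeakLaplacianDiv (v : R4 → ℝ) (W : Fin 4 → R4 → ℝ) : Prop :=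
  ∀ η : R4 → ℝ, IsTest η → ∫ x, (Δ η) x * v x = - ∑ l, ∫ x, pd l η x * W l x

/-- The current `J_α = - Im (φ \overline{D_α φ})`, as a function of `φ` and `D_α φ`. -/
def current (φ Dφ : R4 → ℂ) (x : R4) : ℝ := - (φ x * (starRingEnd ℂ) (Dφ x)).im

/-- The spatial covariant derivative `D_j φ = ∂_j φ + i A_j φ`. -/
def covD (A : Fin 4 → HDot1 ℝ) (φ : HDot1 ℂ) (j : Fin 4) : L2 ℂ :=
  φ.D j + iMul (A j).fn φ.fn

/-- The temporal covariant derivative `D_t φ = ∂ₜφ + i A₀ φ` at time `0`. -/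
def covDt (U : LinData) (A0 : HDot1 ℝ) : L2 ℂ := U.φt + iMul A0.fn U.φ.fn

/-- The gauge covariant data `(A_x, F_{0x}, φ, D_tφ)(0)` determined by `(A_x[0], φ[0])` and
`A₀(0)`, where `F_{0j} = ∂ₜA_j - ∂_j A₀`. -/
def toCovData (U : LinData) (A0 : HDot1 ℝ) : CovData :=
  (U.A, fun j => U.At j - A0.D j, U.φ, covDt U A0)

/-- The Coulomb condition `∂^ℓ A_ℓ = 0` on `A_x[0] = (A_x, ∂ₜA_x)(0)`. -/
def LinData.IsCoulomb (U : LinData) : Prop :=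
  HasWeakDiv (fun l => (U.A l).fn) 0 ∧ HasWeakDiv (fun l => U.At l) 0

/-- `(a, e, f, g)` is a Coulomb initial data set: `∂^ℓ a_ℓ = 0` and the Gauss equation
`∂^ℓ e_ℓ = Im (f \overline{g})` holds. -/
def CovData.IsCoulombDataSet (d : CovData) : Prop :=
  HasWeakDiv (fun l => (d.a l).fn) 0 ∧
    HasWeakDiv (fun l => d.e l) (fun x => (d.f.fn x * (starRingEnd ℂ) (d.g x)).im)

/-- `A₀` solves `Δ A₀ = J₀`, where `J₀ = - Im (φ \overline{D_tφ})` with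
`D_tφ = ∂ₜφ + i A₀ φ`. -/
def SolvesA0 (U : LinData) (A0 : HDot1 ℝ) : Prop :=
  HasWeakLaplacian A0.fn (current U.φ.fn (covDt U A0))

/-- `B = ∂ₜA₀` solves `Δ ∂ₜA₀ = ∂^i J_i`, where `J_i = - Im (φ \overline{D_iφ})`. -/
def SolvesDtA0 (U : LinData) (B : L2 ℝ) : Prop :=
  HasWeakLaplacianDiv B (fun i => current U.φ.fn (covD U.A U.φ i))

/-- The energy `∫ ¼ ∑_{α,β} F_{αβ}² + ½ ∑_α |D_αφ|²` of a gauge covariant data set. The pairs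
`(0, j)` and `(j, 0)` contribute `½ ∑_j e_j²` to the first sum; `‖·‖` is the norm of `L²`. -/
def energy (d : CovData) : ℝ :=
  (1 / 2) * ∑ j, ‖d.e j‖ ^ 2 + (1 / 4) * ∑ j, ∑ k, ‖(d.a k).D j - (d.a j).D k‖ ^ 2
    + (1 / 2) * (‖d.g‖ ^ 2 + ∑ j, ‖covD d.a d.f j‖ ^ 2)

/-- The linear energy
`½ ∫ ∑_{μ,j} |∂_μ A_j|² + ∑_μ |∂_μ φ|²`; `‖·‖` is the norm of `L²`. -/
def linEnergy (U : LinData) : ℝ :=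
  (1 / 2) * (∑ j, (‖U.At j‖ ^ 2 + ∑ k, ‖(U.A j).D k‖ ^ 2)
    + (‖U.φt‖ ^ 2 + ∑ k, ‖U.φ.D k‖ ^ 2))

/-- `m` is a smooth cutoff which equals `1` on `{r ≤ 1}` and vanishes on `{r ≥ 2}`. -/
def IsCutoff (m : ℝ → ℝ) : Prop :=
  ContDiff ℝ ∞ m ∧ (∀ r ≤ 1, m r = 1) ∧ ∀ r, 2 ≤ r → m r = 0

/-- The convolution kernel of the Littlewood-Paley projection `P_k`: the inverse Fourier
transform of `m_k(|ξ|) = m(|ξ|/2^k) - m(|ξ|/2^{k-1})`. The Fourier transform used here has phase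
`e^{2πi⟨x,ζ⟩}`, so that `ξ = 2πζ`. -/
def lpKernel (m : ℝ → ℝ) (k : ℤ) : R4 → ℂ :=
  𝓕⁻ (fun ζ : R4 =>
    ((m (2 * Real.pi * ‖ζ‖ / 2 ^ k) - m (2 * Real.pi * ‖ζ‖ / 2 ^ (k - 1)) : ℝ) : ℂ))

/-- The Littlewood-Paley projection `P_k u`, as convolution with the (Schwartz) kernel. -/
def lpProj (m : ℝ → ℝ) (k : ℤ) (u : R4 → ℂ) (x : R4) : ℂ := ∫ y, lpKernel m k (x - y) * u y

/-- The fixed time energy dispersion norm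
`sup_k 2^{-k} ‖(P_k φ, 2^{-k} P_k ∂ₜφ)‖_{L^∞}`. -/
def edNorm (m : ℝ → ℝ) (U : LinData) : ℝ≥0∞ :=
  ⨆ k : ℤ, ENNReal.ofReal (2 ^ (-k)) *
    max (eLpNorm (lpProj m k U.φ.fn) ⊤ volume)
      (ENNReal.ofReal (2 ^ (-k)) * eLpNorm (lpProj m k U.φt) ⊤ volume)

end MKG

end

noncomputable section

namespace MKG

open MeasureTheory Filter
open scoped ContDiff ENNReal NNReal FourierTransform Laplacian Topology SchwartzMap

/-! Everything is reduced to operators on Hilbert spaces. With the inner product ⟨u, v⟩ = ∑ ⟨∂_j u,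
∂_j v⟩ the space Ḣ¹ is a Hilbert space in which test functions are dense: if u is orthogonal to all
of them, each ∂_k u is a weakly harmonic L² function, hence zero by a Caccioppoli argument. Density
carries the Sobolev inequality ‖u‖_{L⁴} ≤ C‖∇u‖ from test functions to Ḣ¹, so that M_φ h = i h φ is
bounded from Ḣ¹ to L² (`mulOp`).

Since -Δ is the Riesz map of Ḣ¹ and J is the pairing of M_φ with D φ, ΔA₀ = J₀ says A₀ = -M_φ* D_tφ,
that is (1 + M_φ* M_φ) A₀ = -M_φ* ∂ₜφ. The operator on the left is coercive, so A₀ exists, is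
unique, and depends smoothly on the data because inversion is smooth. Likewise ∂ₜA₀ = -∑ ∂_l M_φ*
D_lφ, with uniqueness from the L² Liouville theorem. If instead D_tφ = g is prescribed, A₀ = -M_f* g
is explicit, and ∂ₜA = e + ∇A₀ and ∂ₜφ = g - M_f A₀ are forced; the Gauss equation is what makes ∂ₜA
divergence free.

In Coulomb gauge ∂ₜA ⊥ ∇A₀ and the curl of A carries all of ‖∇A‖, so the energy controls A, ∂ₜA and
A₀ exactly. For φ the diamagnetic inequality |∂_j|φ|| ≤ |D_jφ| bounds ‖φ‖_{L⁴} by ‖Dφ‖, and then ∇φ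
= Dφ - iAφ is controlled (`exists_linEnergy_le`).

The difference of the two energies consists of terms containing a factor M_φ, hence a factor
‖φ‖_{L⁴} (`exists_energy_sub_linEnergy_le`). This norm is small by the refined Sobolev inequality
‖φ‖⁴_{L⁴} ≤ K ε² ‖∇φ‖² (`IsCutoff.exists_norm_fn_pow_four_le`): with S_k the low frequency
projection, |S_kφ| ≤ 2·2^k ε by telescoping, so at the scale 2^k ~ |φ(x)|/(4ε) the high part φ -
S_kφ makes up at least half of φ(x), and ∑ 4^k ‖φ - S_kφ‖² ≤ K‖∇φ‖² by Plancherel. -/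

/-- The `j`-th vector of the standard basis of `ℝ⁴`. -/
abbrev e4 (j : Fin 4) : R4 := EuclideanSpace.single j 1

/-! ### Test functions and integration by parts -/

section TestFunctions

variable {F : Type} [NormedAddCommGroup F] [NormedSpace ℝ F]

/-- Vector valued test functions on `ℝ⁴`. -/
def IsTestFun (f : R4 → F) : Prop := ContDiff ℝ ∞ f ∧ HasCompactSupport f

/-- The classical partial derivative `∂_j f`. -/
def partialD (j : Fin 4) (f : R4 → F) (x : R4) : F := fderiv ℝ f x (e4 j)

lemma IsTest.isTestFun {η : R4 → ℝ} (h : IsTest η) : IsTestFun η := h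

lemma IsTestFun.partialD {f : R4 → F} (h : IsTestFun f) (j : Fin 4) :
    IsTestFun (partialD j f) :=
  ⟨(h.1.fderiv_right (m := ∞) (by simp)).clm_apply contDiff_const, h.2.fderiv_apply (𝕜 := ℝ) _⟩

lemma IsTestFun.memLp {f : R4 → F} (h : IsTestFun f) (p : ℝ≥0∞) :
    MemLp f p (volume : Measure R4) :=
  h.1.continuous.memLp_of_hasCompactSupport h.2

lemma IsTestFun.differentiable {f : R4 → F} (h : IsTestFun f) : Differentiable ℝ f :=
  h.1.differentiable (by simp)

lemma IsTestFun.add {f g : R4 → F} (hf : IsTestFun f) (hg : IsTestFun g) :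
    IsTestFun (f + g) := ⟨hf.1.add hg.1, hf.2.add hg.2⟩

lemma IsTestFun.const_smul {f : R4 → F} (hf : IsTestFun f) (c : ℝ) :
    IsTestFun (c • f) := ⟨hf.1.const_smul c, hf.2.smul_left (f := fun _ => c)⟩

lemma isTestFun_zero : IsTestFun (0 : R4 → F) := ⟨contDiff_const, HasCompactSupport.zero⟩

lemma IsTest.smul_const {η : R4 → ℝ} (h : IsTest η) (c : F) : IsTestFun (fun x => η x • c) :=
  ⟨h.1.smul contDiff_const, h.2.smul_right (f' := fun _ => c)⟩

lemma partialD_smul_const {η : R4 → ℝ} (h : IsTest η) (c : F) (j : Fin 4) (x : R4) :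
    MKG.partialD j (fun x => η x • c) x = pd j η x • c := by
  have h1 := ((h.isTestFun.differentiable x).hasFDerivAt.smul_const c).fderiv
  simp only [MKG.partialD, h1]
  rfl

lemma fderiv_apply_eq_sum (f : R4 → F) (x v : R4) :
    fderiv ℝ f x v = ∑ j, v j • partialD j f x := by
  have hv : v = ∑ j, v j • (e4 j : R4) := by
    ext i; simp [Finset.sum_apply, Pi.single_apply]
  conv_lhs => rw [hv, map_sum]
  simp [MKG.partialD]

/-- Cauchy–Schwarz: the operator norm of the derivative is at most the Euclidean norm of the
gradient. -/
lemma norm_fderiv_sq_le (f : R4 → F) (x : R4) :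
    ‖fderiv ℝ f x‖ ^ 2 ≤ ∑ j, ‖partialD j f x‖ ^ 2 := by
  have h : ‖fderiv ℝ f x‖ ≤ Real.sqrt (∑ j, ‖partialD j f x‖ ^ 2) := by
    refine ContinuousLinearMap.opNorm_le_bound _ (Real.sqrt_nonneg _) fun v => ?_
    rw [fderiv_apply_eq_sum]
    calc ‖∑ j, v j • partialD j f x‖ ≤ ∑ j, ‖v j‖ * ‖partialD j f x‖ :=
          (norm_sum_le _ _).trans (le_of_eq (Finset.sum_congr rfl fun j _ => norm_smul _ _))
      _ ≤ Real.sqrt (∑ j, ‖v j‖ ^ 2) * Real.sqrt (∑ j, ‖partialD j f x‖ ^ 2) :=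
          Real.sum_mul_le_sqrt_mul_sqrt _ _ _
      _ = _ := by rw [← EuclideanSpace.norm_eq, mul_comm]
  calc ‖fderiv ℝ f x‖ ^ 2 ≤ Real.sqrt (∑ j, ‖partialD j f x‖ ^ 2) ^ 2 := by gcongr
    _ = _ := Real.sq_sqrt (Finset.sum_nonneg fun _ _ => sq_nonneg _)

lemma laplacian_eq_sum_partialD {f : R4 → F} (hf : ContDiff ℝ 2 f) (x : R4) :
    (Δ f) x = ∑ j, partialD j (partialD j f) x := by
  rw [InnerProductSpace.laplacian_eq_iteratedFDeriv_orthonormalBasis f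
    (EuclideanSpace.basisFun (Fin 4) ℝ)]
  refine Finset.sum_congr rfl fun j _ => ?_
  rw [iteratedFDeriv_two_apply]
  simp only [Matrix.cons_val_zero, Matrix.cons_val_one, EuclideanSpace.basisFun_apply]
  have h1 : DifferentiableAt ℝ (fderiv ℝ f) x :=
    (hf.fderiv_right (m := 1) (by norm_num)).differentiable (by norm_num) x
  have h2 := (h1.hasFDerivAt.clm_apply (hasFDerivAt_const (e4 j) x)).fderiv
  unfold MKG.partialD
  rw [h2]
  simp

lemma isTest_laplacian {η : R4 → ℝ} (h : IsTest η) : IsTest (Δ η) := by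
  have h1 : Δ η = ∑ j, MKG.partialD j (MKG.partialD j η) := by
    ext x
    rw [laplacian_eq_sum_partialD (contDiff_infty.1 h.1 2), Finset.sum_apply]
  rw [h1]
  exact Finset.sum_induction _ (fun f : R4 → ℝ => IsTestFun f) (fun _ _ => IsTestFun.add)
    isTestFun_zero fun j _ => (h.isTestFun.partialD j).partialD j

lemma integral_pd_smul_eq {η : R4 → ℝ} (hη : ContDiff ℝ 1 η) {f : R4 → F} (hf : ContDiff ℝ 1 f)
    (hc : HasCompactSupport η ∨ HasCompactSupport f) (j : Fin 4) :
    ∫ x, MKG.partialD j η x • f x = - ∫ x, η x • MKG.partialD j f x := by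
  have hη' : Continuous (MKG.partialD j η) :=
    (hη.continuous_fderiv (by simp)).clm_apply continuous_const
  have hf' : Continuous (MKG.partialD j f) :=
    (hf.continuous_fderiv (by simp)).clm_apply continuous_const
  have hp : ∀ {g : R4 → ℝ} {k : R4 → F}, Continuous g → Continuous k →
      (HasCompactSupport g ∨ HasCompactSupport k) → Integrable (fun x => g x • k x) := by
    intro g k hg hk h
    refine (hg.smul hk).integrable_of_hasCompactSupport ?_
    rcases h with h | h
    · exact h.smul_right
    · exact h.smul_left
  have h := integral_smul_fderiv_eq_neg_fderiv_smul_of_integrable (μ := (volume : Measure R4))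
    (f := η) (g := f) (v := e4 j)
    (hp hη' hf.continuous (hc.imp_left fun h => h.fderiv_apply (𝕜 := ℝ) _))
    (hp hη.continuous hf' (hc.imp_right fun h => h.fderiv_apply (𝕜 := ℝ) _))
    (hp hη.continuous hf.continuous hc)
    (fun x _ => hη.differentiable (by simp) x) (fun x _ => hf.differentiable (by simp) x)
  simp only [MKG.partialD]
  rw [h, neg_neg]

/-- The class of a test function in `Ḣ¹`. -/
def testH (f : R4 → F) (hf : IsTestFun f) : HDot1 F :=
  ⟨((hf.memLp 4).toLp f, fun j => ((hf.partialD j).memLp 2).toLp _), by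
    intro j η hη
    have h1 : ∫ x, pd j η x • ((hf.memLp 4).toLp f) x = ∫ x, MKG.partialD j η x • f x := by
      refine integral_congr_ae ?_
      filter_upwards [(hf.memLp 4).coeFn_toLp] with x hx
      rw [hx]; rfl
    have h2 : ∫ x, η x • (((hf.partialD j).memLp 2).toLp _ : L2 F) x
        = ∫ x, η x • MKG.partialD j f x := by
      refine integral_congr_ae ?_
      filter_upwards [((hf.partialD j).memLp 2).coeFn_toLp] with x hx
      rw [hx]
    exact h1.trans ((integral_pd_smul_eq (hη.1.of_le (by exact_mod_cast le_top))
      (hf.1.of_le (by exact_mod_cast le_top)) (Or.inl hη.2) j).trans (congrArg Neg.neg h2.symm))⟩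

lemma testH_fn (f : R4 → F) (hf : IsTestFun f) : (testH f hf).fn = (hf.memLp 4).toLp f := rfl

lemma testH_D (f : R4 → F) (hf : IsTestFun f) (j : Fin 4) :
    (testH f hf).D j = ((hf.partialD j).memLp 2).toLp _ := rfl

lemma testH_fn_ae (f : R4 → F) (hf : IsTestFun f) : (testH f hf).fn =ᵐ[volume] f :=
  (hf.memLp 4).coeFn_toLp

lemma testH_D_ae (f : R4 → F) (hf : IsTestFun f) (j : Fin 4) :
    (testH f hf).D j =ᵐ[volume] MKG.partialD j f :=
  ((hf.partialD j).memLp 2).coeFn_toLp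

end TestFunctions

lemma norm_sq_toLp_two {F : Type} [NormedAddCommGroup F] {f : R4 → F}
    (hf : MemLp f 2 (volume : Measure R4)) :
    ‖hf.toLp f‖ ^ 2 = ∫ x, ‖f x‖ ^ 2 := by
  have h := eLpNorm_eq_lintegral_rpow_enorm_toReal (μ := (volume : Measure R4)) (f := f)
    (p := 2) (by simp) (by simp)
  rw [Lp.norm_toLp, h, ← ENNReal.toReal_pow, ← ENNReal.rpow_natCast, ← ENNReal.rpow_mul]
  simp only [ENNReal.toReal_ofNat, one_div, Nat.cast_ofNat, ne_eq, OfNat.ofNat_ne_zero,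
    not_false_eq_true, inv_mul_cancel₀, ENNReal.rpow_one, ENNReal.rpow_ofNat]
  rw [integral_eq_lintegral_of_nonneg_ae (Filter.Eventually.of_forall fun _ => sq_nonneg _)
    (hf.1.norm.pow 2)]
  congr 1
  refine lintegral_congr fun x => ?_
  rw [← ofReal_norm, ENNReal.ofReal_pow (norm_nonneg _)]

/-! ### The Sobolev inequality for test functions -/

section Sobolev

/-- The Sobolev inequality for continuously differentiable functions with compact support. -/
lemma sobolev_contDiff (F : Type) [NormedAddCommGroup F] [NormedSpace ℝ F]
    [FiniteDimensional ℝ F] : ∃ C : ℝ≥0, ∀ f : R4 → F, ContDiff ℝ 1 f → HasCompactSupport f →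
      eLpNorm f 4 volume ≤ C * eLpNorm (fderiv ℝ f) 2 volume :=
  ⟨SNormLESNormFDerivOfEqConst F (volume : Measure R4) 2, fun f hf hc => by
    have := eLpNorm_le_eLpNorm_fderiv_of_eq (F := F) (volume : Measure R4) hf hc (p := 2) (p' := 4)
      (by norm_num) (by simp) (by simp; norm_num)
    simpa using this⟩

lemma sobolev_testH (F : Type) [NormedAddCommGroup F] [NormedSpace ℝ F]
    [FiniteDimensional ℝ F] [CompleteSpace F] : ∃ C : ℝ, 0 < C ∧ ∀ (f : R4 → F) (hf : IsTestFun f),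
      ‖(testH f hf).fn‖ ≤ C * ‖testH f hf‖ := by
  obtain ⟨C, hC⟩ := sobolev_contDiff F
  -- The added 1 only makes the constant positive.
  refine ⟨C + 1, by positivity, fun f hf => ?_⟩
  have h1 := hC f (hf.1.of_le (by exact_mod_cast le_top)) hf.2
  have hd : MemLp (fderiv ℝ f) 2 (volume : Measure R4) :=
    (hf.1.continuous_fderiv (by simp)).memLp_of_hasCompactSupport (hf.2.fderiv (𝕜 := ℝ))
  have h2 : ‖hd.toLp _‖ ^ 2 ≤ ‖testH f hf‖ ^ 2 := by
    rw [HDot1.norm_sq_eq, norm_sq_toLp_two]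
    simp only [testH_D, norm_sq_toLp_two]
    rw [← integral_finsetSum]
    · refine integral_mono_of_nonneg (Filter.Eventually.of_forall fun _ => sq_nonneg _) ?_
        (Filter.Eventually.of_forall fun x => norm_fderiv_sq_le f x)
      exact integrable_finsetSum _ fun j _ =>
        ((memLp_two_iff_integrable_sq_norm ((hf.partialD j).memLp 2).1).1 ((hf.partialD j).memLp 2))
    · exact fun j _ =>
        ((memLp_two_iff_integrable_sq_norm ((hf.partialD j).memLp 2).1).1 ((hf.partialD j).memLp 2))
  have h3 : ‖hd.toLp _‖ ≤ ‖testH f hf‖ := le_of_sq_le_sq h2 (norm_nonneg _)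
  have h4 : ‖(testH f hf).fn‖ ≤ C * ‖hd.toLp _‖ := by
    rw [testH_fn, Lp.norm_toLp, Lp.norm_toLp]
    have := ENNReal.toReal_mono (ENNReal.mul_ne_top ENNReal.coe_ne_top hd.2.ne) h1
    simpa [ENNReal.toReal_mul] using this
  calc _ ≤ C * ‖hd.toLp _‖ := h4
    _ ≤ C * ‖testH f hf‖ := by gcongr
    _ ≤ _ := by have := norm_nonneg (testH f hf); nlinarith

end Sobolev

/-! ### A Liouville theorem in L² -/

/-- The convolution `η * v` of a real test function with a real function. -/
def mollify (η v : R4 → ℝ) : R4 → ℝ :=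
  convolution η v (ContinuousLinearMap.lsmul ℝ ℝ) volume

lemma mollify_apply (η v : R4 → ℝ) (x : R4) : mollify η v x = ∫ y, η (x - y) * v y := by
  rw [mollify, convolution_def, ← integral_sub_left_eq_self _ _ x]
  simp

lemma contDiff_mollify {η v : R4 → ℝ} (hη : IsTest η)
    (hv : LocallyIntegrable v (volume : Measure R4)) : ContDiff ℝ ∞ (mollify η v) :=
  hη.2.contDiff_convolution_left _ (n := ⊤) hη.1 hv

lemma partialD_mollify {η v : R4 → ℝ} (hη : IsTest η)
    (hv : LocallyIntegrable v (volume : Measure R4)) (j : Fin 4) :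
    partialD j (mollify η v) = mollify (partialD j η) v := by
  ext x
  have hd := hη.2.hasFDerivAt_convolution_left (ContinuousLinearMap.lsmul ℝ ℝ)
    (hη.1.of_le (by exact_mod_cast le_top)) hv x
  have hint : Integrable (fun y => ((ContinuousLinearMap.lsmul ℝ ℝ (E := ℝ)).precompL R4)
      (fderiv ℝ η y) (v (x - y))) :=
    (HasCompactSupport.convolutionExists_left _ (hη.2.fderiv (𝕜 := ℝ))
      (hη.1.continuous_fderiv (by simp)) hv x)
  unfold partialD mollify
  rw [hd.fderiv, convolution_def, ContinuousLinearMap.integral_apply hint]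
  simp only [ContinuousLinearMap.precompL_apply, ContinuousLinearMap.lsmul_apply, convolution_def]

lemma partialD_comp_sub_left {η : R4 → ℝ} (hη : IsTest η) (x : R4) (j : Fin 4) :
    partialD j (fun y => η (x - y)) = fun y => - partialD j η (x - y) := by
  ext y
  have h1 : HasFDerivAt η (fderiv ℝ η (x - y)) (x - y) :=
    (hη.1.differentiable (by simp) _).hasFDerivAt
  have h2 := (h1.comp y ((hasFDerivAt_id y).const_sub x)).fderiv
  simp only [Function.comp_def] at h2
  simp [partialD, h2]

lemma isTest_comp_sub_left {η : R4 → ℝ} (hη : IsTest η) (x : R4) :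
    IsTest (fun y => η (x - y)) :=
  ⟨hη.1.comp (contDiff_const.sub contDiff_id), hη.2.comp_homeomorph (Homeomorph.subLeft x)⟩

lemma laplacian_comp_sub_left {η : R4 → ℝ} (hη : IsTest η) (x y : R4) :
    (Δ (fun y => η (x - y))) y = (Δ η) (x - y) := by
  rw [laplacian_eq_sum_partialD (contDiff_infty.1 (isTest_comp_sub_left hη x).1 2),
    laplacian_eq_sum_partialD (contDiff_infty.1 hη.1 2)]
  refine Finset.sum_congr rfl fun j _ => ?_
  rw [partialD_comp_sub_left hη]
  have := congrFun (partialD_comp_sub_left (hη.isTestFun.partialD j) x j) y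
  unfold partialD at this ⊢
  rw [fderiv_fun_neg]
  simp [this]

/-- The hypothesis is tested on y ↦ η(x - y), whose Laplacian is (Δη)(x - y). -/
lemma sum_partialD_mollify_eq_zero {η v : R4 → ℝ} (hη : IsTest η)
    (hv : LocallyIntegrable v (volume : Measure R4))
    (h : ∀ η : R4 → ℝ, IsTest η → ∫ x, (Δ η) x * v x = 0) (x : R4) :
    ∑ j, partialD j (partialD j (mollify η v)) x = 0 := by
  have h1 := h _ (isTest_comp_sub_left hη x)
  simp only [laplacian_comp_sub_left hη, laplacian_eq_sum_partialD (contDiff_infty.1 hη.1 2),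
    Finset.sum_mul] at h1
  rw [integral_finsetSum] at h1
  · rw [← h1]
    refine Finset.sum_congr rfl fun j _ => ?_
    rw [partialD_mollify hη hv, partialD_mollify (hη.isTestFun.partialD j) hv, mollify_apply]
  · intro j _
    have h2 := isTest_comp_sub_left ((hη.isTestFun.partialD j).partialD j) x
    exact hv.integrable_smul_left_of_hasCompactSupport h2.1.continuous h2.2

/-- Cauchy–Schwarz with the weight |η(x - ·)| gives (η * v)² ≤ ‖η‖_{L¹} (|η| * v²), and the right
side is a convolution of integrable functions. -/
lemma integrable_mollify_sq {η v : R4 → ℝ} (hη : IsTest η)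
    (hv : MemLp v 2 (volume : Measure R4)) : Integrable (fun x => mollify η v x ^ 2) := by
  have hv2 : Integrable (fun x => v x ^ 2) := hv.integrable_sq
  have hvl : LocallyIntegrable v (volume : Measure R4) := hv.locallyIntegrable (by norm_num)
  have hηi : Integrable (fun x => |η x|) :=
    (hη.1.continuous.integrable_of_hasCompactSupport hη.2).abs
  have hconv := hηi.integrable_convolution (ContinuousLinearMap.lsmul ℝ ℝ) hv2
  refine (hconv.const_mul (∫ x, |η x|)).mono'
    ((contDiff_mollify hη hvl).continuous.pow 2).aestronglyMeasurable
    (Filter.Eventually.of_forall fun x => ?_)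
  have hc : ∀ {w : R4 → ℝ}, LocallyIntegrable w (volume : Measure R4) →
      Integrable (fun t => |η (x - t)| * w t) := fun hw =>
    hw.integrable_smul_left_of_hasCompactSupport (isTest_comp_sub_left hη x).1.continuous.abs
      ((isTest_comp_sub_left hη x).2.comp_left (g := abs) abs_zero)
  have e1 : convolution (fun x => |η x|) (fun x => v x ^ 2) (ContinuousLinearMap.lsmul ℝ ℝ)
      volume x = ∫ t, |η (x - t)| * v t ^ 2 := by
    rw [convolution_def, ← integral_sub_left_eq_self _ _ x]; simp
  have e2 : ∫ t, |η (x - t)| = ∫ t, |η t| := integral_sub_left_eq_self (fun t => |η t|) volume x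
  rw [e1, Real.norm_eq_abs, abs_of_nonneg (sq_nonneg _), ← e2]
  have i1 := hc (w := fun t => ‖v t‖) (hv.norm.locallyIntegrable (by norm_num))
  have i2 := hc hv2.locallyIntegrable
  have i3 : Integrable fun t => |η (x - t)| := hηi.comp_sub_left x
  have hP : |mollify η v x| ≤ ∫ t, |η (x - t)| * ‖v t‖ := by
    rw [mollify_apply, ← Real.norm_eq_abs]
    refine (norm_integral_le_integral_norm _).trans (le_of_eq ?_)
    simp
  -- The weighted Cauchy–Schwarz inequality is read off from the discriminant of s ↦ ∫ |η(x - t)|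
  -- (|v t| - s)² dt, which is nonnegative.
  have hquad : ∀ s : ℝ, 0 ≤ (∫ t, |η (x - t)|) * (s * s) + (-2 * ∫ t, |η (x - t)| * ‖v t‖) * s
      + ∫ t, |η (x - t)| * v t ^ 2 := by
    intro s
    have : 0 ≤ ∫ t, |η (x - t)| * (‖v t‖ - s) ^ 2 :=
      integral_nonneg fun t => by positivity
    refine this.trans (le_of_eq ?_)
    have e3 : ∀ t, |η (x - t)| * (‖v t‖ - s) ^ 2 = (|η (x - t)| * (s * s)
        + (-2 * s) * (|η (x - t)| * ‖v t‖)) + |η (x - t)| * v t ^ 2 := by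
      intro t
      rw [Real.norm_eq_abs, ← sq_abs (v t)]; ring
    simp only [e3]
    rw [integral_add, integral_add, integral_mul_const, integral_const_mul]
    · ring
    · exact i3.mul_const _
    · exact i1.const_mul _
    · exact (i3.mul_const _).add (i1.const_mul _)
    · exact i2
  have hd := discrim_le_zero hquad
  unfold discrim at hd
  have hP2 : mollify η v x ^ 2 ≤ (∫ t, |η (x - t)| * ‖v t‖) ^ 2 := by
    rw [← sq_abs]; gcongr
  nlinarith

/-- A fixed smooth cutoff, equal to `1` on the unit ball and supported in the ball of radius `2`. -/
def bump : ContDiffBump (0 : R4) := ⟨1, 2, by norm_num, by norm_num⟩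

/-- The rescaled cutoff `x ↦ χ(x/R)`. -/
def bumpR (R : ℝ) (x : R4) : ℝ := bump (R⁻¹ • x)

lemma isTest_bumpR {R : ℝ} (hR : 0 < R) : IsTest (bumpR R) :=
  ⟨bump.contDiff.comp (contDiff_const_smul _),
    bump.hasCompactSupport.comp_homeomorph (Homeomorph.smulOfNeZero R⁻¹ (inv_ne_zero hR.ne'))⟩

lemma partialD_comp_smul {f : R4 → ℝ} (hf : Differentiable ℝ f) (c : ℝ) (j : Fin 4) :
    partialD j (fun x => f (c • x)) = fun x => c * partialD j f (c • x) := by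
  ext x
  have h1 := ((hf (c • x)).hasFDerivAt.comp x ((hasFDerivAt_id x).const_smul c)).fderiv
  simp only [Function.comp_def] at h1
  simp [partialD, h1]

lemma partialD_partialD_bumpR (R : ℝ) (j : Fin 4) (x : R4) :
    partialD j (partialD j (bumpR R)) x = R⁻¹ ^ 2 * partialD j (partialD j bump) (R⁻¹ • x) := by
  have hb : IsTestFun (bump : R4 → ℝ) := ⟨bump.contDiff, bump.hasCompactSupport⟩
  have h1 : partialD j (bumpR R) = fun x => R⁻¹ * partialD j bump (R⁻¹ • x) :=
    partialD_comp_smul hb.differentiable _ _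
  have h2 := congrFun (partialD_comp_smul (hb.partialD j).differentiable R⁻¹ j) x
  have hd : DifferentiableAt ℝ (fun x => partialD j bump (R⁻¹ • x)) x :=
    ((hb.partialD j).differentiable _).comp x (differentiableAt_id.const_smul R⁻¹)
  rw [h1]
  unfold partialD at h2 hd ⊢
  rw [fderiv_const_mul hd]
  simp only [smul_apply, smul_eq_mul]
  rw [h2]; ring

/-- Each second derivative of χ(x/R) gains R⁻² by scaling; the second derivatives of the fixed
cutoff are bounded. -/
lemma exists_bound_laplacian_bumpR :
    ∃ K : ℝ, 0 ≤ K ∧ ∀ R : ℝ, 0 < R → ∀ x, |∑ j, partialD j (partialD j (bumpR R)) x|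
      ≤ K * R⁻¹ ^ 2 := by
  have hb : IsTestFun (bump : R4 → ℝ) := ⟨bump.contDiff, bump.hasCompactSupport⟩
  have hs : ∀ j : Fin 4, ∃ K, ∀ x, ‖partialD j (partialD j bump) x‖ ≤ K := fun j =>
    ((hb.partialD j).partialD j).1.continuous.bounded_above_of_compact_support
      ((hb.partialD j).partialD j).2
  choose K hK using hs
  refine ⟨∑ j, |K j|, Finset.sum_nonneg fun _ _ => abs_nonneg _, fun R hR x => ?_⟩
  rw [Finset.sum_mul]
  refine (Finset.abs_sum_le_sum_abs _ _).trans (Finset.sum_le_sum fun j _ => ?_)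
  rw [partialD_partialD_bumpR, abs_mul, abs_of_nonneg (show 0 ≤ R⁻¹ ^ 2 by positivity), mul_comm]
  exact mul_le_mul_of_nonneg_right ((hK j _).trans (le_abs_self _)) (by positivity)

lemma bumpR_nonneg (R : ℝ) (x : R4) : 0 ≤ bumpR R x := bump.nonneg

lemma bumpR_eq_one {R : ℝ} (hR : 0 < R) {x : R4} (hx : ‖x‖ ≤ R) : bumpR R x = 1 := by
  refine bump.one_of_mem_closedBall ?_
  rw [mem_closedBall_zero_iff, norm_smul, norm_inv, Real.norm_eq_abs, abs_of_pos hR,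
    inv_mul_le_iff₀ hR]
  simpa [bump] using hx

/-- The larger cutoff is already 1 on the support of the smaller one. This lets the mass at a fixed
radius be compared with cutoffs whose radius tends to infinity. -/
lemma bumpR_le {R R' : ℝ} (hR : 0 < R) (hR' : 2 * R ≤ R') (x : R4) : bumpR R x ≤ bumpR R' x := by
  by_cases hx : ‖x‖ ≤ R'
  · rw [bumpR_eq_one (by linarith) hx]; exact bump.le_one
  · have : bumpR R x = 0 := by
      refine bump.zero_of_le_dist ?_
      rw [dist_zero_right, norm_smul, norm_inv, Real.norm_eq_abs, abs_of_pos hR]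
      change (2 : ℝ) ≤ _
      rw [le_inv_mul_iff₀ hR]
      linarith
    rw [this]; exact bumpR_nonneg _ _

lemma partialD_mul_self {b : R4 → ℝ} (hb : Differentiable ℝ b) (j : Fin 4) :
    partialD j (fun x => b x ^ 2) = fun x => 2 * b x * partialD j b x := by
  ext x
  have := ((hb x).hasFDerivAt.pow 2).fderiv
  unfold partialD
  rw [this]; simp

lemma partialD_mul {b c : R4 → ℝ} (hb : Differentiable ℝ b) (hc : Differentiable ℝ c)
    (j : Fin 4) (x : R4) :
    partialD j (fun x => b x * c x) x = b x * partialD j c x + c x * partialD j b x := by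
  unfold partialD
  rw [fderiv_fun_mul (hb x) (hc x)]; simp

/-- The Caccioppoli type identity for smooth harmonic functions. -/
lemma integral_bumpR_mul_gradient_sq {b : R4 → ℝ} (hb : ContDiff ℝ ∞ b)
    (hh : ∀ x, ∑ j, partialD j (partialD j b) x = 0) {χ : R4 → ℝ} (hχ : IsTest χ) :
    ∫ x, (∑ j, partialD j (partialD j χ) x) * b x ^ 2
      = 2 * ∫ x, χ x * ∑ j, partialD j b x ^ 2 := by
  have hbd : ∀ j, ContDiff ℝ ∞ (partialD j b) := fun j =>
    (hb.fderiv_right (m := ∞) (by simp)).clm_apply contDiff_const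
  have hb2 : ContDiff ℝ ∞ (fun x => b x ^ 2) := hb.pow 2
  have hb2d : ∀ j, ContDiff ℝ ∞ (partialD j (fun x => b x ^ 2)) := fun j =>
    (hb2.fderiv_right (m := ∞) (by simp)).clm_apply contDiff_const
  have hb2dd : ∀ j, ContDiff ℝ ∞ (partialD j (partialD j (fun x => b x ^ 2))) := fun j =>
    ((hb2d j).fderiv_right (m := ∞) (by simp)).clm_apply contDiff_const
  have e1 : ∀ j, ∫ x, partialD j (partialD j χ) x * b x ^ 2
      = ∫ x, χ x * partialD j (partialD j (fun x => b x ^ 2)) x := by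
    intro j
    have h1 := integral_pd_smul_eq (contDiff_infty.1 (hχ.isTestFun.partialD j).1 1)
      (contDiff_infty.1 hb2 1) (Or.inl (hχ.isTestFun.partialD j).2) j
    have h2 := integral_pd_smul_eq (contDiff_infty.1 hχ.1 1)
      (contDiff_infty.1 (hb2d j) 1) (Or.inl hχ.2) j
    simp only [smul_eq_mul] at h1 h2
    rw [h1, h2, neg_neg]
  -- Δ(b²) = 2bΔb + 2|∇b|², and the first term vanishes by harmonicity.
  have e2 : ∀ x, ∑ j, partialD j (partialD j (fun x => b x ^ 2)) x
      = 2 * ∑ j, partialD j b x ^ 2 := by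
    intro x
    have e3 : ∀ j, partialD j (partialD j (fun x => b x ^ 2)) x
        = 2 * b x * partialD j (partialD j b) x + 2 * partialD j b x ^ 2 := by
      intro j
      rw [partialD_mul_self (hb.differentiable (by simp)),
        partialD_mul ((hb.differentiable (by simp)).const_mul 2)
          ((hbd j).differentiable (by simp))]
      have : partialD j (fun x => 2 * b x) x = 2 * partialD j b x := by
        unfold partialD
        rw [fderiv_const_mul (hb.differentiable (by simp) x)]; simp
      rw [this]; ring
    simp only [e3, Finset.sum_add_distrib, ← Finset.mul_sum, hh x]
    ring
  have i1 : ∀ j, Integrable fun x => partialD j (partialD j χ) x * b x ^ 2 := fun j =>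
    (((hχ.isTestFun.partialD j).partialD j).1.continuous.mul
      hb2.continuous).integrable_of_hasCompactSupport
      ((hχ.isTestFun.partialD j).partialD j).2.mul_right
  have i2 : ∀ j, Integrable fun x => χ x * partialD j (partialD j (fun x => b x ^ 2)) x :=
    fun j => (hχ.1.continuous.mul (hb2dd j).continuous).integrable_of_hasCompactSupport
      hχ.2.mul_right
  simp only [Finset.sum_mul]
  rw [integral_finsetSum _ fun j _ => i1 j]
  simp only [e1]
  rw [← integral_finsetSum _ fun j _ => i2 j, ← integral_const_mul]
  refine integral_congr_ae (Filter.Eventually.of_forall fun x => ?_)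
  simp only [← Finset.mul_sum, e2]
  ring

/-- A smooth square integrable harmonic function vanishes. -/
lemma eq_zero_of_harmonic_of_integrable_sq {b : R4 → ℝ} (hb : ContDiff ℝ ∞ b)
    (hh : ∀ x, ∑ j, partialD j (partialD j b) x = 0) (hi : Integrable fun x => b x ^ 2) :
    b = 0 := by
  obtain ⟨K, hK0, hK⟩ := exists_bound_laplacian_bumpR
  have hbd : ∀ j, Continuous (partialD j b) := fun j =>
    ((hb.fderiv_right (m := ∞) (by simp)).clm_apply contDiff_const :
      ContDiff ℝ ∞ (partialD j b)).continuous
  have hG : Continuous fun x => ∑ j, partialD j b x ^ 2 :=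
    continuous_finsetSum _ fun j _ => (hbd j).pow 2
  have hGi : ∀ R, 0 < R → Integrable fun x => bumpR R x * ∑ j, partialD j b x ^ 2 := fun R hR =>
    ((isTest_bumpR hR).1.continuous.mul hG).integrable_of_hasCompactSupport
      (isTest_bumpR hR).2.mul_right
  have hbound : ∀ R, 0 < R → 2 * ∫ x, bumpR R x * ∑ j, partialD j b x ^ 2
      ≤ K * R⁻¹ ^ 2 * ∫ x, b x ^ 2 := by
    intro R hR
    rw [← integral_bumpR_mul_gradient_sq hb hh (isTest_bumpR hR), ← integral_const_mul]
    refine (le_abs_self _).trans ?_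
    rw [← Real.norm_eq_abs]
    refine norm_integral_le_of_norm_le (hi.const_mul _) (Filter.Eventually.of_forall fun x => ?_)
    rw [norm_mul, Real.norm_eq_abs, Real.norm_eq_abs, abs_of_nonneg (sq_nonneg (b x))]
    gcongr
    exact hK R hR x
  have hzero : ∀ x, ∑ j, partialD j b x ^ 2 = 0 := by
    intro x
    by_contra hne
    set R₀ := ‖x‖ + 1 with hR₀
    have hR₀p : 0 < R₀ := by positivity
    -- A nonzero gradient at x gives positive mass near x, while for all R ≥ 2R₀ this mass is at
    -- most a multiple of R⁻² ∫ b², which tends to zero.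
    have hpos : 0 < ∫ x, bumpR R₀ x * ∑ j, partialD j b x ^ 2 := by
      refine ((isTest_bumpR hR₀p).1.continuous.mul
        hG).integral_pos_of_hasCompactSupport_nonneg_nonzero
        (isTest_bumpR hR₀p).2.mul_right
        (fun y => mul_nonneg (bumpR_nonneg _ _) (Finset.sum_nonneg fun _ _ => sq_nonneg _))
        (x := x) ?_
      rw [bumpR_eq_one hR₀p (by linarith), one_mul]
      exact hne
    have hev : ∀ᶠ R : ℝ in Filter.atTop, 2 * ∫ x, bumpR R₀ x * ∑ j, partialD j b x ^ 2
        ≤ K * R⁻¹ ^ 2 * ∫ x, b x ^ 2 := by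
      filter_upwards [Filter.eventually_ge_atTop (2 * R₀)] with R hR
      refine le_trans ?_ (hbound R (by linarith))
      gcongr ?_ * ?_
      refine integral_mono (hGi _ hR₀p) (hGi _ (by linarith)) fun y => ?_
      exact mul_le_mul_of_nonneg_right (bumpR_le hR₀p hR y)
        (Finset.sum_nonneg fun _ _ => sq_nonneg _)
    have hlim : Filter.Tendsto (fun R : ℝ => K * R⁻¹ ^ 2 * ∫ x, b x ^ 2) Filter.atTop
        (nhds (K * 0 ^ 2 * ∫ x, b x ^ 2)) :=
      ((tendsto_inv_atTop_zero.pow 2).const_mul K).mul_const _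
    have := ge_of_tendsto hlim hev
    simp at this
    linarith
  have hconst : ∀ x, b x = b 0 := fun x => by
    refine is_const_of_fderiv_eq_zero (𝕜 := ℝ) (hb.differentiable (by simp)) (fun y => ?_) x 0
    have h1 := (norm_fderiv_sq_le b y).trans (le_of_eq (by simpa using hzero y))
    have h2 : ‖fderiv ℝ b y‖ = 0 := by
      have := norm_nonneg (fderiv ℝ b y); nlinarith
    exact norm_eq_zero.1 h2
  ext x
  rw [hconst x]
  -- A nonzero constant is not square integrable, the volume of ℝ⁴ being infinite.
  by_contra hne
  simp only [hconst] at hi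
  rw [integrable_const_iff] at hi
  rcases hi with h | h
  · exact hne (by simpa using h)
  · have := h.measure_univ_lt_top
    simp at this

/-- A real square integrable weakly harmonic function on `ℝ⁴` vanishes. -/
lemma ae_eq_zero_of_weakly_harmonic {v : R4 → ℝ} (hv : MemLp v 2 (volume : Measure R4))
    (h : ∀ η : R4 → ℝ, IsTest η → ∫ x, (Δ η) x * v x = 0) : v =ᵐ[volume] 0 := by
  have hvl : LocallyIntegrable v (volume : Measure R4) := hv.locallyIntegrable (by norm_num)
  refine ae_eq_zero_of_integral_contDiff_smul_eq_zero hvl fun η h1 h2 => ?_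
  have hη : IsTest fun y => η (0 - y) := isTest_comp_sub_left (η := η) ⟨h1, h2⟩ 0
  have h0 := congrFun (eq_zero_of_harmonic_of_integrable_sq (contDiff_mollify hη hvl)
    (sum_partialD_mollify_eq_zero hη hvl h) (integrable_mollify_sq hη hv)) 0
  rw [mollify_apply] at h0
  simpa using h0

/-! ### Closedness of the weak gradient -/

namespace HDot1

variable {F : Type} [NormedAddCommGroup F] [NormedSpace ℝ F]

lemma fn_sub (u v : HDot1 F) : (u - v).fn = u.fn - v.fn := rfl

lemma norm_gradL [CompleteSpace F] (u : HDot1 F) : ‖gradL F u‖ = ‖u‖ := rfl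

end HDot1

section Pairing

variable {F : Type} [NormedAddCommGroup F] [NormedSpace ℝ F]

/-- Hölder's inequality; the test function lies in every L^q, in particular for the exponent dual to
p. -/
lemma exists_norm_integral_test_le {η : R4 → ℝ} (hη : IsTest η) {p : ℝ≥0∞} (hp : 1 ≤ p) :
    ∃ K : ℝ, ∀ u : Lp F p (volume : Measure R4), ‖∫ x, η x • u x‖ ≤ K * ‖u‖ := by
  have hq : ENNReal.HolderTriple (1 - p⁻¹)⁻¹ p 1 := ⟨by
    rw [inv_inv, inv_one]; exact tsub_add_cancel_of_le (by simpa using hp)⟩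
  have hηq := hη.isTestFun.memLp (1 - p⁻¹)⁻¹
  refine ⟨(eLpNorm η (1 - p⁻¹)⁻¹ volume).toReal, fun u => ?_⟩
  have h1 : ‖∫ x, η x • u x‖ₑ ≤ eLpNorm η (1 - p⁻¹)⁻¹ volume * eLpNorm u p volume :=
    calc ‖∫ x, η x • u x‖ₑ ≤ ∫⁻ x, ‖η x • u x‖ₑ := enorm_integral_le_lintegral_enorm _
      _ = eLpNorm (η • (u : R4 → F)) 1 volume := by rw [eLpNorm_one_eq_lintegral_enorm]; rfl
      _ ≤ _ := eLpNorm_smul_le_mul_eLpNorm (Lp.aestronglyMeasurable u) hηq.1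
  have h2 := ENNReal.toReal_mono (ENNReal.mul_ne_top hηq.2.ne (Lp.memLp u).2.ne) h1
  rwa [ENNReal.toReal_mul, toReal_enorm, ← Lp.norm_def] at h2

lemma integral_test_sub {η : R4 → ℝ} (h : IsTest η) {p : ℝ≥0∞} (hp : 1 ≤ p)
    (u v : Lp F p (volume : Measure R4)) :
    ∫ x, η x • (u - v : Lp F p (volume : Measure R4)) x
      = (∫ x, η x • u x) - ∫ x, η x • v x := by
  have := integral_test_add h hp (u - v) v
  rw [sub_add_cancel] at this
  rw [this, add_sub_cancel_right]

lemma tendsto_integral_test {η : R4 → ℝ} (hη : IsTest η) {p : ℝ≥0∞} [Fact (1 ≤ p)]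
    {u : ℕ → Lp F p (volume : Measure R4)} {v : Lp F p (volume : Measure R4)}
    (h : Tendsto u atTop (𝓝 v)) :
    Tendsto (fun n => ∫ x, η x • u n x) atTop (𝓝 (∫ x, η x • v x)) := by
  obtain ⟨K, hK⟩ := exists_norm_integral_test_le (F := F) hη (Fact.out : 1 ≤ p)
  rw [tendsto_iff_norm_sub_tendsto_zero] at h ⊢
  refine squeeze_zero (fun _ => norm_nonneg _) (fun n => ?_) (by simpa using h.const_mul K)
  rw [← integral_test_sub hη Fact.out]
  exact hK _

/-- The graph of the weak gradient is closed. -/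
lemma mem_hdot1Graph_of_tendsto {u : ℕ → HDot1 F} {v : L4 F} {G : Fin 4 → L2 F}
    (h1 : Tendsto (fun n => (u n).fn) atTop (𝓝 v))
    (h2 : ∀ j, Tendsto (fun n => (u n).D j) atTop (𝓝 (G j))) : (v, G) ∈ hdot1Graph F := by
  intro j η hη
  have e1 := tendsto_integral_test (hη.pd_isTest j) h1
  have e2 := (tendsto_integral_test hη (h2 j)).neg
  refine tendsto_nhds_unique e1 (e2.congr fun n => ?_)
  exact ((u n).isWeakPartial j η hη).symm

end Pairing

/-! ### Density of test functions and completeness of Ḣ¹ -/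

section Density

variable {F : Type} [NormedAddCommGroup F]

lemma partialD_comm [NormedSpace ℝ F] {f : R4 → F} (hf : ContDiff ℝ 2 f) (j k : Fin 4) (x : R4) :
    partialD j (partialD k f) x = partialD k (partialD j f) x := by
  have h1 : DifferentiableAt ℝ (fderiv ℝ f) x :=
    (hf.fderiv_right (m := 1) (by norm_num)).differentiable (by norm_num) x
  have h2 : ∀ i, fderiv ℝ (fun y => fderiv ℝ f y (e4 i)) x
      = (fderiv ℝ (fderiv ℝ f) x).flip (e4 i) := by
    intro i
    rw [(h1.hasFDerivAt.clm_apply (hasFDerivAt_const (e4 i) x)).fderiv]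
    simp
  unfold partialD
  rw [h2, h2]
  simp only [ContinuousLinearMap.flip_apply]
  exact (hf.contDiffAt.isSymmSndFDerivAt (by simp)) (e4 j) (e4 k)

lemma integral_congr_smul_fun [NormedSpace ℝ F] {f g : R4 → ℝ} (h : ∀ x, f x = g x)
    (u : R4 → F) : ∫ x, f x • u x = ∫ x, g x • u x := by
  simp only [h]

/-- Integration by parts in `∫ Δη ∂_k w`. -/
lemma integral_laplacian_smul_D [NormedSpace ℝ F] (w : HDot1 F) {η : R4 → ℝ} (hη : IsTest η)
    (k : Fin 4) :
    ∫ x, (Δ η) x • w.D k x = ∑ j, ∫ x, pd j (pd k η) x • w.D j x := by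
  have hd : ∀ {θ : R4 → ℝ}, IsTest θ → ∀ i, IsTest (pd i θ) := fun h i => h.pd_isTest i
  simp only [laplacian_eq_sum_partialD (contDiff_infty.1 hη.1 2), Finset.sum_smul]
  rw [integral_finsetSum]
  · refine Finset.sum_congr rfl fun j _ => ?_
    -- Each side is, up to the same sign, the integral of w against a third derivative of η; the two
    -- third derivatives agree since partial derivatives commute.
    have e1 := w.isWeakPartial k _ (hd (hd hη j) j)
    have e2 := w.isWeakPartial j _ (hd (hd hη k) j)
    change ∫ x, pd j (pd j η) x • w.D k x = _
    rw [← neg_inj, ← e1, ← e2]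
    refine integral_congr_smul_fun (fun x => ?_) _
    change partialD k (partialD j (partialD j η)) x = partialD j (partialD j (partialD k η)) x
    rw [partialD_comm (contDiff_infty.1 (hη.isTestFun.partialD j).1 2)]
    congr 1
    exact funext fun y => partialD_comm (contDiff_infty.1 hη.1 2) k j y
  · exact fun j _ => integrable_test_smul (hd (hd hη j) j) (by norm_num) (w.D k)

variable [InnerProductSpace ℝ F]

lemma inner_gradL (u v : HDot1 F) :
    inner ℝ (HDot1.gradL F u) (HDot1.gradL F v) = ∑ j, inner ℝ (u.D j) (v.D j) :=
  PiLp.inner_apply _ _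

lemma inner_test_smul {η : R4 → ℝ} (hη : IsTest η) (c : F) (v : L2 F) :
    inner ℝ (((hη.smul_const c).memLp 2).toLp _ : L2 F) v = ∫ x, η x * inner ℝ c (v x) := by
  rw [MeasureTheory.L2.inner_def]
  refine integral_congr_ae ?_
  filter_upwards [((hη.smul_const c).memLp 2).coeFn_toLp] with x hx
  rw [hx, inner_smul_left]; rfl

variable [CompleteSpace F]

/-- The inner product is pulled back along the gradient, and the existing normed structure is kept
so that no second norm arises. -/
instance : InnerProductSpace ℝ (HDot1 F) :=
  { (inferInstance : NormedSpace ℝ (HDot1 F)) with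
    inner := fun u v => inner ℝ (HDot1.gradL F u) (HDot1.gradL F v)
    norm_sq_eq_re_inner := fun u => norm_sq_eq_re_inner (𝕜 := ℝ) (HDot1.gradL F u)
    conj_inner_symm := fun u v => inner_conj_symm (𝕜 := ℝ) (HDot1.gradL F u) (HDot1.gradL F v)
    add_left := fun u v w => by rw [map_add]; exact inner_add_left _ _ _
    smul_left := fun u v c => by rw [map_smul]; exact inner_smul_left _ _ _ }

lemma HDot1.inner_eq (u v : HDot1 F) : inner ℝ u v = ∑ j, inner ℝ (u.D j) (v.D j) :=
  inner_gradL u v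

lemma inner_testH_smul {η : R4 → ℝ} (hη : IsTest η) (c : F) (v : HDot1 F) :
    inner ℝ (testH _ (hη.smul_const c)) v = ∑ j, ∫ x, pd j η x * inner ℝ c (v.D j x) := by
  rw [HDot1.inner_eq]
  refine Finset.sum_congr rfl fun j _ => ?_
  rw [← inner_test_smul (hη.pd_isTest j) c (v.D j)]
  congr 1
  rw [testH_D]
  refine (MemLp.toLp_eq_toLp_iff _ _).2 (Eventually.of_forall fun x => ?_)
  exact partialD_smul_const hη c j x

variable (F) in
/-- The subspace of test functions of `Ḣ¹`. -/
def testSpace : Submodule ℝ (HDot1 F) where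
  carrier := {u | ∃ f hf, u = testH f hf}
  zero_mem' := ⟨0, isTestFun_zero, by
    refine (HDot1.gradL_injective ?_)
    refine congrArg (WithLp.toLp 2) (funext fun j => ?_)
    change (0 : L2 F) = _
    rw [testH_D, eq_comm, Lp.eq_zero_iff_ae_eq_zero]
    filter_upwards [((isTestFun_zero (F := F)).partialD j |>.memLp 2).coeFn_toLp] with x hx
    rw [hx]; simp [partialD]⟩
  add_mem' := by
    rintro _ _ ⟨f, hf, rfl⟩ ⟨g, hg, rfl⟩
    refine ⟨f + g, hf.add hg, HDot1.gradL_injective ?_⟩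
    refine congrArg (WithLp.toLp 2) (funext fun j => ?_)
    change (testH f hf).D j + (testH g hg).D j = _
    rw [testH_D, testH_D, testH_D, ← MemLp.toLp_add, MemLp.toLp_eq_toLp_iff]
    refine Eventually.of_forall fun x => ?_
    simp only [partialD, Pi.add_apply]
    rw [fderiv_add (hf.differentiable x) (hg.differentiable x)]; rfl
  smul_mem' := by
    rintro c _ ⟨f, hf, rfl⟩
    refine ⟨c • f, hf.const_smul c, HDot1.gradL_injective ?_⟩
    refine congrArg (WithLp.toLp 2) (funext fun j => ?_)
    change c • (testH f hf).D j = _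
    rw [testH_D, testH_D, ← MemLp.toLp_const_smul, MemLp.toLp_eq_toLp_iff]
    refine Eventually.of_forall fun x => ?_
    simp only [partialD, Pi.smul_apply]
    rw [fderiv_const_smul (hf.differentiable x)]; rfl

lemma testH_mem_testSpace (f : R4 → F) (hf : IsTestFun f) : testH f hf ∈ testSpace F :=
  ⟨f, hf, rfl⟩

/-- Limits of gradients of test functions are gradients. -/
lemma exists_of_mem_closure_gradL {C : ℝ} (hC0 : 0 < C)
    (hC : ∀ (f : R4 → F) (hf : IsTestFun f), ‖(testH f hf).fn‖ ≤ C * ‖testH f hf‖)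
    {y : PiLp 2 (fun _ : Fin 4 => L2 F)}
    (hy : y ∈ closure (((testSpace F).map (HDot1.gradL F) : Submodule ℝ _) : Set _)) :
    ∃ v : HDot1 F, HDot1.gradL F v = y ∧ ‖v.fn‖ ≤ C * ‖v‖ := by
  obtain ⟨s, hs, hlim⟩ := mem_closure_iff_seq_limit.1 hy
  choose t ht hts using hs
  have hT : ∀ u ∈ testSpace F, ‖u.fn‖ ≤ C * ‖u‖ := by
    rintro _ ⟨f, hf, rfl⟩; exact hC f hf
  have hdist : ∀ m n, dist (t m).fn (t n).fn ≤ C * dist (s m) (s n) := by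
    intro m n
    rw [dist_eq_norm, dist_eq_norm, ← hts m, ← hts n, ← map_sub]
    rw [HDot1.norm_gradL, ← HDot1.fn_sub]
    exact hT _ ((testSpace F).sub_mem (ht m) (ht n))
  -- By the Sobolev bound, convergence of the gradients makes the functions themselves Cauchy in L⁴.
  have hcs : CauchySeq fun n => (t n).fn := by
    have h := hlim.cauchySeq
    rw [Metric.cauchySeq_iff] at h ⊢
    intro ε hε
    obtain ⟨N, hN⟩ := h (ε / C) (by positivity)
    refine ⟨N, fun m hm n hn => (hdist m n).trans_lt ?_⟩
    have := hN m hm n hn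
    rwa [lt_div_iff₀ hC0, mul_comm] at this
  obtain ⟨v, hv⟩ := cauchySeq_tendsto_of_complete hcs
  have hD : ∀ j, Tendsto (fun n => (t n).D j) atTop (𝓝 (y j)) := by
    intro j
    have h1 : Tendsto (fun n => s n j) atTop (𝓝 (y j)) :=
      ((PiLp.continuous_apply 2 (fun _ : Fin 4 => L2 F) j).tendsto y).comp hlim
    refine h1.congr fun n => ?_
    rw [← hts n]; rfl
  refine ⟨⟨(v, fun j => y j), mem_hdot1Graph_of_tendsto hv hD⟩, ?_, ?_⟩
  · exact PiLp.ext fun j => rfl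
  · have h1 : Tendsto (fun n => ‖(t n).fn‖) atTop (𝓝 ‖v‖) := hv.norm
    have h2 : Tendsto (fun n => C * ‖s n‖) atTop (𝓝 (C * ‖y‖)) := hlim.norm.const_mul C
    refine le_of_tendsto_of_tendsto' h1 h2 fun n => ?_
    rw [← hts n]
    exact hT _ (ht n)

variable [FiniteDimensional ℝ F]

/-- An element of `Ḣ¹` orthogonal to all test functions vanishes. -/
lemma HDot1.eq_zero_of_orthogonal (w : HDot1 F)
    (h : ∀ (f : R4 → F) (hf : IsTestFun f), inner ℝ (testH f hf) w = 0) : w = 0 := by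
  have hD : ∀ k, w.D k = 0 := by
    intro k
    have hc : ∀ c : F, (fun x => inner ℝ c (w.D k x)) =ᵐ[volume] 0 := by
      intro c
      have hm : ∀ j, MemLp (fun x => inner ℝ c (w.D j x)) 2 (volume : Measure R4) := fun j =>
        (innerSL ℝ c).comp_memLp' (Lp.memLp (w.D j))
      refine ae_eq_zero_of_weakly_harmonic (hm k) fun η hη => ?_
      have e : ∀ {θ : R4 → ℝ}, IsTest θ → ∀ j, ∫ x, θ x * inner ℝ c (w.D j x)
          = inner ℝ c (∫ x, θ x • w.D j x) := by
        intro θ hθ j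
        rw [← innerSL_apply_apply ℝ, ← ContinuousLinearMap.integral_comp_comm _
          (integrable_test_smul hθ (by norm_num) (w.D j))]
        simp
      -- Orthogonality to the test function ∂_kη · c says exactly that the component ⟨c, ∂_k w⟩ is
      -- weakly harmonic.
      rw [e (isTest_laplacian hη), integral_laplacian_smul_D w hη k, inner_sum,
        ← h _ ((hη.pd_isTest k).smul_const c), inner_testH_smul (hη.pd_isTest k)]
      exact Finset.sum_congr rfl fun j _ => (e ((hη.pd_isTest k).pd_isTest j) j).symm
    rw [Lp.eq_zero_iff_ae_eq_zero]
    have hall : ∀ᵐ x ∂(volume : Measure R4), ∀ i,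
        inner ℝ (stdOrthonormalBasis ℝ F i) (w.D k x) = 0 := ae_all_iff.2 fun i => hc _
    filter_upwards [hall] with x hx
    refine InnerProductSpace.ext_inner_left_basis (𝕜 := ℝ) (stdOrthonormalBasis ℝ F).toBasis fun i => ?_
    simpa using hx i
  apply HDot1.gradL_injective
  rw [map_zero]
  exact congrArg (WithLp.toLp 2) (funext hD)

/-- The orthogonal projection of ∇u to the closure of the test gradients is itself a gradient ∇v.
Then u - v is orthogonal to all test functions, so it vanishes. -/
lemma gradL_mem_closure (u : HDot1 F) :
    HDot1.gradL F u ∈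
      closure (((testSpace F).map (HDot1.gradL F) : Submodule ℝ _) : Set _) := by
  obtain ⟨C, hC0, hC⟩ := sobolev_testH F
  set Y := ((testSpace F).map (HDot1.gradL F)).topologicalClosure with hY
  have : CompleteSpace Y := ((testSpace F).map
    (HDot1.gradL F)).isClosed_topologicalClosure.completeSpace_coe
  obtain ⟨v, hv, -⟩ := exists_of_mem_closure_gradL hC0 hC
    (Y.starProjection_apply_mem (HDot1.gradL F u))
  have hw : u - v = 0 := by
    refine HDot1.eq_zero_of_orthogonal _ fun f hf => ?_
    change inner ℝ (HDot1.gradL F _) (HDot1.gradL F (u - v)) = 0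
    rw [map_sub, hv]
    refine Submodule.inner_right_of_mem_orthogonal (K := Y) ?_
      (Y.sub_starProjection_mem_orthogonal _)
    exact Submodule.le_topologicalClosure _ ⟨_, testH_mem_testSpace f hf, rfl⟩
  rw [sub_eq_zero.1 hw, hv]
  exact Y.starProjection_apply_mem (HDot1.gradL F u)

variable (F) in
/-- The Sobolev inequality `‖u‖_{L⁴} ≤ C ‖∇u‖_{L²}` on `Ḣ¹`. -/
lemma HDot1.sobolev : ∃ C : ℝ, 0 < C ∧ ∀ u : HDot1 F, ‖u.fn‖ ≤ C * ‖u‖ := by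
  obtain ⟨C, hC0, hC⟩ := sobolev_testH F
  refine ⟨C, hC0, fun u => ?_⟩
  obtain ⟨v, hv, h⟩ := exists_of_mem_closure_gradL hC0 hC (gradL_mem_closure u)
  rwa [HDot1.gradL_injective hv] at h

/-- Test functions are dense in `Ḣ¹`. -/
lemma HDot1.exists_testH_tendsto (u : HDot1 F) : ∃ (f : ℕ → R4 → F) (hf : ∀ n, IsTestFun (f n)),
    Tendsto (fun n => testH (f n) (hf n)) atTop (𝓝 u) := by
  obtain ⟨s, hs, hlim⟩ := mem_closure_iff_seq_limit.1 (gradL_mem_closure u)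
  choose t ht hts using hs
  choose f hf hft using ht
  refine ⟨f, hf, ?_⟩
  rw [tendsto_iff_norm_sub_tendsto_zero] at hlim ⊢
  refine hlim.congr fun n => ?_
  rw [← hts n, hft n, ← map_sub, HDot1.norm_gradL]

/-- The gradient is an isometry whose range is the closure of the test gradients, hence closed in a
complete space. -/
instance : CompleteSpace (HDot1 F) := by
  obtain ⟨C, hC0, hC⟩ := sobolev_testH F
  have hi : IsUniformInducing (HDot1.gradL F) :=
    (AddMonoidHomClass.isometry_of_norm (HDot1.gradL F) HDot1.norm_gradL).isUniformInducing
  refine (completeSpace_iff_isComplete_range hi).2 (IsClosed.isComplete ?_)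
  have : Set.range (HDot1.gradL F)
      = closure (((testSpace F).map (HDot1.gradL F) : Submodule ℝ _) : Set _) := by
    refine Set.Subset.antisymm ?_ fun y hy => ?_
    · rintro _ ⟨u, rfl⟩; exact gradL_mem_closure u
    · obtain ⟨v, hv, -⟩ := exists_of_mem_closure_gradL hC0 hC hy
      exact ⟨v, hv⟩
  rw [this]
  exact isClosed_closure

end Density

/-! ### Adjoints over ℝ and a coercive operator -/

section RealAdjoint

variable {E G : Type*} [NormedAddCommGroup E] [InnerProductSpace ℝ E] [CompleteSpace E]
  [NormedAddCommGroup G] [InnerProductSpace ℝ G] [CompleteSpace G]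

variable (E G) in
/-- Over the reals, taking adjoints is a bounded linear map. -/
def adjointL : (E →L[ℝ] G) →L[ℝ] (G →L[ℝ] E) :=
  LinearMap.mkContinuous
    { toFun := fun T => ContinuousLinearMap.adjoint T
      map_add' := fun S T => map_add _ S T
      map_smul' := fun c T => by rw [map_smulₛₗ]; rfl } 1 fun T => by simp

lemma adjointL_inner_right (T : E →L[ℝ] G) (x : E) (y : G) :
    inner ℝ x (adjointL E G T y) = inner ℝ (T x) y :=
  ContinuousLinearMap.adjoint_inner_right T x y

/-- Lax–Milgram: ⟨(1 + T*T)x, x⟩ = ‖x‖² + ‖Tx‖² ≥ ‖x‖². -/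
lemma isUnit_one_add_adjoint_comp (T : E →L[ℝ] G) :
    IsUnit (1 + (adjointL E G T).comp T : E →L[ℝ] E) := by
  refine ContinuousLinearMap.isUnit_of_forall_le_norm_inner_map _ (c := 1) one_pos fun x => ?_
  have h : inner ℝ ((1 + (adjointL E G T).comp T : E →L[ℝ] E) x) x = ‖x‖ ^ 2 + ‖T x‖ ^ 2 := by
    rw [real_inner_comm]
    simp only [add_apply, one_apply_eq_self,
      ContinuousLinearMap.comp_apply, inner_add_right, adjointL_inner_right,
      real_inner_self_eq_norm_sq]
  rw [h, Real.norm_of_nonneg (by positivity), NNReal.coe_one, mul_one]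
  linarith [sq_nonneg ‖T x‖]

end RealAdjoint

/-! ### Derivatives, Sobolev embedding and multiplication as bounded operators -/

section Operators

variable (F : Type) [NormedAddCommGroup F] [InnerProductSpace ℝ F] [CompleteSpace F]

/-- The `j`-th derivative as a bounded map `Ḣ¹ → L²`. -/
def derivL (j : Fin 4) : HDot1 F →L[ℝ] L2 F :=
  LinearMap.mkContinuous
    { toFun := fun u => u.D j, map_add' := fun _ _ => rfl, map_smul' := fun _ _ => rfl } 1
    fun u => by
      rw [one_mul, ← HDot1.norm_gradL]
      exact PiLp.norm_apply_le (HDot1.gradL F u) j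

lemma derivL_apply (j : Fin 4) (u : HDot1 F) : derivL F j u = u.D j := rfl

/-- The Sobolev embedding `Ḣ¹ → L⁴`. -/
def embL [FiniteDimensional ℝ F] : HDot1 F →L[ℝ] L4 F :=
  LinearMap.mkContinuous
    { toFun := fun u => u.fn, map_add' := fun _ _ => rfl, map_smul' := fun _ _ => rfl }
    (HDot1.sobolev F).choose fun u => (HDot1.sobolev F).choose_spec.2 u

end Operators

lemma iMul_ae (a : L4 ℝ) (f : L4 ℂ) :
    iMul a f =ᵐ[volume] fun x => Complex.I * ((a x : ℂ) * f x) := MemLp.coeFn_toLp _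

/-- Hölder with 1/4 + 1/4 = 1/2. -/
lemma norm_iMul_le (a : L4 ℝ) (f : L4 ℂ) : ‖iMul a f‖ ≤ ‖a‖ * ‖f‖ := by
  have h1 : eLpNorm (fun x => Complex.I * ((a x : ℂ) * f x)) 2 volume
      ≤ eLpNorm a 4 volume * eLpNorm f 4 volume := by
    have h : eLpNorm (fun x => Complex.I * ((a x : ℂ) * f x)) 2 volume
        = eLpNorm ((a : R4 → ℝ) • (f : R4 → ℂ)) 2 volume := by
      refine eLpNorm_congr_norm_ae (Eventually.of_forall fun x => ?_)
      simp
    rw [h]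
    exact eLpNorm_smul_le_mul_eLpNorm (Lp.aestronglyMeasurable f) (Lp.aestronglyMeasurable a)
  have h2 := ENNReal.toReal_mono
    (ENNReal.mul_ne_top (Lp.memLp a).2.ne (Lp.memLp f).2.ne) h1
  rwa [ENNReal.toReal_mul, ← Lp.norm_def, ← Lp.norm_def, ← Lp.norm_toLp] at h2

/-- The product `(a, f) ↦ i a f` as a bounded bilinear map `L⁴ × L⁴ → L²`. -/
def iMulL : L4 ℝ →L[ℝ] L4 ℂ →L[ℝ] L2 ℂ :=
  LinearMap.mkContinuous₂
    (LinearMap.mk₂ ℝ iMul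
      (fun a b f => by
        apply Lp.ext
        filter_upwards [iMul_ae (a + b) f, iMul_ae a f, iMul_ae b f, Lp.coeFn_add a b,
          Lp.coeFn_add (iMul a f) (iMul b f)] with x h1 h2 h3 h4 h5
        rw [h1, h5, Pi.add_apply, h2, h3, h4, Pi.add_apply]; push_cast; ring)
      (fun c a f => by
        apply Lp.ext
        filter_upwards [iMul_ae (c • a) f, iMul_ae a f, Lp.coeFn_smul c a,
          Lp.coeFn_smul c (iMul a f)] with x h1 h2 h3 h4
        rw [h1, h4, Pi.smul_apply, h2, h3, Pi.smul_apply, Complex.real_smul, smul_eq_mul]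
        push_cast; ring)
      (fun a f g => by
        apply Lp.ext
        filter_upwards [iMul_ae a (f + g), iMul_ae a f, iMul_ae a g, Lp.coeFn_add f g,
          Lp.coeFn_add (iMul a f) (iMul a g)] with x h1 h2 h3 h4 h5
        rw [h1, h5, Pi.add_apply, h2, h3, h4, Pi.add_apply]; ring)
      (fun c a f => by
        apply Lp.ext
        filter_upwards [iMul_ae a (c • f), iMul_ae a f, Lp.coeFn_smul c f,
          Lp.coeFn_smul c (iMul a f)] with x h1 h2 h3 h4
        rw [h1, h4, Pi.smul_apply, h2, h3, Pi.smul_apply, Complex.real_smul, Complex.real_smul]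
        ring)) 1
    fun a f => by rw [one_mul]; exact norm_iMul_le a f

/-- The multiplication operators `M_φ : h ↦ i h φ`, `Ḣ¹ → L²`, as a linear function of `φ ∈ Ḣ¹`. -/
def mulOp : HDot1 ℂ →L[ℝ] HDot1 ℝ →L[ℝ] L2 ℂ :=
  ((ContinuousLinearMap.compL ℝ (HDot1 ℝ) (L4 ℝ) (L2 ℂ)).flip (embL ℝ)).comp
    (iMulL.flip.comp (embL ℂ))

lemma mulOp_apply (φ : HDot1 ℂ) (h : HDot1 ℝ) : mulOp φ h = iMul h.fn φ.fn := rfl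

/-- For real w one has Re(conj(i w φ) g) = -w Im(φ conj g). Thus the current is the transpose of
multiplication by iφ, which is what makes both equations of (∗) adjoint equations. -/
lemma inner_iMul (w : L4 ℝ) (φ : L4 ℂ) (g : L2 ℂ) :
    inner ℝ (iMul w φ) g = ∫ x, w x * current φ g x := by
  rw [MeasureTheory.L2.inner_def]
  refine integral_congr_ae ?_
  filter_upwards [iMul_ae w φ] with x hx
  rw [hx, Complex.inner, current]
  simp only [map_mul, Complex.conj_I, Complex.conj_ofReal, Complex.mul_re, Complex.mul_im,
    Complex.neg_re, Complex.neg_im, Complex.I_re, Complex.I_im, Complex.ofReal_re,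
    Complex.ofReal_im, Complex.conj_re, Complex.conj_im]
  ring

/-! ### The equations for A₀ and ∂ₜA₀ in operator form -/

section Pairing

variable {F : Type} [NormedAddCommGroup F] [NormedSpace ℝ F]

/-- Integration against a test function, as a linear map on `L^p`. -/
def testPairing {η : R4 → ℝ} (hη : IsTest η) {p : ℝ≥0∞} (hp : 1 ≤ p) :
    Lp F p (volume : Measure R4) →ₗ[ℝ] F where
  toFun u := ∫ x, η x • u x
  map_add' u v := integral_test_add hη hp u v
  map_smul' c u := integral_test_smul η c u

lemma testPairing_apply {η : R4 → ℝ} (hη : IsTest η) {p : ℝ≥0∞} (hp : 1 ≤ p)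
    (u : Lp F p (volume : Measure R4)) : testPairing hη hp u = ∫ x, η x • u x := rfl

end Pairing

lemma inner_testH {η : R4 → ℝ} (hη : IsTest η) (v : HDot1 ℝ) :
    inner ℝ (testH η hη) v = ∑ j, ∫ x, pd j η x * v.D j x := by
  rw [HDot1.inner_eq]
  refine Finset.sum_congr rfl fun j _ => ?_
  rw [MeasureTheory.L2.inner_def]
  refine integral_congr_ae ?_
  filter_upwards [testH_D_ae η hη j] with x hx
  rw [hx, RCLike.inner_apply, conj_trivial, mul_comm]; rfl

/-- This identifies -Δ with the Riesz map of Ḣ¹, so that weak equations for Δv become identities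
between elements of Ḣ¹. -/
lemma integral_laplacian_mul_fn {η : R4 → ℝ} (hη : IsTest η) (v : HDot1 ℝ) :
    ∫ x, (Δ η) x * v.fn x = - inner ℝ (testH η hη) v := by
  rw [inner_testH]
  simp only [laplacian_eq_sum_partialD (contDiff_infty.1 hη.1 2), Finset.sum_mul]
  rw [integral_finsetSum]
  · rw [← Finset.sum_neg_distrib]
    exact Finset.sum_congr rfl fun j _ => v.isWeakPartial j _ (hη.pd_isTest j)
  · exact fun j _ => integrable_test_smul ((hη.pd_isTest j).pd_isTest j) (by norm_num) v.fn

lemma integral_laplacian_mul_D {η : R4 → ℝ} (hη : IsTest η) (v : HDot1 ℝ) (k : Fin 4) :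
    ∫ x, (Δ η) x * v.D k x = inner ℝ (testH _ (hη.pd_isTest k)) v := by
  rw [inner_testH]
  exact integral_laplacian_smul_D v hη k

lemma integral_test_mul_current {η : R4 → ℝ} (hη : IsTest η) (φ : HDot1 ℂ) (g : L2 ℂ) :
    ∫ x, η x * current φ.fn g x = inner ℝ (mulOp φ (testH η hη)) g := by
  rw [mulOp_apply, inner_iMul]
  refine integral_congr_ae ?_
  filter_upwards [testH_fn_ae η hη] with x hx
  rw [hx]

lemma HDot1.eq_zero_of_inner_testH (w : HDot1 ℝ)
    (h : ∀ (η : R4 → ℝ) (hη : IsTest η), inner ℝ (testH η hη) w = 0) : w = 0 :=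
  HDot1.eq_zero_of_orthogonal w h

lemma covDt_eq (U : LinData) (A0 : HDot1 ℝ) : covDt U A0 = U.φt + mulOp U.φ A0 := rfl

/-- The weak form of `ΔA₀ = J₀` in operator form. -/
lemma hasWeakLaplacian_current_iff (v : HDot1 ℝ) (φ : HDot1 ℂ) (g : L2 ℂ) :
    HasWeakLaplacian v.fn (current φ.fn g) ↔ v = - adjointL _ _ (mulOp φ) g := by
  constructor
  · intro h
    rw [← sub_eq_zero, sub_neg_eq_add]
    refine HDot1.eq_zero_of_inner_testH _ fun η hη => ?_
    have := h η hη
    rw [integral_laplacian_mul_fn hη, integral_test_mul_current hη] at this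
    rw [inner_add_right, adjointL_inner_right]
    linarith
  · intro h η hη
    rw [integral_laplacian_mul_fn hη, integral_test_mul_current hη, h, inner_neg_right,
      adjointL_inner_right, neg_neg]

lemma solvesA0_iff (U : LinData) (A0 : HDot1 ℝ) :
    SolvesA0 U A0 ↔ A0 = - adjointL _ _ (mulOp U.φ) (U.φt + mulOp U.φ A0) :=
  hasWeakLaplacian_current_iff A0 U.φ _

/-- The operator `1 - Δ⁻¹|φ|²` on `Ḣ¹`. -/
def gaussOp (φ : HDot1 ℂ) : HDot1 ℝ →L[ℝ] HDot1 ℝ :=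
  1 + (adjointL _ _ (mulOp φ)).comp (mulOp φ)

/-- The solution operator for `A₀`. -/
def solA0 (U : LinData) : HDot1 ℝ :=
  - (Ring.inverse (gaussOp U.φ)) (adjointL _ _ (mulOp U.φ) U.φt)

/-- The equation A₀ = -M*(∂ₜφ + M A₀) rearranges to (1 + M*M) A₀ = -M*∂ₜφ, and 1 + M*M is
invertible. -/
lemma solvesA0_iff_eq_solA0 (U : LinData) (A0 : HDot1 ℝ) : SolvesA0 U A0 ↔ A0 = solA0 U := by
  have hu : IsUnit (gaussOp U.φ) := isUnit_one_add_adjoint_comp _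
  have h1 : ∀ v, Ring.inverse (gaussOp U.φ) (gaussOp U.φ v) = v := fun v => by
    have := congrArg (fun T : HDot1 ℝ →L[ℝ] HDot1 ℝ => T v) (Ring.inverse_mul_cancel _ hu)
    simpa using this
  have h2 : ∀ v, gaussOp U.φ (Ring.inverse (gaussOp U.φ) v) = v := fun v => by
    have := congrArg (fun T : HDot1 ℝ →L[ℝ] HDot1 ℝ => T v) (Ring.mul_inverse_cancel _ hu)
    simpa using this
  have h3 : ∀ v, gaussOp U.φ v = v + adjointL _ _ (mulOp U.φ) (mulOp U.φ v) := fun v => rfl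
  rw [solvesA0_iff, map_add, solA0]
  have h4 : A0 = -(adjointL _ _ (mulOp U.φ) U.φt + adjointL _ _ (mulOp U.φ) (mulOp U.φ A0)) ↔
      gaussOp U.φ A0 = - adjointL _ _ (mulOp U.φ) U.φt := by
    rw [h3]
    constructor
    · intro h; nth_rewrite 1 [h]; abel
    · intro h; rw [neg_add, ← h]; abel
  rw [h4]
  constructor
  · intro h; rw [← h1 A0, h, map_neg]
  · intro h; rw [h, map_neg, h2]

/-- The solution operator for `∂ₜA₀`. -/
def solDtA0 (U : LinData) : L2 ℝ :=
  - ∑ l, derivL ℝ l (adjointL _ _ (mulOp U.φ) (covD U.A U.φ l))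

/-- Pairing Δη with ∂_l M* D_lφ gives ⟨∂_lη, M* D_lφ⟩ = ⟨M ∂_lη, D_lφ⟩ = ∫ ∂_lη J_l. -/
lemma solvesDtA0_solDtA0 (U : LinData) : SolvesDtA0 U (solDtA0 U) := by
  intro η hη
  have h := testPairing_apply (isTest_laplacian hη) (by norm_num) (solDtA0 U)
  rw [solDtA0, map_neg, map_sum] at h
  rw [← solDtA0] at h
  refine h.symm.trans ?_
  congr 1
  refine Finset.sum_congr rfl fun l _ => ?_
  rw [testPairing_apply]
  exact (integral_laplacian_mul_D hη _ l).trans ((adjointL_inner_right _ _ _).trans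
    (integral_test_mul_current (hη.pd_isTest l) U.φ _).symm)

/-- Uniqueness for ∂ₜA₀: the difference of two solutions is weakly harmonic and in L². -/
lemma L2_eq_of_integral_laplacian {B B' : L2 ℝ}
    (h : ∀ η : R4 → ℝ, IsTest η → ∫ x, (Δ η) x * B x = ∫ x, (Δ η) x * B' x) : B = B' := by
  rw [← sub_eq_zero, Lp.eq_zero_iff_ae_eq_zero]
  refine ae_eq_zero_of_weakly_harmonic (Lp.memLp (B - B')) fun η hη => ?_
  exact (integral_test_sub (isTest_laplacian hη) (by norm_num) B B').trans
    (sub_eq_zero.2 (h η hη))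

lemma solvesDtA0_iff (U : LinData) (B : L2 ℝ) : SolvesDtA0 U B ↔ B = solDtA0 U := by
  constructor
  · intro h
    exact L2_eq_of_integral_laplacian fun η hη =>
      (h η hη).trans (solvesDtA0_solDtA0 U η hη).symm
  · rintro rfl; exact solvesDtA0_solDtA0 U

lemma covD_eq (A : Fin 4 → HDot1 ℝ) (φ : HDot1 ℂ) (j : Fin 4) :
    covD A φ j = derivL ℂ j φ + mulOp φ (A j) := rfl

/-! ### Smooth dependence on the data -/

lemma contDiff_mulOp : ContDiff ℝ ∞ fun U : LinData => mulOp U.φ :=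
  mulOp.contDiff.comp (contDiff_fst.comp (contDiff_snd.comp contDiff_snd))

lemma contDiff_adjoint_mulOp :
    ContDiff ℝ ∞ fun U : LinData => adjointL _ _ (mulOp U.φ) :=
  (adjointL (HDot1 ℝ) (L2 ℂ)).contDiff.comp contDiff_mulOp

lemma contDiff_φt : ContDiff ℝ ∞ fun U : LinData => U.φt :=
  contDiff_snd.comp (contDiff_snd.comp contDiff_snd)

lemma contDiff_φ : ContDiff ℝ ∞ fun U : LinData => U.φ :=
  contDiff_fst.comp (contDiff_snd.comp contDiff_snd)

lemma contDiff_A (j : Fin 4) : ContDiff ℝ ∞ fun U : LinData => U.A j :=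
  (contDiff_apply ℝ _ j).comp contDiff_fst

lemma contDiff_At (j : Fin 4) : ContDiff ℝ ∞ fun U : LinData => U.At j :=
  (contDiff_apply ℝ _ j).comp (contDiff_fst.comp contDiff_snd)

/-- The operator 1 + M*M is quadratic in φ, and inversion in a Banach algebra is smooth at units.
Over ℝ the adjoint is bounded linear, so no conjugation spoils smoothness. -/
lemma contDiff_solA0 : ContDiff ℝ ∞ solA0 := by
  have h1 : ContDiff ℝ ∞ fun U : LinData => gaussOp U.φ :=
    contDiff_const.add (contDiff_adjoint_mulOp.clm_comp contDiff_mulOp)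
  have h2 : ContDiff ℝ ∞ fun U : LinData => Ring.inverse (gaussOp U.φ) := by
    rw [contDiff_iff_contDiffAt]
    intro U
    obtain ⟨u, hu⟩ : IsUnit (gaussOp U.φ) := isUnit_one_add_adjoint_comp _
    have h3 := contDiffAt_ringInverse (n := ∞) ℝ u
    rw [hu] at h3
    exact ContDiffAt.comp U h3 h1.contDiffAt
  exact (h2.clm_apply (contDiff_adjoint_mulOp.clm_apply contDiff_φt)).neg

lemma contDiff_covD (j : Fin 4) : ContDiff ℝ ∞ fun U : LinData => covD U.A U.φ j :=
  ((derivL ℂ j).contDiff.comp contDiff_φ).add (contDiff_mulOp.clm_apply (contDiff_A j))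

lemma contDiff_solDtA0 : ContDiff ℝ ∞ solDtA0 :=
  (ContDiff.sum fun l _ => (derivL ℝ l).contDiff.comp
    (contDiff_adjoint_mulOp.clm_apply (contDiff_covD l))).neg

lemma contDiff_energy : ContDiff ℝ ∞ fun U : LinData => energy (toCovData U (solA0 U)) := by
  have he : ∀ j, ContDiff ℝ ∞ fun U : LinData => U.At j - (solA0 U).D j := fun j =>
    (contDiff_At j).sub ((derivL ℝ j).contDiff.comp contDiff_solA0)
  have hc : ∀ j k, ContDiff ℝ ∞ fun U : LinData => (U.A k).D j - (U.A j).D k := fun j k =>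
    ((derivL ℝ j).contDiff.comp (contDiff_A k)).sub ((derivL ℝ k).contDiff.comp (contDiff_A j))
  have hg : ContDiff ℝ ∞ fun U : LinData => covDt U (solA0 U) :=
    contDiff_φt.add (contDiff_mulOp.clm_apply contDiff_solA0)
  exact ((contDiff_const.mul (ContDiff.sum fun j _ => (he j).norm_sq ℝ)).add
    (contDiff_const.mul (ContDiff.sum fun j _ => ContDiff.sum fun k _ =>
      (hc j k).norm_sq ℝ))).add
    (contDiff_const.mul ((hg.norm_sq ℝ).add
      (ContDiff.sum fun j _ => (contDiff_covD j).norm_sq ℝ)))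

/-! ### Divergence, the Gauss equation and the Coulomb condition -/

section Divergence

/-- The negative divergence `L² → Ḣ⁻¹`, followed by the Riesz identification with `Ḣ¹`; this is
the adjoint of the gradient. -/
def gradAdj (V : Fin 4 → L2 ℝ) : HDot1 ℝ := ∑ l, adjointL _ _ (derivL ℝ l) (V l)

lemma inner_gradAdj (u : HDot1 ℝ) (V : Fin 4 → L2 ℝ) :
    inner ℝ u (gradAdj V) = ∑ l, inner ℝ (u.D l) (V l) := by
  rw [gradAdj, inner_sum]
  exact Finset.sum_congr rfl fun l _ => adjointL_inner_right _ _ _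

lemma gradAdj_grad (v : HDot1 ℝ) : gradAdj (fun l => v.D l) = v :=
  ext_inner_left ℝ fun u => by rw [inner_gradAdj, HDot1.inner_eq]

lemma gradAdj_add (V W : Fin 4 → L2 ℝ) : gradAdj (fun l => V l + W l) = gradAdj V + gradAdj W := by
  simp only [gradAdj, map_add, Finset.sum_add_distrib]

lemma inner_testH_gradAdj {η : R4 → ℝ} (hη : IsTest η) (V : Fin 4 → L2 ℝ) :
    inner ℝ (testH η hη) (gradAdj V) = ∑ l, ∫ x, pd l η x * V l x := by
  rw [inner_gradAdj]
  refine Finset.sum_congr rfl fun l _ => ?_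
  rw [MeasureTheory.L2.inner_def]
  refine integral_congr_ae ?_
  filter_upwards [testH_D_ae η hη l] with x hx
  rw [hx, RCLike.inner_apply, conj_trivial, mul_comm]; rfl

lemma hasWeakDiv_zero_iff (V : Fin 4 → L2 ℝ) :
    HasWeakDiv (fun l => V l) 0 ↔ gradAdj V = 0 := by
  constructor
  · intro h
    refine HDot1.eq_zero_of_inner_testH _ fun η hη => ?_
    rw [inner_testH_gradAdj, h η hη]; simp
  · intro h η hη
    rw [← inner_testH_gradAdj hη, h]; simp

/-- Both sides of the Gauss equation are represented in Ḣ¹ by Riesz: -div V by the adjoint of the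
gradient, and -Im(f conj g) by M_f* g. -/
lemma hasWeakDiv_gauss_iff (V : Fin 4 → L2 ℝ) (f : HDot1 ℂ) (g : L2 ℂ) :
    HasWeakDiv (fun l => V l) (fun x => (f.fn x * (starRingEnd ℂ) (g x)).im) ↔
      gradAdj V = adjointL _ _ (mulOp f) g := by
  have h0 : ∀ (η : R4 → ℝ) (hη : IsTest η),
      - ∫ x, η x * (f.fn x * (starRingEnd ℂ) (g x)).im
        = inner ℝ (testH η hη) (adjointL _ _ (mulOp f) g) := by
    intro η hη
    rw [adjointL_inner_right, ← integral_test_mul_current hη, ← integral_neg]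
    exact integral_congr_ae (Eventually.of_forall fun x => by simp only [current, mul_neg])
  constructor
  · intro h
    rw [← sub_eq_zero]
    refine HDot1.eq_zero_of_inner_testH _ fun η hη => ?_
    rw [inner_sub_right, inner_testH_gradAdj, h η hη, h0 η hη, sub_self]
  · intro h η hη
    rw [h0 η hη, ← h, inner_testH_gradAdj]

/-- Continuous functions which agree on test functions agree on `Ḣ¹`. -/
lemma HDot1.eq_of_eq_testH {F : Type} [NormedAddCommGroup F] [InnerProductSpace ℝ F]
    [FiniteDimensional ℝ F] [CompleteSpace F] {X : Type*} [TopologicalSpace X] [T2Space X]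
    {S T : HDot1 F → X} (hS : Continuous S) (hT : Continuous T)
    (h : ∀ f hf, S (testH f hf) = T (testH f hf)) (u : HDot1 F) : S u = T u := by
  obtain ⟨f, hf, hlim⟩ := u.exists_testH_tendsto
  refine tendsto_nhds_unique ((hS.tendsto u).comp hlim) (((hT.tendsto u).comp hlim).congr ?_)
  exact fun n => (h _ _).symm

/-- For a test function v both sides are -∫ u ∂_j∂_k v; density in v gives the rest. -/
lemma inner_D_comm (u v : HDot1 ℝ) (j k : Fin 4) :
    inner ℝ (u.D j) (v.D k) = inner ℝ (u.D k) (v.D j) := by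
  refine HDot1.eq_of_eq_testH (S := fun v => inner ℝ (u.D j) (v.D k))
    (T := fun v => inner ℝ (u.D k) (v.D j))
    (continuous_const.inner (derivL ℝ k).continuous)
    (continuous_const.inner (derivL ℝ j).continuous) (fun η hη => ?_) v
  have h : ∀ j k, inner ℝ (u.D j) ((testH η hη).D k) = - ∫ x, pd j (pd k η) x * u.fn x := by
    intro j k
    have h1 := u.isWeakPartial j _ (IsTest.pd_isTest hη k)
    simp only [smul_eq_mul] at h1
    rw [h1, neg_neg, MeasureTheory.L2.inner_def]
    refine integral_congr_ae ?_
    filter_upwards [testH_D_ae η hη k] with x hx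
    rw [hx, RCLike.inner_apply, conj_trivial]; rfl
  rw [h, h]
  congr 1
  refine integral_congr_smul_fun (fun x => ?_) _
  exact partialD_comm (contDiff_infty.1 hη.1 2) j k x

lemma sum_D_eq_zero {a : Fin 4 → HDot1 ℝ} (h : HasWeakDiv (fun l => (a l).fn) 0) :
    ∑ l, (a l).D l = 0 := by
  rw [Lp.eq_zero_iff_ae_eq_zero]
  refine ae_eq_zero_of_integral_contDiff_smul_eq_zero
    ((Lp.memLp _).locallyIntegrable (by norm_num)) fun η h1 h2 => ?_
  have hη : IsTest η := ⟨h1, h2⟩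
  have e1 := testPairing_apply hη (by norm_num) (∑ l, (a l).D l)
  rw [← e1, map_sum, ← neg_eq_zero, ← Finset.sum_neg_distrib]
  have e2 := h η hη
  simp only [Pi.zero_apply, mul_zero, integral_zero, neg_zero] at e2
  rw [← e2]
  refine Finset.sum_congr rfl fun l _ => ?_
  rw [testPairing_apply]
  exact ((a l).isWeakPartial l η hη).symm

/-- For divergence free `a`, the curl controls the full gradient. -/
lemma sum_norm_curl_sq {a : Fin 4 → HDot1 ℝ} (h : HasWeakDiv (fun l => (a l).fn) 0) :
    ∑ j, ∑ k, ‖(a k).D j - (a j).D k‖ ^ 2 = 2 * ∑ j, ‖a j‖ ^ 2 := by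
  -- Exchanging the derivatives turns the cross term of the curl into ‖div a‖² = 0.
  have h0 : ∑ j, ∑ k, inner ℝ ((a k).D j) ((a j).D k) = 0 := by
    have h1 : ∑ j, ∑ k, inner ℝ ((a k).D j) ((a j).D k)
        = ∑ j, ∑ k, inner ℝ ((a k).D k) ((a j).D j) :=
      Finset.sum_congr rfl fun j _ => Finset.sum_congr rfl fun k _ => inner_D_comm _ _ _ _
    rw [h1, Finset.sum_comm]
    simp only [← inner_sum, ← sum_inner, sum_D_eq_zero h, inner_zero_left]
  simp only [norm_sub_sq_real, HDot1.norm_sq_eq, Finset.sum_add_distrib, Finset.sum_sub_distrib,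
    ← Finset.mul_sum, h0]
  rw [Finset.sum_comm (f := fun j k => ‖(a k).D j‖ ^ 2)]
  ring

end Divergence

/-! ### The diamagnetic inequality -/

section Diamagnetic

/-- The regularized modulus `√(|z|² + δ²) - δ`. -/
def regAbs (δ : ℝ) (z : ℂ) : ℝ := Real.sqrt (‖z‖ ^ 2 + δ ^ 2) - δ

lemma isTest_regAbs {δ : ℝ} (hδ : 0 < δ) {f : R4 → ℂ} (hf : IsTestFun f) :
    IsTest (fun x => regAbs δ (f x)) := by
  -- Subtracting δ makes the regularized modulus vanish at 0, which preserves compact support.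
  refine ⟨?_, hf.2.comp_left (g := regAbs δ) ?_⟩
  · exact (((hf.1.norm_sq ℝ).add contDiff_const).sqrt fun x => by positivity).sub contDiff_const
  · simp [regAbs, Real.sqrt_sq hδ.le]

/-- With s = √(|f|² + δ²), the derivative is ⟨f, ∂_j f⟩ / s. Since i a f is orthogonal to f for the
real inner product, ∂_j f may be replaced by the covariant derivative; then Cauchy–Schwarz and |f| ≤
s apply. -/
lemma abs_partialD_regAbs_le {δ : ℝ} (hδ : 0 < δ) {f : R4 → ℂ} (hf : IsTestFun f) (j : Fin 4)
    (x : R4) (a : ℝ) : |partialD j (fun x => regAbs δ (f x)) x|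
      ≤ ‖partialD j f x + Complex.I * (a * f x)‖ := by
  set s := Real.sqrt (‖f x‖ ^ 2 + δ ^ 2) with hs
  have hpos : 0 < ‖f x‖ ^ 2 + δ ^ 2 := by positivity
  have hspos : 0 < s := Real.sqrt_pos.2 hpos
  have hd := ((((hf.differentiable x).hasFDerivAt.norm_sq).add_const (δ ^ 2)).sqrt
    hpos.ne').sub_const δ
  have h1 : partialD j (fun x => regAbs δ (f x)) x = inner ℝ (f x) (partialD j f x) / s := by
    unfold partialD regAbs
    rw [hd.fderiv]
    simp only [smul_apply, ContinuousLinearMap.comp_apply, innerSL_apply_apply, smul_eq_mul,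
      nsmul_eq_mul]
    field_simp
    push_cast
    ring
  have h2 : inner ℝ (f x) (partialD j f x)
      = inner ℝ (f x) (partialD j f x + Complex.I * (a * f x)) := by
    rw [inner_add_right]
    have : inner ℝ (f x) (Complex.I * (a * f x)) = 0 := by
      rw [Complex.inner]
      simp only [Complex.mul_re, Complex.mul_im, Complex.I_re, Complex.I_im, Complex.ofReal_re,
        Complex.ofReal_im, Complex.conj_re, Complex.conj_im]
      ring
    rw [this, add_zero]
  rw [h1, h2, abs_div, abs_of_pos hspos, div_le_iff₀ hspos]
  refine (abs_real_inner_le_norm _ _).trans ?_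
  rw [mul_comm]
  gcongr
  rw [hs]
  exact Real.le_sqrt_of_sq_le (by nlinarith)

/-- The gauge covariant Sobolev inequality `‖f‖_{L⁴} ≤ C ‖D_a f‖_{L²}`. -/
lemma exists_norm_fn_sq_le_covD : ∃ C : ℝ, 0 < C ∧ ∀ (a : Fin 4 → HDot1 ℝ) (f : HDot1 ℂ),
    ‖f.fn‖ ≤ C * Real.sqrt (∑ j, ‖covD a f j‖ ^ 2) := by
  obtain ⟨C, hC0, hC⟩ := HDot1.sobolev ℝ
  refine ⟨C, hC0, fun a f => ?_⟩
  have htest : ∀ (f : R4 → ℂ) (hf : IsTestFun f),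
      ‖(testH f hf).fn‖ ≤ C * Real.sqrt (∑ j, ‖covD a (testH f hf) j‖ ^ 2) := by
    intro f hf
    set B := C * Real.sqrt (∑ j, ‖covD a (testH f hf) j‖ ^ 2) with hB
    have hB0 : 0 ≤ B := by positivity
    have hreg : ∀ δ : ℝ, 0 < δ → eLpNorm (fun x => regAbs δ (f x)) 4 volume ≤ ENNReal.ofReal B := by
      intro δ hδ
      have ht : IsTestFun fun x => regAbs δ (f x) := isTest_regAbs hδ hf
      have h1 := hC (testH _ ht)
      have h2 : ‖testH _ ht‖ ≤ Real.sqrt (∑ j, ‖covD a (testH f hf) j‖ ^ 2) := by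
        refine Real.le_sqrt_of_sq_le ?_
        rw [HDot1.norm_sq_eq]
        refine Finset.sum_le_sum fun j _ => ?_
        gcongr
        refine Lp.norm_le_norm_of_ae_le ?_
        filter_upwards [testH_D_ae _ ht j, testH_D_ae f hf j, testH_fn_ae f hf,
          iMul_ae (a j).fn (testH f hf).fn,
          Lp.coeFn_add ((testH f hf).D j) (iMul (a j).fn (testH f hf).fn)] with x e1 e2 e3 e4 e5
        rw [covD, e5, Pi.add_apply, e4, e1, e2, e3, Real.norm_eq_abs]
        exact abs_partialD_regAbs_le hδ hf j x _
      have h3 : ‖(testH _ ht).fn‖ ≤ B := h1.trans (by rw [hB]; gcongr)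
      rw [testH_fn, Lp.norm_toLp] at h3
      exact (ENNReal.le_ofReal_iff_toReal_le (ht.memLp 4).2.ne hB0).2 h3
    have hlim : ∀ x, Tendsto (fun n : ℕ => regAbs (1 / ((n : ℝ) + 1)) (f x)) atTop (𝓝 ‖f x‖) := by
      intro x
      have hc : Continuous fun δ : ℝ => regAbs δ (f x) := by unfold regAbs; fun_prop
      have h := (hc.tendsto 0).comp (tendsto_one_div_add_atTop_nhds_zero_nat (𝕜 := ℝ))
      have h0 : regAbs 0 (f x) = ‖f x‖ := by simp [regAbs]
      rwa [h0] at h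
    -- Fatou's lemma along δ = 1/(n + 1): the bound for the regularized modulus does not depend on
    -- δ.
    have hfat := Lp.eLpNorm_lim_le_liminf_eLpNorm (p := 4) (μ := (volume : Measure R4))
      (f := fun (n : ℕ) x => regAbs (1 / ((n : ℝ) + 1)) (f x))
      (fun n => (isTest_regAbs (by positivity) hf).1.continuous.aestronglyMeasurable)
      (fun x => ‖f x‖) (Eventually.of_forall hlim)
    have hle : eLpNorm (fun x => ‖f x‖) 4 volume ≤ ENNReal.ofReal B := by
      refine hfat.trans ((liminf_le_liminf (Eventually.of_forall fun n : ℕ =>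
        hreg (1 / ((n : ℝ) + 1)) (by positivity))).trans ?_)
      simp
    rw [eLpNorm_norm] at hle
    rw [testH_fn, Lp.norm_toLp]
    exact (ENNReal.le_ofReal_iff_toReal_le (hf.memLp 4).2.ne hB0).1 hle
  obtain ⟨g, hg, hlim⟩ := f.exists_testH_tendsto
  have hc : Continuous fun f : HDot1 ℂ => C * Real.sqrt (∑ j, ‖covD a f j‖ ^ 2) := by
    have : ∀ j, Continuous fun f : HDot1 ℂ => covD a f j := fun j =>
      (derivL ℂ j).continuous.add
        ((ContinuousLinearMap.apply ℝ (L2 ℂ) (a j)).continuous.comp mulOp.continuous)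
    fun_prop
  exact le_of_tendsto_of_tendsto' (((embL ℂ).continuous.norm.tendsto f).comp hlim)
    ((hc.tendsto f).comp hlim) fun n => htest _ _

end Diamagnetic

/-! ### Comparison of the energy with the linear energy -/

section Energy

lemma linEnergy_eq (U : LinData) : linEnergy U
    = (1 / 2) * (∑ j, ‖U.At j‖ ^ 2 + ∑ j, ‖U.A j‖ ^ 2 + ‖U.φt‖ ^ 2 + ‖U.φ‖ ^ 2) := by
  simp only [linEnergy, HDot1.norm_sq_eq, Finset.sum_add_distrib]
  ring

lemma norm_sq_add_le {E : Type*} [SeminormedAddCommGroup E] (x y : E) :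
    ‖x + y‖ ^ 2 ≤ 2 * ‖x‖ ^ 2 + 2 * ‖y‖ ^ 2 := by
  have h := norm_add_le x y
  have h0 := norm_nonneg (x + y)
  nlinarith [sq_nonneg (‖x‖ - ‖y‖), mul_self_le_mul_self h0 h]

lemma norm_sq_sub_le {E : Type*} [SeminormedAddCommGroup E] (x y : E) :
    ‖x - y‖ ^ 2 ≤ 2 * ‖x‖ ^ 2 + 2 * ‖y‖ ^ 2 := by
  have := norm_sq_add_le x (-y)
  rwa [← sub_eq_add_neg, norm_neg] at this

/-- For divergence free `V`, the decomposition `V - ∇u` is orthogonal. -/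
lemma sum_norm_sub_grad_sq {V : Fin 4 → L2 ℝ} (hV : gradAdj V = 0) (u : HDot1 ℝ) :
    ∑ j, ‖V j - u.D j‖ ^ 2 = ∑ j, ‖V j‖ ^ 2 + ‖u‖ ^ 2 := by
  have h := inner_gradAdj u V
  rw [hV, inner_zero_right] at h
  simp only [norm_sub_sq_real, Finset.sum_add_distrib, Finset.sum_sub_distrib, ← Finset.mul_sum,
    HDot1.norm_sq_eq, real_inner_comm (u.D _) (V _), ← h]
  ring

/-- The energy identity for `A₀`. -/
lemma SolvesA0.norm_sq {U : LinData} {A0 : HDot1 ℝ} (h : SolvesA0 U A0) :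
    ‖A0‖ ^ 2 + ‖mulOp U.φ A0‖ ^ 2 = - inner ℝ (mulOp U.φ A0) U.φt := by
  have h1 := (solvesA0_iff U A0).1 h
  have h2 : inner ℝ A0 A0 = - inner ℝ (mulOp U.φ A0) (U.φt + mulOp U.φ A0) := by
    rw [← adjointL_inner_right, ← inner_neg_right, ← h1]
  rw [inner_add_right, real_inner_self_eq_norm_sq, real_inner_self_eq_norm_sq] at h2
  linarith

/-- In the energy identity -⟨M A₀, ∂ₜφ⟩ is at most (‖M A₀‖² + ‖∂ₜφ‖²)/2, and half of ‖M A₀‖² is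
absorbed. -/
lemma SolvesA0.norm_sq_le {U : LinData} {A0 : HDot1 ℝ} (h : SolvesA0 U A0) :
    2 * ‖A0‖ ^ 2 + ‖mulOp U.φ A0‖ ^ 2 ≤ ‖U.φt‖ ^ 2 := by
  have h1 := h.norm_sq
  have h2 := neg_le_of_abs_le (abs_real_inner_le_norm (mulOp U.φ A0) U.φt)
  nlinarith [sq_nonneg (‖mulOp U.φ A0‖ - ‖U.φt‖)]

lemma exists_norm_mulOp_le : ∃ S : ℝ, 0 < S ∧ ∀ (φ : HDot1 ℂ) (h : HDot1 ℝ),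
    ‖mulOp φ h‖ ≤ S * ‖h‖ * ‖φ.fn‖ := by
  obtain ⟨S, hS0, hS⟩ := HDot1.sobolev ℝ
  refine ⟨S, hS0, fun φ h => ?_⟩
  rw [mulOp_apply]
  exact (norm_iMul_le _ _).trans (mul_le_mul_of_nonneg_right (hS h) (norm_nonneg _))

lemma exists_norm_mulOp_sq_le : ∃ S : ℝ, 0 < S ∧ ∀ (φ : HDot1 ℂ) (h : HDot1 ℝ),
    ‖mulOp φ h‖ ^ 2 ≤ S * ‖h‖ ^ 2 * ‖φ.fn‖ ^ 2 := by
  obtain ⟨S, hS0, hS⟩ := exists_norm_mulOp_le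
  refine ⟨S ^ 2, by positivity, fun φ h => ?_⟩
  rw [← mul_pow, ← mul_pow]
  exact pow_le_pow_left₀ (norm_nonneg _) (hS φ h) 2

lemma isCoulomb_iff (U : LinData) :
    U.IsCoulomb ↔ HasWeakDiv (fun l => (U.A l).fn) 0 ∧ gradAdj U.At = 0 := by
  rw [LinData.IsCoulomb, hasWeakDiv_zero_iff]

/-- The linear data of a Coulomb data set are unique. -/
lemma existsUnique_linData {d : CovData} (hd : d.IsCoulombDataSet) :
    ∃! p : LinData × HDot1 ℝ, p.1.IsCoulomb ∧ SolvesA0 p.1 p.2 ∧ toCovData p.1 p.2 = d := by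
  obtain ⟨a, e, f, g⟩ := d
  -- As D_tφ = g is prescribed, the equation for A₀ is already solved; no operator has to be
  -- inverted.
  set A0 : HDot1 ℝ := - adjointL _ _ (mulOp f) g with hA0
  have hgauss : gradAdj e = adjointL _ _ (mulOp f) g := (hasWeakDiv_gauss_iff _ _ _).1 hd.2
  have hcov : covDt (a, fun j => e j + A0.D j, f, g - mulOp f A0) A0 = g := by
    rw [covDt_eq]; exact sub_add_cancel _ _
  refine ⟨((a, fun j => e j + A0.D j, f, g - mulOp f A0), A0), ⟨?_, ?_, ?_⟩, ?_⟩
  · refine (isCoulomb_iff _).2 ⟨hd.1, ?_⟩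
    change gradAdj (fun j => e j + A0.D j) = 0
    rw [gradAdj_add, gradAdj_grad, hgauss, hA0, add_neg_cancel]
  · rw [SolvesA0, hcov]
    exact (hasWeakLaplacian_current_iff _ _ _).2 hA0
  · rw [toCovData, hcov]
    exact congrArg (fun e' => (a, e', f, g)) (funext fun j => add_sub_cancel_right _ _)
  · rintro ⟨⟨a', At', f', φt'⟩, A0'⟩ ⟨-, hs, hc⟩
    have e1 : a' = a := congrArg (fun d : CovData => d.1) hc
    have e2 : (fun j => At' j - A0'.D j) = e := congrArg (fun d : CovData => d.2.1) hc
    have e3 : f' = f := congrArg (fun d : CovData => d.2.2.1) hc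
    have e4 : φt' + mulOp f' A0' = g := congrArg (fun d : CovData => d.2.2.2) hc
    subst e1 e3
    have e5 : A0' = A0 := by
      have := (solvesA0_iff _ _).1 hs
      rw [hA0, ← e4]
      exact this
    rw [e5] at e2 e4 ⊢
    rw [← e2, ← e4]
    simp

/-- The linear energy is controlled by the energy of the covariant data. -/
lemma exists_linEnergy_le : ∃ C : ℝ, 0 < C ∧ ∀ (U : LinData) (A0 : HDot1 ℝ), U.IsCoulomb →
    linEnergy U ≤ C * (energy (toCovData U A0) + energy (toCovData U A0) ^ 2) := by
  obtain ⟨S, hS0, hS⟩ := exists_norm_mulOp_sq_le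
  obtain ⟨K, hK0, hK⟩ := exists_norm_fn_sq_le_covD
  -- The estimates give 2E + 8SK²E²; the larger first coefficient is slack.
  refine ⟨6 + 8 * S * K ^ 2, by positivity, fun U A0 hU => ?_⟩
  have hE : energy (toCovData U A0) = (1 / 2) * (∑ j, ‖U.At j‖ ^ 2 + ‖A0‖ ^ 2)
      + (1 / 2) * ∑ j, ‖U.A j‖ ^ 2
      + (1 / 2) * (‖covDt U A0‖ ^ 2 + ∑ j, ‖covD U.A U.φ j‖ ^ 2) := by
    rw [← sum_norm_sub_grad_sq ((isCoulomb_iff U).1 hU).2]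
    have h := sum_norm_curl_sq hU.1
    have h' : energy (toCovData U A0) = (1 / 2) * ∑ j, ‖U.At j - A0.D j‖ ^ 2
      + (1 / 4) * ∑ j, ∑ k, ‖(U.A k).D j - (U.A j).D k‖ ^ 2
      + (1 / 2) * (‖covDt U A0‖ ^ 2 + ∑ j, ‖covD U.A U.φ j‖ ^ 2) := rfl
    rw [h', h]; ring
  set E := energy (toCovData U A0)
  set p := ‖U.φ.fn‖
  set Q := ∑ j, ‖covD U.A U.φ j‖ ^ 2 with hQ
  have hQ0 : 0 ≤ Q := Finset.sum_nonneg fun _ _ => sq_nonneg _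
  have hp : p ^ 2 ≤ K ^ 2 * Q := by
    have := pow_le_pow_left₀ (norm_nonneg _) (hK U.A U.φ) 2
    rwa [mul_pow, Real.sq_sqrt hQ0] at this
  have hAt0 : 0 ≤ ∑ j, ‖U.At j‖ ^ 2 := Finset.sum_nonneg fun _ _ => sq_nonneg _
  have hA00 : 0 ≤ ∑ j, ‖U.A j‖ ^ 2 := Finset.sum_nonneg fun _ _ => sq_nonneg _
  have hsq := sq_nonneg ‖A0‖
  have hsq' := sq_nonneg ‖covDt U A0‖
  have hE0 : 0 ≤ E := by rw [hE]; linarith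
  have hp2 : p ^ 2 ≤ 2 * K ^ 2 * E := by
    have : Q ≤ 2 * E := by linarith
    nlinarith [sq_nonneg K]
  have hprod : ∀ t : ℝ, 0 ≤ t → t ≤ 2 * E → S * t * p ^ 2 ≤ 4 * S * K ^ 2 * E ^ 2 := by
    intro t ht0 ht
    calc S * t * p ^ 2 ≤ S * (2 * E) * (2 * K ^ 2 * E) := by gcongr
      _ = _ := by ring
  have hφt : ‖U.φt‖ ^ 2 ≤ 2 * ‖covDt U A0‖ ^ 2 + 2 * (4 * S * K ^ 2 * E ^ 2) := by
    have h1 := norm_sq_sub_le (covDt U A0) (mulOp U.φ A0)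
    have h2 : covDt U A0 - mulOp U.φ A0 = U.φt := by rw [covDt_eq, add_sub_cancel_right]
    rw [h2] at h1
    have h3 := (hS U.φ A0).trans (hprod _ (sq_nonneg _) (by linarith))
    linarith
  have hφ : ‖U.φ‖ ^ 2 ≤ 2 * Q + 2 * (4 * S * K ^ 2 * E ^ 2) := by
    have h1 : ∀ j, ‖U.φ.D j‖ ^ 2
        ≤ 2 * ‖covD U.A U.φ j‖ ^ 2 + 2 * (S * ‖U.A j‖ ^ 2 * p ^ 2) := by
      intro j
      have h1 := norm_sq_sub_le (covD U.A U.φ j) (mulOp U.φ (U.A j))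
      have h2 : covD U.A U.φ j - mulOp U.φ (U.A j) = U.φ.D j := by
        rw [covD_eq, add_sub_cancel_right]; rfl
      rw [h2] at h1
      linarith [hS U.φ (U.A j)]
    rw [HDot1.norm_sq_eq]
    refine (Finset.sum_le_sum fun j _ => h1 j).trans ?_
    rw [Finset.sum_add_distrib, ← Finset.mul_sum, ← Finset.mul_sum, ← Finset.sum_mul,
      ← Finset.mul_sum]
    have := hprod _ hA00 (by linarith)
    linarith
  rw [linEnergy_eq]
  have hX : 0 ≤ S * K ^ 2 * E ^ 2 := by positivity
  have hX' : 0 ≤ S * K ^ 2 * E := by positivity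
  nlinarith [sq_nonneg E]

/-- The energy of the covariant data is controlled by the linear energy. -/
lemma exists_energy_le : ∃ C : ℝ, 0 < C ∧ ∀ (U : LinData) (A0 : HDot1 ℝ), SolvesA0 U A0 →
    energy (toCovData U A0) ≤ C * (linEnergy U + linEnergy U ^ 2) := by
  obtain ⟨S, hS0, hS⟩ := exists_norm_mulOp_sq_le
  obtain ⟨K, hK0, hK⟩ := HDot1.sobolev ℂ
  -- The estimates give 4L + 4SK²L², so this constant is generous.
  refine ⟨8 + 8 * S * K ^ 2, by positivity, fun U A0 hA => ?_⟩
  have hL := linEnergy_eq U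
  set L := linEnergy U
  have hAt0 : 0 ≤ ∑ j, ‖U.At j‖ ^ 2 := Finset.sum_nonneg fun _ _ => sq_nonneg _
  have hA00 : 0 ≤ ∑ j, ‖U.A j‖ ^ 2 := Finset.sum_nonneg fun _ _ => sq_nonneg _
  have hsq1 := sq_nonneg ‖U.φt‖
  have hsq2 := sq_nonneg ‖U.φ‖
  have hL0 : 0 ≤ L := by rw [hL]; linarith
  have hA0 := hA.norm_sq_le
  have he : ∑ j, ‖U.At j - A0.D j‖ ^ 2 ≤ 2 * ∑ j, ‖U.At j‖ ^ 2 + 2 * ‖A0‖ ^ 2 := by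
    rw [HDot1.norm_sq_eq, Finset.mul_sum, Finset.mul_sum, ← Finset.sum_add_distrib]
    exact Finset.sum_le_sum fun j _ => norm_sq_sub_le _ _
  have hc : ∑ j, ∑ k, ‖(U.A k).D j - (U.A j).D k‖ ^ 2 ≤ 4 * ∑ j, ‖U.A j‖ ^ 2 := by
    have h1 : ∑ j, ∑ k, ‖(U.A k).D j - (U.A j).D k‖ ^ 2
        ≤ ∑ j, ∑ k, (2 * ‖(U.A k).D j‖ ^ 2 + 2 * ‖(U.A j).D k‖ ^ 2) :=
      Finset.sum_le_sum fun j _ => Finset.sum_le_sum fun k _ => norm_sq_sub_le _ _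
    refine h1.trans (le_of_eq ?_)
    simp only [HDot1.norm_sq_eq, Finset.sum_add_distrib, ← Finset.mul_sum]
    rw [Finset.sum_comm (f := fun j k => ‖(U.A k).D j‖ ^ 2)]
    ring
  have hg : ‖covDt U A0‖ ^ 2 ≤ 2 * ‖U.φt‖ ^ 2 + 2 * ‖mulOp U.φ A0‖ ^ 2 := by
    rw [covDt_eq]; exact norm_sq_add_le _ _
  have hp : ‖U.φ.fn‖ ^ 2 ≤ K ^ 2 * ‖U.φ‖ ^ 2 := by
    rw [← mul_pow]; exact pow_le_pow_left₀ (norm_nonneg _) (hK U.φ) 2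
  have hD : ∑ j, ‖covD U.A U.φ j‖ ^ 2 ≤ 2 * ‖U.φ‖ ^ 2 + 8 * S * K ^ 2 * L ^ 2 := by
    have h1 : ∀ j, ‖covD U.A U.φ j‖ ^ 2
        ≤ 2 * ‖U.φ.D j‖ ^ 2 + 2 * (S * ‖U.A j‖ ^ 2 * ‖U.φ.fn‖ ^ 2) := by
      intro j
      have h1 := norm_sq_add_le (U.φ.D j) (mulOp U.φ (U.A j))
      have h2 := hS U.φ (U.A j)
      rw [covD_eq, derivL_apply]
      linarith
    refine (Finset.sum_le_sum fun j _ => h1 j).trans ?_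
    rw [Finset.sum_add_distrib, ← Finset.mul_sum, ← HDot1.norm_sq_eq, ← Finset.mul_sum,
      ← Finset.sum_mul, ← Finset.mul_sum]
    have h3 : S * (∑ j, ‖U.A j‖ ^ 2) * ‖U.φ.fn‖ ^ 2 ≤ S * (2 * L) * (K ^ 2 * (2 * L)) := by
      have h4 : ∑ j, ‖U.A j‖ ^ 2 ≤ 2 * L := by linarith
      have h5 : ‖U.φ‖ ^ 2 ≤ 2 * L := by linarith
      have h6 : ‖U.φ.fn‖ ^ 2 ≤ K ^ 2 * (2 * L) := hp.trans (by gcongr)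
      gcongr
    linarith
  have hE : energy (toCovData U A0) = (1 / 2) * ∑ j, ‖U.At j - A0.D j‖ ^ 2
      + (1 / 4) * ∑ j, ∑ k, ‖(U.A k).D j - (U.A j).D k‖ ^ 2
      + (1 / 2) * (‖covDt U A0‖ ^ 2 + ∑ j, ‖covD U.A U.φ j‖ ^ 2) := rfl
  rw [hE]
  have hsq3 := sq_nonneg ‖A0‖
  have hsq4 := sq_nonneg ‖mulOp U.φ A0‖
  have hX : 0 ≤ S * K ^ 2 * L ^ 2 := by positivity
  have hX' : 0 ≤ S * K ^ 2 * L := by positivity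
  nlinarith [sq_nonneg L]

/-- The difference of the two energies is controlled by `‖φ‖_{L⁴}`. -/
lemma exists_energy_sub_linEnergy_le : ∃ S : ℝ, 0 < S ∧ ∀ (U : LinData) (A0 : HDot1 ℝ),
    U.IsCoulomb → SolvesA0 U A0 → |energy (toCovData U A0) - linEnergy U|
      ≤ S * linEnergy U * (‖U.φ.fn‖ + ‖U.φ.fn‖ ^ 2) := by
  obtain ⟨S, hS0, hS⟩ := exists_norm_mulOp_le
  -- The three terms of `hid` contribute SpL, SpL and S²p²L.
  refine ⟨2 * S + S ^ 2, by positivity, fun U A0 hU hA => ?_⟩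
  have hL := linEnergy_eq U
  set L := linEnergy U
  set p := ‖U.φ.fn‖
  have hp0 : 0 ≤ p := norm_nonneg _
  have hAt0 : 0 ≤ ∑ j, ‖U.At j‖ ^ 2 := Finset.sum_nonneg fun _ _ => sq_nonneg _
  have hA00 : 0 ≤ ∑ j, ‖U.A j‖ ^ 2 := Finset.sum_nonneg fun _ _ => sq_nonneg _
  have hsq1 := sq_nonneg ‖U.φt‖
  have hsq2 := sq_nonneg ‖U.φ‖
  have hL0 : 0 ≤ L := by rw [hL]; linarith
  have hE : energy (toCovData U A0) = (1 / 2) * ∑ j, ‖U.At j - A0.D j‖ ^ 2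
      + (1 / 4) * ∑ j, ∑ k, ‖(U.A k).D j - (U.A j).D k‖ ^ 2
      + (1 / 2) * (‖U.φt + mulOp U.φ A0‖ ^ 2
        + ∑ j, ‖U.φ.D j + mulOp U.φ (U.A j)‖ ^ 2) := rfl
  -- All purely quadratic terms of A, ∂ₜA and φ cancel by the Coulomb condition; the energy identity
  -- for A₀ merges (‖A₀‖² + ‖M A₀‖²)/2 + ⟨M A₀, ∂ₜφ⟩ into ½⟨M A₀, ∂ₜφ⟩.
  have hid : energy (toCovData U A0) - L = (1 / 2) * inner ℝ (mulOp U.φ A0) U.φt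
      + ∑ j, inner ℝ (U.φ.D j) (mulOp U.φ (U.A j))
      + (1 / 2) * ∑ j, ‖mulOp U.φ (U.A j)‖ ^ 2 := by
    rw [hE, sum_norm_sub_grad_sq ((isCoulomb_iff U).1 hU).2, sum_norm_curl_sq hU.1, hL]
    simp only [norm_add_sq_real, Finset.sum_add_distrib, ← Finset.mul_sum, ← HDot1.norm_sq_eq]
    have h1 := hA.norm_sq
    have h2 := real_inner_comm U.φt (mulOp U.φ A0)
    linarith
  have hA0 := hA.norm_sq_le
  have b1 : |inner ℝ (mulOp U.φ A0) U.φt| ≤ S * p * (2 * L) := by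
    refine (abs_real_inner_le_norm _ _).trans ?_
    have h1 : ‖A0‖ * ‖U.φt‖ ≤ 2 * L := by
      nlinarith [sq_nonneg (‖A0‖ - ‖U.φt‖), sq_nonneg ‖mulOp U.φ A0‖]
    calc ‖mulOp U.φ A0‖ * ‖U.φt‖ ≤ S * ‖A0‖ * p * ‖U.φt‖ := by gcongr; exact hS _ _
      _ = S * p * (‖A0‖ * ‖U.φt‖) := by ring
      _ ≤ _ := by gcongr
  have b2 : |∑ j, inner ℝ (U.φ.D j) (mulOp U.φ (U.A j))| ≤ S * p * L := by
    have h1 : ∀ j, |inner ℝ (U.φ.D j) (mulOp U.φ (U.A j))|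
        ≤ S * p * ((1 / 2) * (‖U.φ.D j‖ ^ 2 + ‖U.A j‖ ^ 2)) := by
      intro j
      refine (abs_real_inner_le_norm _ _).trans ?_
      calc ‖U.φ.D j‖ * ‖mulOp U.φ (U.A j)‖ ≤ ‖U.φ.D j‖ * (S * ‖U.A j‖ * p) := by
            gcongr; exact hS _ _
        _ = S * p * (‖U.φ.D j‖ * ‖U.A j‖) := by ring
        _ ≤ _ := mul_le_mul_of_nonneg_left
            (by nlinarith [sq_nonneg (‖U.φ.D j‖ - ‖U.A j‖)]) (by positivity)
    refine (Finset.abs_sum_le_sum_abs _ _).trans ((Finset.sum_le_sum fun j _ => h1 j).trans ?_)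
    rw [← Finset.mul_sum, ← Finset.mul_sum, Finset.sum_add_distrib, ← HDot1.norm_sq_eq]
    gcongr
    linarith
  have b3 : ∑ j, ‖mulOp U.φ (U.A j)‖ ^ 2 ≤ S ^ 2 * p ^ 2 * (2 * L) := by
    have h1 : ∀ j, ‖mulOp U.φ (U.A j)‖ ^ 2 ≤ S ^ 2 * p ^ 2 * ‖U.A j‖ ^ 2 := by
      intro j
      calc _ ≤ (S * ‖U.A j‖ * p) ^ 2 := by gcongr; exact hS _ _
        _ = _ := by ring
    refine (Finset.sum_le_sum fun j _ => h1 j).trans ?_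
    rw [← Finset.mul_sum]
    gcongr
    linarith
  have b3' : 0 ≤ ∑ j, ‖mulOp U.φ (U.A j)‖ ^ 2 := Finset.sum_nonneg fun _ _ => sq_nonneg _
  rw [hid, abs_le]
  have b1' := abs_le.1 b1
  have b2' := abs_le.1 b2
  have x1 : 0 ≤ S * L * p ^ 2 := by positivity
  have x2 : 0 ≤ S ^ 2 * L * p := by positivity
  have x3 : 0 ≤ S * L * p := by positivity
  have x4 : 0 ≤ S ^ 2 * L * p ^ 2 := by positivity
  constructor <;> nlinarith

end Energy

/-! ### Littlewood–Paley and low frequency projections -/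

section Symbols

variable {m : ℝ → ℝ}

/-- The norm is not smooth at 0, but there the cutoff is locally constant. -/
lemma IsCutoff.contDiff_norm (hm : IsCutoff m) {c : ℝ} (hc : 0 < c) :
    ContDiff ℝ ∞ fun ζ : R4 => m (c * ‖ζ‖) := by
  rw [contDiff_iff_contDiffAt]
  intro ζ
  by_cases hζ : ζ = 0
  · have h1 : (fun ζ : R4 => m (c * ‖ζ‖)) =ᶠ[𝓝 ζ] fun _ => 1 := by
      have h2 : Metric.ball (0 : R4) c⁻¹ ∈ 𝓝 ζ := by
        rw [hζ]; exact Metric.ball_mem_nhds _ (inv_pos.2 hc)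
      filter_upwards [h2] with ξ hξ
      refine hm.2.1 _ ?_
      rw [mem_ball_zero_iff] at hξ
      have := mul_le_mul_of_nonneg_left hξ.le hc.le
      rwa [mul_inv_cancel₀ hc.ne'] at this
    exact contDiffAt_const.congr_of_eventuallyEq h1
  · exact hm.1.contDiffAt.comp ζ (contDiffAt_const.mul (contDiffAt_norm ℝ hζ))

lemma IsCutoff.hasCompactSupport_norm (hm : IsCutoff m) {c : ℝ} (hc : 0 < c) :
    HasCompactSupport fun ζ : R4 => m (c * ‖ζ‖) := by
  refine HasCompactSupport.intro (isCompact_closedBall (0 : R4) (2 / c)) fun ζ hζ => hm.2.2 _ ?_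
  rw [mem_closedBall_zero_iff, not_le, div_lt_iff₀ hc] at hζ
  linarith

lemma IsCutoff.exists_bound (hm : IsCutoff m) : ∃ M : ℝ, 1 ≤ M ∧ ∀ r, |m r| ≤ M := by
  obtain ⟨M, hM⟩ := (isCompact_Icc (a := (1 : ℝ)) (b := 2)).exists_bound_of_continuousOn
    hm.1.continuous.continuousOn
  refine ⟨max M 1, le_max_right _ _, fun r => ?_⟩
  by_cases h1 : r ≤ 1
  · rw [hm.2.1 r h1, abs_one]; exact le_max_right _ _
  by_cases h2 : 2 ≤ r
  · rw [hm.2.2 r h2, abs_zero]; exact le_trans zero_le_one (le_max_right _ _)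
  · exact (hM r ⟨(not_le.1 h1).le, (not_le.1 h2).le⟩).trans (le_max_left _ _)

/-- The symbol `m(2π|ζ|/2^k)` of the low frequency projection. -/
def lowSymbol (m : ℝ → ℝ) (k : ℤ) (ζ : R4) : ℝ := m (2 * Real.pi * ‖ζ‖ / 2 ^ k)

lemma lowSymbol_eq (m : ℝ → ℝ) (k : ℤ) :
    lowSymbol m k = fun ζ : R4 => m ((2 * Real.pi / 2 ^ k) * ‖ζ‖) := by
  ext ζ; rw [lowSymbol]; congr 1; ring

lemma two_pi_div_pos (k : ℤ) : (0 : ℝ) < 2 * Real.pi / 2 ^ k := by positivity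

/-- The symbol of the low frequency projection as a Schwartz function. -/
def lowS (hm : IsCutoff m) (k : ℤ) : 𝓢(R4, ℂ) :=
  HasCompactSupport.toSchwartzMap (f := fun ζ => ((lowSymbol m k ζ : ℝ) : ℂ))
    (by
      rw [lowSymbol_eq]
      exact (hm.hasCompactSupport_norm (two_pi_div_pos k)).comp_left (g := ((↑) : ℝ → ℂ))
        Complex.ofReal_zero)
    (by
      rw [lowSymbol_eq]
      exact Complex.ofRealCLM.contDiff.comp (hm.contDiff_norm (two_pi_div_pos k)))

lemma lowS_apply (hm : IsCutoff m) (k : ℤ) (ζ : R4) : lowS hm k ζ = (lowSymbol m k ζ : ℂ) := rfl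

/-- The low frequency projection of a Schwartz function. -/
def lowProj (hm : IsCutoff m) (k : ℤ) (f : 𝓢(R4, ℂ)) : 𝓢(R4, ℂ) :=
  𝓕⁻ (SchwartzMap.pairing (ContinuousLinearMap.mul ℂ ℂ) (𝓕 f) (lowS hm k))

lemma fourier_lowProj (hm : IsCutoff m) (k : ℤ) (f : 𝓢(R4, ℂ)) (ζ : R4) :
    𝓕 (lowProj hm k f) ζ = 𝓕 f ζ * lowSymbol m k ζ := by
  rw [lowProj, FourierTransform.fourier_fourierInv_eq]
  rfl

lemma lpKernel_eq (hm : IsCutoff m) (k : ℤ) :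
    lpKernel m k = 𝓕⁻ (lowS hm k - lowS hm (k - 1)) := by
  rw [SchwartzMap.fourierInv_coe, lpKernel]
  congr 1
  ext ζ
  rw [sub_apply, lowS_apply, lowS_apply, lowSymbol, lowSymbol]
  push_cast; rfl

/-- The convolution theorem, together with the symbol of P_k being that of S_k minus that of
S_{k-1}. -/
lemma lpProj_schwartz (hm : IsCutoff m) (k : ℤ) (f : 𝓢(R4, ℂ)) (x : R4) :
    lpProj m k f x = lowProj hm k f x - lowProj hm (k - 1) f x := by
  have h1 := SchwartzMap.convolution_apply (ContinuousLinearMap.mul ℂ ℂ) f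
    (𝓕⁻ (lowS hm k - lowS hm (k - 1))) x
  have h2 : lpProj m k f x = SchwartzMap.convolution (ContinuousLinearMap.mul ℂ ℂ) f
      (𝓕⁻ (lowS hm k - lowS hm (k - 1))) x := by
    rw [h1, convolution_def, lpProj, lpKernel_eq hm]
    refine integral_congr_ae (Eventually.of_forall fun y => ?_)
    simp [mul_comm]
  have h3 : SchwartzMap.convolution (ContinuousLinearMap.mul ℂ ℂ) f
      (𝓕⁻ (lowS hm k - lowS hm (k - 1))) = lowProj hm k f - lowProj hm (k - 1) f := by
    change 𝓕⁻ (SchwartzMap.pairing (ContinuousLinearMap.mul ℂ ℂ) (𝓕 f)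
      (𝓕 (𝓕⁻ (lowS hm k - lowS hm (k - 1))))) = _
    rw [FourierTransform.fourier_fourierInv_eq, map_sub, lowProj, lowProj]
    exact map_sub (FourierTransform.fourierInvCLM ℂ 𝓢(R4, ℂ)) _ _
  rw [h2, h3, sub_apply]

/-- S_k f(x) is bounded by the L¹ norm of its Fourier transform. For each ζ ≠ 0 the symbol vanishes
once 2^k is small, so dominated convergence applies. This removes the remainder in the telescoping
sum below. -/
lemma tendsto_lowProj_atBot (hm : IsCutoff m) (k : ℤ) (f : 𝓢(R4, ℂ)) (x : R4) :
    Tendsto (fun n : ℕ => lowProj hm (k - n) f x) atTop (𝓝 0) := by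
  obtain ⟨M, hM1, hM⟩ := hm.exists_bound
  have hF : Integrable (fun ζ => 𝓕 f ζ) (volume : Measure R4) := (𝓕 f).integrable
  have hlim : Tendsto (fun n : ℕ => ∫ ζ, ‖𝓕 f ζ * lowSymbol m (k - n) ζ‖) atTop
      (𝓝 (∫ _ : R4, (0 : ℝ))) := by
    refine tendsto_integral_of_dominated_convergence (fun ζ => ‖𝓕 f ζ‖ * M)
      (fun n => ?_) (hF.norm.mul_const M) (fun n => Eventually.of_forall fun ζ => ?_) ?_
    · exact ((SchwartzMap.pairing (ContinuousLinearMap.mul ℂ ℂ) (𝓕 f)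
        (lowS hm (k - n))).continuous.norm).aestronglyMeasurable
    · rw [norm_norm, norm_mul]
      gcongr
      rw [Complex.norm_real]
      exact hM _
    · have hne : ∀ᵐ ζ ∂(volume : Measure R4), ζ ≠ 0 := by
        rw [ae_iff]
        simp
      filter_upwards [hne] with ζ hζ
      have hpos : 0 < 2 * Real.pi * ‖ζ‖ := by positivity
      have htend : Tendsto (fun n : ℕ => (2 : ℝ) ^ n * (2 * Real.pi * ‖ζ‖ / 2 ^ k)) atTop atTop :=
        (tendsto_pow_atTop_atTop_of_one_lt one_lt_two).atTop_mul_const (by positivity)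
      refine tendsto_const_nhds.congr' ?_
      filter_upwards [htend.eventually_ge_atTop 2] with n hn
      have : lowSymbol m (k - n) ζ = 0 := by
        refine hm.2.2 _ (hn.trans (le_of_eq ?_))
        rw [zpow_sub₀ two_ne_zero, zpow_natCast]
        field_simp
      rw [this]; simp
  rw [integral_zero] at hlim
  refine squeeze_zero_norm (fun n => ?_) hlim
  rw [lowProj, SchwartzMap.fourierInv_coe, Real.fourierInv_eq]
  refine (norm_integral_le_integral_norm _).trans (le_of_eq ?_)
  refine integral_congr_ae (Eventually.of_forall fun ζ => ?_)
  simp only [Circle.norm_smul]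
  rfl

/-- S_k is the sum of P_j over j ≤ k, and the bounds 2^j ε add up to 2·2^k ε. -/
lemma norm_lowProj_le (hm : IsCutoff m) (f : 𝓢(R4, ℂ)) {ε : ℝ} (x : R4)
    (h : ∀ k : ℤ, ‖lpProj m k f x‖ ≤ 2 ^ k * ε) (k : ℤ) :
    ‖lowProj hm k f x‖ ≤ 2 * 2 ^ k * ε := by
  have hε : 0 ≤ ε := by simpa using (norm_nonneg _).trans (h 0)
  have hind : ∀ n : ℕ, ‖lowProj hm k f x‖
      ≤ ‖lowProj hm (k - n) f x‖ + (2 * 2 ^ k - 2 * 2 ^ (k - n)) * ε := by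
    intro n
    induction n with
    | zero => simp
    | succ n ih =>
      refine ih.trans ?_
      have h1 := lpProj_schwartz hm (k - n) f x
      have h2 : lowProj hm (k - n) f x
          = lpProj m (k - n) f x + lowProj hm (k - n - 1) f x := by rw [h1]; ring
      have h3 : ‖lowProj hm (k - n) f x‖
          ≤ 2 ^ (k - n : ℤ) * ε + ‖lowProj hm (k - n - 1) f x‖ := by
        rw [h2]
        exact (norm_add_le _ _).trans (add_le_add_left (h _) _)
      have h4 : (2 : ℝ) ^ (k - n : ℤ) = 2 * 2 ^ (k - n - 1 : ℤ) := by
        rw [zpow_sub_one₀ two_ne_zero]; ring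
      have h5 : (k - ((n + 1 : ℕ) : ℤ)) = k - n - 1 := by push_cast; ring
      rw [h5]
      rw [h4] at h3 ⊢
      linarith
  have hlim : Tendsto (fun n : ℕ => ‖lowProj hm (k - n) f x‖ + 2 * 2 ^ k * ε) atTop
      (𝓝 (‖(0 : ℂ)‖ + 2 * 2 ^ k * ε)) :=
    (tendsto_lowProj_atBot hm k f x).norm.add_const _
  rw [norm_zero, zero_add] at hlim
  refine ge_of_tendsto' hlim fun n => (hind n).trans ?_
  have : 0 ≤ (2 : ℝ) * 2 ^ (k - n : ℤ) * ε := by positivity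
  linarith

end Symbols

/-! ### The square function estimate and refined Sobolev inequality for Schwartz functions -/

section SquareFunction

variable {m : ℝ → ℝ}

lemma tsum_zpow_indicator_le {r : ℝ} (hr : 0 ≤ r) (N : ℝ≥0∞) (a : ℤ → ℝ≥0∞)
    (h1 : ∀ k, a k ≤ N * ENNReal.ofReal ((2 ^ k) ^ 2)) (h2 : ∀ k : ℤ, r ≤ 2 ^ k → a k = 0) :
    ∑' k, a k ≤ N * 2 * ENNReal.ofReal (r ^ 2) := by
  rcases hr.eq_or_lt with rfl | hr
  · have : ∀ k, a k = 0 := fun k => h2 k (by positivity)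
    simp [this]
  -- With 2^n ≤ r < 2^(n+1), the terms with k > n vanish and the others are indexed by k = n - i.
  obtain ⟨n, hn1, hn2⟩ := exists_mem_Ico_zpow hr one_lt_two
  have hsupp : Function.support a ⊆ Set.range fun i : ℕ => n - (i : ℤ) := by
    intro k hk
    have hkn : k ≤ n := by
      by_contra hlt
      exact hk (h2 k (hn2.le.trans (zpow_le_zpow_right₀ one_le_two (by omega))))
    exact ⟨(n - k).toNat, by simp only; omega⟩
  have hinj : Function.Injective fun i : ℕ => n - (i : ℤ) := fun i j hij => by
    simp only at hij; omega
  rw [← hinj.tsum_eq hsupp]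
  have h3 : ∀ i : ℕ, a (n - i) ≤ N * ENNReal.ofReal (r ^ 2) * (2⁻¹ : ℝ≥0∞) ^ i := by
    intro i
    refine (h1 _).trans ?_
    rw [mul_assoc]
    gcongr
    have h4 : (2⁻¹ : ℝ≥0∞) ^ i = ENNReal.ofReal (2⁻¹ ^ i) := by
      rw [ENNReal.ofReal_pow (by norm_num), ENNReal.ofReal_inv_of_pos (by norm_num)]; simp
    rw [h4, ← ENNReal.ofReal_mul (by positivity)]
    refine ENNReal.ofReal_le_ofReal ?_
    rw [zpow_sub₀ two_ne_zero, zpow_natCast, div_pow, div_eq_mul_inv, ← inv_pow, ← inv_pow]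
    -- The ratio 1/4 is relaxed to 1/2, whose geometric series sums to the factor 2.
    have h5 : ((2 : ℝ)⁻¹ ^ i) ^ 2 ≤ 2⁻¹ ^ i := by
      rw [sq]
      exact mul_le_of_le_one_left (by positivity) (pow_le_one₀ (by norm_num) (by norm_num))
    have h6 : ((2 : ℝ) ^ n) ^ 2 ≤ r ^ 2 := by gcongr
    exact mul_le_mul h6 h5 (by positivity) (by positivity)
  refine (ENNReal.tsum_le_tsum h3).trans (le_of_eq ?_)
  rw [ENNReal.tsum_mul_left, ENNReal.tsum_geometric, ENNReal.one_sub_inv_two, inv_inv]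
  ring

/-- With |ξ| = 2π|ζ|, the factor 1 - m(|ξ|/2^k) vanishes for 2^k ≥ |ξ| and is at most 1 + M
otherwise, so a geometric sum over 2^k < |ξ| remains. -/
lemma IsCutoff.exists_tsum_le (hm : IsCutoff m) : ∃ K : ℝ≥0, ∀ ζ : R4,
    ∑' k : ℤ, ENNReal.ofReal ((2 ^ k) ^ 2 * (1 - lowSymbol m k ζ) ^ 2)
      ≤ K * ENNReal.ofReal ((2 * Real.pi * ‖ζ‖) ^ 2) := by
  obtain ⟨M, hM1, hM⟩ := hm.exists_bound
  refine ⟨((1 + M) ^ 2).toNNReal * 2, fun ζ => ?_⟩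
  have := tsum_zpow_indicator_le (r := 2 * Real.pi * ‖ζ‖) (by positivity)
    (((1 + M) ^ 2).toNNReal : ℝ≥0∞)
    (fun k : ℤ => ENNReal.ofReal ((2 ^ k) ^ 2 * (1 - lowSymbol m k ζ) ^ 2)) (fun k => ?_)
    fun k hk => ?_
  · exact_mod_cast this
  · change _ ≤ ENNReal.ofReal ((1 + M) ^ 2) * _
    rw [← ENNReal.ofReal_mul (by positivity), mul_comm]
    refine ENNReal.ofReal_le_ofReal (mul_le_mul_of_nonneg_right ?_ (by positivity))
    have h1 : |1 - lowSymbol m k ζ| ≤ 1 + M := by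
      refine (abs_sub _ _).trans ?_
      rw [abs_one]
      exact add_le_add_right (hM _) _
    rw [← sq_abs]
    gcongr
  · have : lowSymbol m k ζ = 1 := hm.2.1 _ ((div_le_one (by positivity)).2 hk)
    simp [this]

lemma lintegral_enorm_sq_fourier (f : 𝓢(R4, ℂ)) :
    ∫⁻ ζ, ‖𝓕 f ζ‖ₑ ^ 2 = ∫⁻ x, ‖f x‖ₑ ^ 2 := by
  have h : ∀ g : 𝓢(R4, ℂ), ∫⁻ x, ‖g x‖ₑ ^ 2 = ENNReal.ofReal (∫ x, ‖g x‖ ^ 2) := by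
    intro g
    rw [ofReal_integral_eq_lintegral_ofReal]
    · refine lintegral_congr fun x => ?_
      rw [ENNReal.ofReal_pow (norm_nonneg _), ofReal_norm]
    · exact (memLp_two_iff_integrable_sq_norm (g.memLp 2).1).1 (g.memLp 2)
    · exact Eventually.of_forall fun x => sq_nonneg _
  rw [h, h, SchwartzMap.integral_norm_sq_fourier]

/-- Plancherel: ∂_j becomes multiplication by 2πiζ_j. -/
lemma lintegral_gradient_sq (f : 𝓢(R4, ℂ)) :
    ∑ j, ∫⁻ x, ‖partialD j f x‖ₑ ^ 2
      = ∫⁻ ζ, ENNReal.ofReal ((2 * Real.pi * ‖ζ‖) ^ 2) * ‖𝓕 f ζ‖ₑ ^ 2 := by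
  have h1 : ∀ j : Fin 4, ∫⁻ x, ‖partialD j f x‖ₑ ^ 2
      = ∫⁻ ζ, ENNReal.ofReal ((2 * Real.pi * ζ j) ^ 2) * ‖𝓕 f ζ‖ₑ ^ 2 := by
    intro j
    have h2 : ∀ x, partialD j f x = (LineDeriv.lineDerivOp (e4 j) f : 𝓢(R4, ℂ)) x := fun x =>
      (SchwartzMap.lineDerivOp_apply_eq_fderiv _ _ _).symm
    simp only [h2]
    rw [← lintegral_enorm_sq_fourier]
    refine lintegral_congr fun ζ => ?_
    rw [SchwartzMap.fourier_lineDerivOp_eq]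
    have htg : (inner ℝ · (e4 j) : R4 → ℝ).HasTemperateGrowth := by fun_prop
    rw [smul_apply, SchwartzMap.smulLeftCLM_apply_apply htg, enorm_smul, enorm_smul, mul_pow,
      mul_pow, ← mul_assoc]
    congr 1
    have e1 : inner ℝ ζ (e4 j) = ζ j := by
      rw [EuclideanSpace.inner_single_right]; simp
    have e2 : ‖(2 * Real.pi * Complex.I : ℂ)‖ = 2 * Real.pi := by
      simp [abs_of_pos Real.pi_pos]
    rw [e1, ← ofReal_norm, ← ofReal_norm, e2, ← ENNReal.ofReal_pow (by positivity),
      ← ENNReal.ofReal_pow (by positivity), ← ENNReal.ofReal_mul (by positivity),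
      Real.norm_eq_abs, sq_abs, mul_pow (2 * Real.pi)]
  simp only [h1]
  rw [← lintegral_finsetSum]
  · refine lintegral_congr fun ζ => ?_
    rw [← Finset.sum_mul, ← ENNReal.ofReal_sum_of_nonneg fun _ _ => sq_nonneg _]
    congr 2
    simp only [mul_pow, ← Finset.mul_sum]
    rw [EuclideanSpace.norm_sq_eq]
    simp
  · intro j _
    have h3 : Continuous fun ζ : R4 => ENNReal.ofReal ((2 * Real.pi * ζ j) ^ 2) * ‖𝓕 f ζ‖ₑ ^ 2 := by
      have h4 : Continuous fun ζ : R4 => ‖𝓕 f ζ‖ₑ ^ 2 :=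
        (ENNReal.continuous_pow 2).comp (𝓕 f).continuous.enorm
      have h5 : Continuous fun ζ : R4 => ENNReal.ofReal ((2 * Real.pi * ζ j) ^ 2) :=
        ENNReal.continuous_ofReal.comp (by fun_prop)
      refine continuous_iff_continuousAt.2 fun ζ => ?_
      exact ENNReal.Tendsto.mul h5.continuousAt (Or.inr (by simp)) h4.continuousAt
        (Or.inr ENNReal.ofReal_ne_top)
    exact h3.measurable

/-- The square function estimate `∑_k 4^k ‖f - S_k f‖² ≤ K ‖∇f‖²`. -/
lemma IsCutoff.exists_squareFunction_le (hm : IsCutoff m) : ∃ K : ℝ≥0, ∀ f : 𝓢(R4, ℂ),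
    ∑' k : ℤ, ENNReal.ofReal ((2 ^ k) ^ 2) * ∫⁻ x, ‖f x - lowProj hm k f x‖ₑ ^ 2
      ≤ K * ∑ j, ∫⁻ x, ‖partialD j f x‖ₑ ^ 2 := by
  obtain ⟨K, hK⟩ := hm.exists_tsum_le
  refine ⟨K, fun f => ?_⟩
  have h1 : ∀ k : ℤ, ENNReal.ofReal ((2 ^ k) ^ 2) * ∫⁻ x, ‖f x - lowProj hm k f x‖ₑ ^ 2
      = ∫⁻ ζ, ENNReal.ofReal ((2 ^ k) ^ 2 * (1 - lowSymbol m k ζ) ^ 2) * ‖𝓕 f ζ‖ₑ ^ 2 := by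
    intro k
    have h2 : ∀ ζ, 𝓕 (f - lowProj hm k f) ζ = ((1 - lowSymbol m k ζ : ℝ) : ℂ) * 𝓕 f ζ := by
      intro ζ
      have h3 : 𝓕 (f - lowProj hm k f) = 𝓕 f - 𝓕 (lowProj hm k f) :=
        map_sub (FourierTransform.fourierCLM ℂ 𝓢(R4, ℂ)) _ _
      rw [h3, sub_apply, fourier_lowProj]
      push_cast; ring
    have h4 := lintegral_enorm_sq_fourier (f - lowProj hm k f)
    simp only [sub_apply] at h4
    rw [← h4, ← lintegral_const_mul' _ _ ENNReal.ofReal_ne_top]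
    refine lintegral_congr fun ζ => ?_
    rw [h2, enorm_mul, mul_pow, ← mul_assoc, ← ofReal_norm ((1 - lowSymbol m k ζ : ℝ) : ℂ),
      Complex.norm_real, Real.norm_eq_abs, ← ENNReal.ofReal_pow (abs_nonneg _), sq_abs,
      ← ENNReal.ofReal_mul (by positivity)]
  simp only [h1]
  rw [lintegral_gradient_sq, ← lintegral_tsum, ← lintegral_const_mul' _ _ ENNReal.coe_ne_top]
  · refine lintegral_mono fun ζ => ?_
    rw [ENNReal.tsum_mul_right, ← mul_assoc]
    gcongr
    exact hK ζ
  · intro k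
    have hc : Continuous (lowSymbol m k) := by
      rw [lowSymbol_eq]; exact (hm.contDiff_norm (two_pi_div_pos k)).continuous
    have h5 : Measurable fun ζ : R4 =>
        ENNReal.ofReal ((2 ^ k) ^ 2 * (1 - lowSymbol m k ζ) ^ 2) :=
      (ENNReal.continuous_ofReal.comp (by fun_prop)).measurable
    exact (h5.mul ((𝓕 f).continuous.enorm.measurable.pow_const 2)).aemeasurable

/-- The pointwise bound by the square function. -/
lemma enorm_pow_four_le (hm : IsCutoff m) (f : 𝓢(R4, ℂ)) {ε : ℝ} (hε : 0 < ε) (x : R4)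
    (h : ∀ k : ℤ, ‖lpProj m k f x‖ ≤ 2 ^ k * ε) :
    ‖f x‖ₑ ^ 4 ≤ ENNReal.ofReal (256 * ε ^ 2)
      * ∑' k : ℤ, ENNReal.ofReal ((2 ^ k) ^ 2) * ‖f x - lowProj hm k f x‖ₑ ^ 2 := by
  by_cases hf : f x = 0
  · simp [hf]
  have hpos : 0 < ‖f x‖ / (4 * ε) := by positivity
  -- At this scale |S_k f(x)| ≤ 2·2^k ε ≤ |f(x)|/2, so the high part is at least |f(x)|/2, while
  -- |f(x)| < 8·2^k ε. Two powers of |f(x)| are spent on each bound, and 64·4 = 256.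
  obtain ⟨k, hk1, hk2⟩ := exists_mem_Ico_zpow hpos one_lt_two
  rw [le_div_iff₀ (by positivity)] at hk1
  rw [div_lt_iff₀ (by positivity), zpow_add_one₀ two_ne_zero] at hk2
  have h1 := norm_lowProj_le hm f x h k
  have h2 : ‖f x‖ ≤ ‖f x - lowProj hm k f x‖ + ‖lowProj hm k f x‖ := by
    simpa using norm_add_le (f x - lowProj hm k f x) (lowProj hm k f x)
  have h3 : ‖f x‖ ≤ 2 * ‖f x - lowProj hm k f x‖ := by linarith
  have h4 : ‖f x‖ ^ 4 ≤ 256 * ε ^ 2 * ((2 ^ k) ^ 2 * ‖f x - lowProj hm k f x‖ ^ 2) := by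
    calc ‖f x‖ ^ 4 = ‖f x‖ ^ 2 * ‖f x‖ ^ 2 := by ring
      _ ≤ (2 ^ k * 2 * (4 * ε)) ^ 2 * (2 * ‖f x - lowProj hm k f x‖) ^ 2 := by gcongr
      _ = _ := by ring
  calc ‖f x‖ₑ ^ 4 = ENNReal.ofReal (‖f x‖ ^ 4) := by
        rw [ENNReal.ofReal_pow (norm_nonneg _), ofReal_norm]
    _ ≤ _ := ENNReal.ofReal_le_ofReal h4
    _ = ENNReal.ofReal (256 * ε ^ 2)
        * (ENNReal.ofReal ((2 ^ k) ^ 2) * ‖f x - lowProj hm k f x‖ₑ ^ 2) := by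
        rw [ENNReal.ofReal_mul (by positivity : 0 ≤ 256 * ε ^ 2),
          ENNReal.ofReal_mul (by positivity : (0 : ℝ) ≤ (2 ^ k) ^ 2),
          ENNReal.ofReal_pow (norm_nonneg _), ofReal_norm]
    _ ≤ _ := by
        gcongr
        exact ENNReal.le_tsum k

/-- The refined Sobolev inequality for Schwartz functions. -/
lemma IsCutoff.exists_lintegral_pow_four_le (hm : IsCutoff m) : ∃ K : ℝ≥0, ∀ (f : 𝓢(R4, ℂ)) (ε : ℝ),
    0 < ε → (∀ k : ℤ, ∀ᵐ x, ‖lpProj m k f x‖ ≤ 2 ^ k * ε) →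
      ∫⁻ x, ‖f x‖ₑ ^ 4 ≤ K * ENNReal.ofReal (ε ^ 2) * ∑ j, ∫⁻ x, ‖partialD j f x‖ₑ ^ 2 := by
  obtain ⟨K, hK⟩ := hm.exists_squareFunction_le
  refine ⟨256 * K, fun f ε hε h => ?_⟩
  calc ∫⁻ x, ‖f x‖ₑ ^ 4 ≤ ∫⁻ x, ENNReal.ofReal (256 * ε ^ 2)
      * ∑' k : ℤ, ENNReal.ofReal ((2 ^ k) ^ 2) * ‖f x - lowProj hm k f x‖ₑ ^ 2 := by
        refine lintegral_mono_ae ?_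
        filter_upwards [ae_all_iff.2 h] with x hx
        exact enorm_pow_four_le hm f hε x hx
    _ = ENNReal.ofReal (256 * ε ^ 2) * ∑' k : ℤ, ENNReal.ofReal ((2 ^ k) ^ 2)
        * ∫⁻ x, ‖f x - lowProj hm k f x‖ₑ ^ 2 := by
        have hms : ∀ k : ℤ, Measurable fun x : R4 => ‖f x - lowProj hm k f x‖ₑ ^ 2 := fun k =>
          ((f.continuous.sub (lowProj hm k f).continuous).enorm.measurable.pow_const 2)
        rw [lintegral_const_mul' _ _ ENNReal.ofReal_ne_top, lintegral_tsum]
        · congr 1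
          refine tsum_congr fun k => ?_
          rw [lintegral_const_mul' _ _ ENNReal.ofReal_ne_top]
        · exact fun k => ((hms k).const_mul _).aemeasurable
    _ ≤ ENNReal.ofReal (256 * ε ^ 2) * (K * ∑ j, ∫⁻ x, ‖partialD j f x‖ₑ ^ 2) := by
        gcongr; exact hK f
    _ = _ := by
        rw [ENNReal.ofReal_mul (by norm_num)]
        push_cast
        simp only [ENNReal.ofReal_ofNat]
        ring

end SquareFunction

/-! ### Scaling of the kernels and Bernstein's inequality -/

section KernelBounds

variable {m : ℝ → ℝ}

/-- Scaling of the Littlewood-Paley kernels. -/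
lemma lpKernel_scaling (m : ℝ → ℝ) (k : ℤ) (x : R4) :
    lpKernel m k x = (((2 : ℝ) ^ k) ^ 4 : ℝ) • lpKernel m 0 ((2 : ℝ) ^ k • x) := by
  set a : ℝ := 2 ^ k with ha
  have ha0 : 0 < a := by positivity
  rw [lpKernel, lpKernel, Real.fourierInv_eq', Real.fourierInv_eq']
  set F : R4 → ℂ := fun v => Complex.exp (((2 * Real.pi * inner ℝ v (a • x) : ℝ) : ℂ) * Complex.I) •
    ((m (2 * Real.pi * ‖v‖ / 2 ^ (0 : ℤ)) - m (2 * Real.pi * ‖v‖ / 2 ^ ((0 : ℤ) - 1)) : ℝ) : ℂ)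
    with hF
  -- The substitution v ↦ 2^(-k) v in the Fourier integral produces the Jacobian 2^(4k).
  have h := Measure.integral_comp_smul (volume : Measure R4) F a⁻¹
  have hc : |((a⁻¹) ^ Module.finrank ℝ R4)⁻¹| = a ^ 4 := by
    rw [finrank_euclideanSpace, Fintype.card_fin, inv_pow, inv_inv, abs_of_pos (by positivity)]
  rw [hc] at h
  rw [← h]
  refine integral_congr_ae (Eventually.of_forall fun v => ?_)
  have e1 : inner ℝ (a⁻¹ • v) (a • x) = inner ℝ v x := by
    rw [inner_smul_left, inner_smul_right, conj_trivial, ← mul_assoc, inv_mul_cancel₀ ha0.ne',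
      one_mul]
  have e2 : ‖a⁻¹ • v‖ = ‖v‖ / a := by
    rw [norm_smul, norm_inv, Real.norm_eq_abs, abs_of_pos ha0, div_eq_inv_mul]
  simp only [hF, e1, e2]
  have e3 : 2 * Real.pi * ‖v‖ / a = 2 * Real.pi * (‖v‖ / a) / 1 := by ring
  have e4 : 2 * Real.pi * ‖v‖ / (a * 2⁻¹) = 2 * Real.pi * (‖v‖ / a) / (1 * 2⁻¹) := by
    field_simp
  rw [zpow_sub_one₀ two_ne_zero, zpow_sub_one₀ two_ne_zero, zpow_zero, ← ha, e3, e4]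

/-- The exponent dual to `4`. -/
abbrev fourDual : ℝ≥0∞ := (1 - (4 : ℝ≥0∞)⁻¹)⁻¹

instance holderTripleFourDual : ENNReal.HolderTriple fourDual 4 1 := ⟨by
  rw [inv_inv, inv_one]; exact tsub_add_cancel_of_le (by simp)⟩

lemma fourDual_ne_top : fourDual ≠ ⊤ := by
  rw [fourDual, ne_eq, ENNReal.inv_eq_top, tsub_eq_zero_iff_le, not_le]
  rw [ENNReal.inv_lt_one]
  norm_num

lemma one_div_fourDual_toReal : (1 / fourDual).toReal = 3 / 4 := by
  rw [fourDual, one_div, inv_inv, ENNReal.toReal_sub_of_le (by simp) (by simp)]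
  norm_num

lemma lpKernel_memLp (hm : IsCutoff m) (k : ℤ) (p : ℝ≥0∞) :
    MemLp (lpKernel m k) p (volume : Measure R4) := by
  rw [lpKernel_eq hm]; exact SchwartzMap.memLp _ p volume

/-- In L^{4/3} the amplitude 2^(4k) meets the dilation factor 2^(-4k·3/4), leaving 2^k. -/
lemma eLpNorm_lpKernel (hm : IsCutoff m) (k : ℤ) :
    eLpNorm (lpKernel m k) fourDual volume
      = ENNReal.ofReal (2 ^ k) * eLpNorm (lpKernel m 0) fourDual volume := by
  set a : ℝ := 2 ^ k with ha
  have ha0 : 0 < a := by positivity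
  have h1 : lpKernel m k = (a ^ 4 : ℝ) • (lpKernel m 0 ∘ fun x => a • x) := by
    ext x; exact lpKernel_scaling m k x
  have hmeas : Measurable fun x : R4 => a • x := measurable_const_smul a
  have h2 := eLpNorm_map_measure (μ := (volume : Measure R4)) (p := fourDual)
    (f := fun x => a • x) (g := lpKernel m 0)
    ((lpKernel_eq hm 0 ▸ SchwartzMap.continuous _ :
      Continuous (lpKernel m 0)).aestronglyMeasurable) hmeas.aemeasurable
  rw [Measure.map_addHaar_smul _ ha0.ne', eLpNorm_smul_measure_of_ne_top fourDual_ne_top,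
    one_div_fourDual_toReal] at h2
  rw [h1, eLpNorm_const_smul, ← h2, smul_eq_mul, ← mul_assoc]
  congr 1
  rw [finrank_euclideanSpace, Fintype.card_fin, abs_of_pos (by positivity),
    ENNReal.ofReal_rpow_of_pos (by positivity), ← ofReal_norm, ← ENNReal.ofReal_mul (norm_nonneg _),
    Real.norm_eq_abs, abs_of_pos (by positivity)]
  congr 1
  rw [← Real.rpow_natCast a 4, ← Real.rpow_neg ha0.le, ← Real.rpow_mul ha0.le,
    ← Real.rpow_add ha0]
  norm_num

lemma memLp_lpKernel_sub (hm : IsCutoff m) (k : ℤ) (x : R4) :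
    MemLp (fun y => lpKernel m k (x - y)) fourDual (volume : Measure R4) :=
  (lpKernel_memLp hm k fourDual).comp_measurePreserving (volume.measurePreserving_sub_left x)

lemma integrable_lpProj (hm : IsCutoff m) (k : ℤ) (u : L4 ℂ) (x : R4) :
    Integrable fun y => lpKernel m k (x - y) * u y :=
  memLp_one_iff_integrable.1 ((Lp.memLp u).mul' (memLp_lpKernel_sub hm k x))

lemma lpProj_sub (hm : IsCutoff m) (k : ℤ) (u v : L4 ℂ) (x : R4) :
    lpProj m k (u - v : L4 ℂ) x = lpProj m k u x - lpProj m k v x := by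
  unfold lpProj
  rw [← integral_sub (integrable_lpProj hm k u x) (integrable_lpProj hm k v x)]
  refine integral_congr_ae ?_
  filter_upwards [Lp.coeFn_sub u v] with y hy
  rw [hy, Pi.sub_apply, mul_sub]

/-- Bernstein's inequality `‖P_k u‖_{L^∞} ≤ C 2^k ‖u‖_{L⁴}`. -/
lemma IsCutoff.exists_norm_lpProj_le (hm : IsCutoff m) : ∃ C : ℝ, 0 ≤ C ∧ ∀ (k : ℤ) (u : L4 ℂ)
    (x : R4), ‖lpProj m k u x‖ ≤ 2 ^ k * (C * ‖u‖) := by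
  refine ⟨(eLpNorm (lpKernel m 0) fourDual volume).toReal, ENNReal.toReal_nonneg,
    fun k u x => ?_⟩
  have h1 : ‖lpProj m k u x‖ₑ
      ≤ ENNReal.ofReal (2 ^ k) * eLpNorm (lpKernel m 0) fourDual volume * eLpNorm u 4 volume :=
    calc ‖lpProj m k u x‖ₑ ≤ ∫⁻ y, ‖lpKernel m k (x - y) * u y‖ₑ :=
          enorm_integral_le_lintegral_enorm _
      _ = eLpNorm ((fun y => lpKernel m k (x - y)) • (u : R4 → ℂ)) 1 volume := by
          rw [eLpNorm_one_eq_lintegral_enorm]; rfl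
      _ ≤ eLpNorm (fun y => lpKernel m k (x - y)) fourDual volume * eLpNorm u 4 volume :=
          eLpNorm_smul_le_mul_eLpNorm (Lp.aestronglyMeasurable u) (memLp_lpKernel_sub hm k x).1
      _ = _ := by
          rw [← eLpNorm_lpKernel hm k]
          congr 1
          exact eLpNorm_comp_measurePreserving (lpKernel_memLp hm k fourDual).1
            (volume.measurePreserving_sub_left x)
  have h2 := ENNReal.toReal_mono (ENNReal.mul_ne_top (ENNReal.mul_ne_top ENNReal.ofReal_ne_top
    (lpKernel_memLp hm 0 fourDual).2.ne) (Lp.memLp u).2.ne) h1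
  rw [toReal_enorm, ENNReal.toReal_mul, ENNReal.toReal_mul, ENNReal.toReal_ofReal (by positivity),
    ← Lp.norm_def, mul_assoc] at h2
  exact h2

end KernelBounds

/-! ### The refined Sobolev inequality on Ḣ¹ -/

section RefinedSobolev

variable {m : ℝ → ℝ}

lemma eLpNorm_pow_eq_lintegral {F : Type} [NormedAddCommGroup F] {f : R4 → F} (n : ℕ) [NeZero n] :
    eLpNorm f n volume ^ n = ∫⁻ x, ‖f x‖ₑ ^ n := by
  have h := eLpNorm_nnreal_pow_eq_lintegral (μ := (volume : Measure R4)) (f := f) (p := (n : ℝ≥0))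
    (by exact_mod_cast NeZero.ne n)
  simpa using h

lemma IsCutoff.exists_norm_testH_pow_four_le (hm : IsCutoff m) : ∃ K : ℝ, 0 ≤ K ∧
    ∀ (f : R4 → ℂ) (hf : IsTestFun f) (ε : ℝ), 0 < ε →
      (∀ k : ℤ, ∀ᵐ x, ‖lpProj m k f x‖ ≤ 2 ^ k * ε) →
      ‖(testH f hf).fn‖ ^ 4 ≤ K * ε ^ 2 * ‖testH f hf‖ ^ 2 := by
  obtain ⟨K, hK⟩ := hm.exists_lintegral_pow_four_le
  refine ⟨K, K.2, fun f hf ε hε h => ?_⟩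
  have h1 := hK (hf.2.toSchwartzMap hf.1) ε hε h
  change ∫⁻ x, ‖f x‖ₑ ^ 4 ≤ K * ENNReal.ofReal (ε ^ 2) * ∑ j, ∫⁻ x, ‖partialD j f x‖ₑ ^ 2 at h1
  have h2 := eLpNorm_pow_eq_lintegral (f := f) 4
  have h3 : ∀ j, eLpNorm (partialD j f) 2 volume ^ 2 = ∫⁻ x, ‖partialD j f x‖ₑ ^ 2 := fun j =>
    eLpNorm_pow_eq_lintegral 2
  simp only [← h3] at h1
  rw [← h2] at h1
  have hfin : ∀ j, eLpNorm (partialD j f) 2 volume ^ 2 ≠ ⊤ := fun j =>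
    ENNReal.pow_ne_top ((hf.partialD j).memLp 2).2.ne
  have h4 := ENNReal.toReal_mono (ENNReal.mul_ne_top
    (ENNReal.mul_ne_top ENNReal.coe_ne_top ENNReal.ofReal_ne_top)
    (ENNReal.sum_ne_top.2 fun j _ => hfin j)) h1
  rw [ENNReal.toReal_mul, ENNReal.toReal_mul, ENNReal.toReal_ofReal (sq_nonneg _),
    ENNReal.toReal_sum fun j _ => hfin j, ENNReal.toReal_pow] at h4
  simp only [ENNReal.toReal_pow, ENNReal.coe_toReal] at h4
  rw [HDot1.norm_sq_eq, testH_fn, Lp.norm_toLp]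
  simp only [testH_D, Lp.norm_toLp]
  exact_mod_cast h4

/-- The refined Sobolev inequality `‖φ‖_{L⁴}⁴ ≤ K ε² ‖∇φ‖²` for `ε = sup_k 2^{-k} ‖P_kφ‖_{L^∞}`. -/
lemma IsCutoff.exists_norm_fn_pow_four_le (hm : IsCutoff m) : ∃ K : ℝ, 0 ≤ K ∧
    ∀ (φ : HDot1 ℂ) (ε : ℝ), 0 < ε →
      (∀ k : ℤ, eLpNorm (lpProj m k φ.fn) ⊤ volume ≤ ENNReal.ofReal (2 ^ k * ε)) →
      ‖φ.fn‖ ^ 4 ≤ K * ε ^ 2 * ‖φ‖ ^ 2 := by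
  obtain ⟨K, hK0, hK⟩ := hm.exists_norm_testH_pow_four_le
  obtain ⟨C, hC0, hC⟩ := hm.exists_norm_lpProj_le
  refine ⟨K, hK0, fun φ ε hε h => ?_⟩
  obtain ⟨f, hf, hlim⟩ := φ.exists_testH_tendsto
  have hfn : Tendsto (fun n => (testH (f n) (hf n)).fn) atTop (𝓝 φ.fn) :=
    ((embL ℂ).continuous.tendsto φ).comp hlim
  -- By Bernstein the approximants satisfy the dispersion bound with ε + C‖fₙ - φ‖_{L⁴}, which tends
  -- to ε.
  have hδ : Tendsto (fun n => ε + C * ‖(testH (f n) (hf n)).fn - φ.fn‖) atTop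
      (𝓝 (ε + C * 0)) :=
    ((tendsto_iff_norm_sub_tendsto_zero.1 hfn).const_mul C).const_add ε
  rw [mul_zero, add_zero] at hδ
  refine le_of_tendsto_of_tendsto' (hfn.norm.pow 4)
    (((hδ.pow 2).const_mul K).mul (hlim.norm.pow 2)) fun n => ?_
  refine hK (f n) (hf n) _ (by positivity) fun k => ?_
  have hae : ∀ᵐ x, ‖lpProj m k φ.fn x‖ₑ ≤ eLpNorm (lpProj m k φ.fn) ⊤ volume := by
    rw [eLpNorm_exponent_top]
    exact ae_le_eLpNormEssSup
  filter_upwards [hae] with x hx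
  have h1 : ‖lpProj m k φ.fn x‖ ≤ 2 ^ k * ε := by
    have h2 := hx.trans (h k)
    rw [← ofReal_norm] at h2
    exact (ENNReal.ofReal_le_ofReal_iff (by positivity)).1 h2
  have h3 : lpProj m k (f n) x = lpProj m k (testH (f n) (hf n)).fn x := by
    refine integral_congr_ae ?_
    filter_upwards [testH_fn_ae (f n) (hf n)] with y hy
    rw [hy]
  have h4 := lpProj_sub hm k (testH (f n) (hf n)).fn φ.fn x
  have h5 : lpProj m k (f n) x = lpProj m k φ.fn x
      + lpProj m k ((testH (f n) (hf n)).fn - φ.fn : L4 ℂ) x := by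
    rw [h4, h3]; ring
  rw [h5, mul_add]
  exact (norm_add_le _ _).trans (add_le_add h1 (hC k _ x))

lemma eLpNorm_lpProj_le_of_edNorm {U : LinData} {ε : ℝ}
    (h : edNorm m U ≤ ENNReal.ofReal ε) (k : ℤ) :
    eLpNorm (lpProj m k U.φ.fn) ⊤ volume ≤ ENNReal.ofReal (2 ^ k * ε) := by
  have h1 : ENNReal.ofReal (2 ^ (-k)) * eLpNorm (lpProj m k U.φ.fn) ⊤ volume
      ≤ ENNReal.ofReal ε :=
    le_trans (mul_le_mul_right (le_max_left _ _) _) ((le_iSup (fun k : ℤ =>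
      ENNReal.ofReal (2 ^ (-k)) * max (eLpNorm (lpProj m k U.φ.fn) ⊤ volume)
        (ENNReal.ofReal (2 ^ (-k)) * eLpNorm (lpProj m k U.φt) ⊤ volume)) k).trans h)
  have h2 : ENNReal.ofReal (2 ^ k) * ENNReal.ofReal (2 ^ (-k)) = 1 := by
    rw [← ENNReal.ofReal_mul (by positivity), ← zpow_add₀ two_ne_zero]; simp
  calc eLpNorm (lpProj m k U.φ.fn) ⊤ volume
      = ENNReal.ofReal (2 ^ k) * (ENNReal.ofReal (2 ^ (-k))
        * eLpNorm (lpProj m k U.φ.fn) ⊤ volume) := by rw [← mul_assoc, h2, one_mul]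
    _ ≤ ENNReal.ofReal (2 ^ k) * ENNReal.ofReal ε := by gcongr
    _ = _ := (ENNReal.ofReal_mul (by positivity)).symm

end RefinedSobolev

/-! ### Comparison of the energies under small energy dispersion -/

lemma energy_nonneg (d : CovData) : 0 ≤ energy d := by
  have h1 : 0 ≤ ∑ j, ‖d.e j‖ ^ 2 := Finset.sum_nonneg fun _ _ => sq_nonneg _
  have h2 : 0 ≤ ∑ j, ∑ k, ‖(d.a k).D j - (d.a j).D k‖ ^ 2 :=
    Finset.sum_nonneg fun _ _ => Finset.sum_nonneg fun _ _ => sq_nonneg _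
  have h3 : 0 ≤ ∑ j, ‖covD d.a d.f j‖ ^ 2 := Finset.sum_nonneg fun _ _ => sq_nonneg _
  have h4 := sq_nonneg ‖d.g‖
  rw [energy]
  linarith

lemma norm_φ_sq_le (U : LinData) : ‖U.φ‖ ^ 2 ≤ 2 * linEnergy U := by
  have h1 : 0 ≤ ∑ j, ‖U.At j‖ ^ 2 := Finset.sum_nonneg fun _ _ => sq_nonneg _
  have h2 : 0 ≤ ∑ j, ‖U.A j‖ ^ 2 := Finset.sum_nonneg fun _ _ => sq_nonneg _
  have h3 := sq_nonneg ‖U.φt‖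
  rw [linEnergy_eq]
  linarith

/-- Comparison of the two energies under small energy dispersion. -/
lemma IsCutoff.exists_energy_comparison {m : ℝ → ℝ} (hm : IsCutoff m) (E : ℝ) :
    ∃ ε₀ : ℝ, 0 < ε₀ ∧ ∃ C : ℝ, 0 < C ∧
      ∀ (U : LinData) (A0 : HDot1 ℝ), U.IsCoulomb → SolvesA0 U A0 →
        energy (toCovData U A0) ≤ E →
        ∀ ε : ℝ, 0 < ε → ε ≤ ε₀ → edNorm m U ≤ ENNReal.ofReal ε →
          |energy (toCovData U A0) - linEnergy U| ≤ C * ε ^ (1 / 4 : ℝ) := by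
  obtain ⟨C₁, hC₁, hlin⟩ := exists_linEnergy_le
  obtain ⟨S, hS, hdiff⟩ := exists_energy_sub_linEnergy_le
  obtain ⟨K, hK0, hK⟩ := hm.exists_norm_fn_pow_four_le
  -- The absolute value covers negative E.
  set L₀ : ℝ := C₁ * (|E| + |E| ^ 2) with hL₀
  have hL₀0 : 0 ≤ L₀ := by positivity
  set X : ℝ := 1 + K * (2 * L₀) with hX
  have hX1 : 1 ≤ X := by
    have : 0 ≤ K * (2 * L₀) := by positivity
    linarith
  have hX0 : 0 < X := by linarith
  -- The threshold 1 suffices, since smallness of ε enters only through ε² ≤ ε and t² ≤ t; the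
  -- summand 1 keeps the constant positive.
  refine ⟨1, one_pos, S * L₀ * (X + X ^ 2) + 1, by positivity,
    fun U A0 hU hA hE ε hε hε1 hed => ?_⟩
  set t : ℝ := ε ^ (1 / 4 : ℝ) with ht
  have ht0 : 0 < t := Real.rpow_pos_of_pos hε _
  have ht1 : t ≤ 1 := Real.rpow_le_one hε.le hε1 (by norm_num)
  have ht4 : t ^ 4 = ε := by
    rw [ht, ← Real.rpow_natCast, ← Real.rpow_mul hε.le]; norm_num
  have hL : linEnergy U ≤ L₀ := by
    refine (hlin U A0 hU).trans ?_
    have h0 := energy_nonneg (toCovData U A0)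
    have h1 : energy (toCovData U A0) ≤ |E| := hE.trans (le_abs_self E)
    rw [hL₀]
    gcongr
  -- The refined inequality gives ‖φ‖_{L⁴} of order ε^(1/2); only ε^(1/4) is kept, and X ≥ 1 allows
  -- X to be replaced by X⁴.
  have hp4 : ‖U.φ.fn‖ ^ 4 ≤ (X * t) ^ 4 := by
    have h1 := hK U.φ ε hε (eLpNorm_lpProj_le_of_edNorm hed)
    have h2 : ‖U.φ‖ ^ 2 ≤ 2 * L₀ := (norm_φ_sq_le U).trans (by linarith)
    calc ‖U.φ.fn‖ ^ 4 ≤ K * ε ^ 2 * ‖U.φ‖ ^ 2 := h1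
      _ ≤ K * ε ^ 2 * (2 * L₀) := by gcongr
      _ = K * (2 * L₀) * ε ^ 2 := by ring
      _ ≤ X * ε := by
          have h3 : ε ^ 2 ≤ ε := by nlinarith
          have h4 : K * (2 * L₀) ≤ X := by linarith
          gcongr
      _ ≤ X ^ 4 * ε := by
          have h5 : X ≤ X ^ 4 := le_self_pow₀ hX1 (by norm_num)
          gcongr
      _ = (X * t) ^ 4 := by rw [mul_pow, ht4]
  have hp : ‖U.φ.fn‖ ≤ X * t := le_of_pow_le_pow_left₀ (by norm_num) (by positivity) hp4
  have hsum : ‖U.φ.fn‖ + ‖U.φ.fn‖ ^ 2 ≤ (X + X ^ 2) * t := by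
    have h1 : ‖U.φ.fn‖ ^ 2 ≤ (X * t) ^ 2 := by gcongr
    have h2 : (X * t) ^ 2 ≤ X ^ 2 * t := by
      rw [mul_pow]
      have : t ^ 2 ≤ t := by nlinarith
      gcongr
    linarith
  calc |energy (toCovData U A0) - linEnergy U|
      ≤ S * linEnergy U * (‖U.φ.fn‖ + ‖U.φ.fn‖ ^ 2) := hdiff U A0 hU hA
    _ ≤ S * L₀ * ((X + X ^ 2) * t) := by gcongr
    _ ≤ (S * L₀ * (X + X ^ 2) + 1) * t := by nlinarith

end MKG

end

/-! ### The proposition -/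

theorem proposition2p1 :
    -- (1) from a finite energy Coulomb data set to `(A_x[0], φ[0])`
    (∃ C : ℝ, 0 < C ∧ ∀ d : MKG.CovData, d.IsCoulombDataSet →
      (∃! p : MKG.LinData × MKG.HDot1 ℝ,
        p.1.IsCoulomb ∧ MKG.SolvesA0 p.1 p.2 ∧ MKG.toCovData p.1 p.2 = d) ∧
      ∀ (U : MKG.LinData) (A0 : MKG.HDot1 ℝ),
        U.IsCoulomb → MKG.SolvesA0 U A0 → MKG.toCovData U A0 = d →
          MKG.linEnergy U ≤ C * (MKG.energy d + MKG.energy d ^ 2)) ∧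
    -- (2) unique solvability for `(A₀, ∂ₜA₀)`, smooth dependence, and the converse energy bound
    (∃ S : MKG.LinData → MKG.HDot1 ℝ × MKG.L2 ℝ,
      (∀ U, MKG.SolvesA0 U (S U).1 ∧ MKG.SolvesDtA0 U (S U).2) ∧
      (∀ U A0 B, MKG.SolvesA0 U A0 → MKG.SolvesDtA0 U B → (A0, B) = S U) ∧
      ContDiff ℝ ((⊤ : ℕ∞) : WithTop ℕ∞) S ∧
      ContDiff ℝ ((⊤ : ℕ∞) : WithTop ℕ∞) (fun U => MKG.energy (MKG.toCovData U (S U).1)) ∧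
      ∃ C : ℝ, 0 < C ∧ ∀ U, MKG.energy (MKG.toCovData U (S U).1)
        ≤ C * (MKG.linEnergy U + MKG.linEnergy U ^ 2)) ∧
    -- (3) comparison of the energies under small energy dispersion
    (∀ m : ℝ → ℝ, MKG.IsCutoff m → ∀ E : ℝ, ∃ ε₀ : ℝ, 0 < ε₀ ∧ ∃ C : ℝ, 0 < C ∧
      ∀ (U : MKG.LinData) (A0 : MKG.HDot1 ℝ), U.IsCoulomb → MKG.SolvesA0 U A0 →
        MKG.energy (MKG.toCovData U A0) ≤ E →
        ∀ ε : ℝ, 0 < ε → ε ≤ ε₀ → MKG.edNorm m U ≤ ENNReal.ofReal ε →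
          |MKG.energy (MKG.toCovData U A0) - MKG.linEnergy U| ≤ C * ε ^ (1 / 4 : ℝ)) := by
  refine ⟨?_, ?_, fun m hm E => hm.exists_energy_comparison E⟩
  · obtain ⟨C, hC, h⟩ := MKG.exists_linEnergy_le
    refine ⟨C, hC, fun d hd => ⟨MKG.existsUnique_linData hd, fun U A0 hU _ hd' => ?_⟩⟩
    rw [← hd']
    exact h U A0 hU
  · obtain ⟨C, hC, h⟩ := MKG.exists_energy_le
    refine ⟨fun U => (MKG.solA0 U, MKG.solDtA0 U),
      fun U => ⟨(MKG.solvesA0_iff_eq_solA0 U _).2 rfl, MKG.solvesDtA0_solDtA0 U⟩,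
      fun U A0 B hA hB => Prod.ext ((MKG.solvesA0_iff_eq_solA0 U A0).1 hA)
        ((MKG.solvesDtA0_iff U B).1 hB),
      MKG.contDiff_solA0.prodMk MKG.contDiff_solDtA0, MKG.contDiff_energy,
      C, hC, fun U => h U _ ((MKG.solvesA0_iff_eq_solA0 U _).2 rfl)⟩
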